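/- Let $(M,\alpha)$ be a smooth 3-dimensional contact manifold with contact structure $\xi=\ker\alpha$, Reeb vector field $X$ (determined by $\alpha(X)=1$, $\iota_Xd\alpha=0$) and Reeb flow $\phi^t_X$. For a $T$-periodic Reeb orbit $P$ ($\dot P=X(P)$, $P(t+T)=P(t)$, $T>0$ not necessarily minimal) and a continuous trivialization $\Phi(t):\mathbb R^2\to\xi_{P(t)}$ with $\Phi(t+T)=\Phi(t)$ and $\Phi(t)^*d\alpha=dx\wedge dy$ (for instance a unitary one), put $\Psi_P(t)=\Phi(t)^{-1}\circ T\phi_X^t(P(0))\circ\Phi(0)$. For $m\in\mathbb N=\{1,2,\dots\}$ let $P^m$ be the $m$-fold iterate, i.e. $P$ regarded as an $mT$-periodic orbit, trivialized by the same $\Phi$. The Conley–Zehnder index $\mu^\Phi_{\rm CZ}(P^m)$ is the Robbin–Salamon index of the path of graphs of $\Psi_P(t)$, $0\le t\le mT$, relative to the diagonal in $(\mathbb R^2\times\mathbb R^2,(-\omega_0)\oplus\omega_0)$, where $\omega_0=dx\wedge dy$ (no nondegeneracy is required; in the degenerate case this is the half-integer valued Robbin–Salamon index). Let $\rho$ be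 a smooth involution of $M$ with $\rho^*\alpha=-\alpha$. Let $C:[0,T/2]\to M$ be a Reeb chord, i.e. an integral curve of $X$ with $T>0$ and $C(0),C(T/2)\in\mathrm{Fix}\,\rho$. It extends to a $T$-periodic curve on $\mathbb R$ by $t\mapsto\rho(C(T-t))$ on $[T/2,T]$; the iterate $C^m$ is the restriction of this curve to $[0,mT/2]$. Let $\Phi$ be a trivialization along it as above which is moreover symmetric, $T\rho\circ\Phi(t)=\Phi(-t)\circ I$ with $I(x,y)=(x,-y)$, and let $\Psi$ be the corresponding linearized flow. Then $\mu^\Phi_{\rm RS}(C^m)$ is the Robbin–Salamon index of the path of lines $\Psi(t)(\mathbb R\times 0)$, $0\le t\le mT/2$, relative to $\mathbb R\times 0$ in $(\mathbb R^2,\omega_0)$. Then the following hold. (1) For every periodic Reeb orbit $(P,T)$, every such $\Phi$ and every $m\in\mathbb N$: $$\mu^\Phi_{\rm CZ}(P)<1\Rightarrow\mu^\Phi_{\rm CZ}(P^m)<1,\qquad \mu^\Phi_{\rm CZ}(P)\ge1\Rightarrow\mu^\Phi_{\rm CZ}(P^m)\ge1,\qquad \mu^\Phi_{\rm CZ}(P)\ge3\Rightarrow\mu^\Phi_{\rm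 CZ}(P^m)\ge2m+1.$$ (2) For every $\rho$ as above, every Reeb chord $(C,T/2)$ with end points in $\mathrm{Fix}\,\rho$, every such symmetric $\Phi$ and every $m\in\mathbb N$: $$\mu^\Phi_{\rm RS}(C)<\tfrac12\Rightarrow\mu^\Phi_{\rm RS}(C^m)<\tfrac12,\qquad \mu^\Phi_{\rm RS}(C)\ge\tfrac12\Rightarrow\mu^\Phi_{\rm RS}(C^m)\ge\tfrac12,\qquad \mu^\Phi_{\rm RS}(C)\ge\tfrac32\Rightarrow\mu^\Phi_{\rm RS}(C^m)\ge\tfrac{2m+1}2.$$ (3) If $(P,T)$ is a symmetric periodic Reeb orbit with $P=C^2$ for such a chord $(C,T/2)$, then for every symmetric $\Phi$ as above $$\mu^\Phi_{\rm CZ}(P)\ge3\Rightarrow\mu^\Phi_{\rm RS}(C)\ge\tfrac32.$$ -/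

import Mathlib

open scoped Manifold ContDiff

noncomputable section

/-! ### Lagrangian subspaces and the Robbin-Salamon index -/

namespace RobbinSalamon

variable {F : Type*} [AddCommGroup F] [Module ℝ F]

/-- A subspace is Lagrangian if it equals its symplectic complement. -/
def IsLagrangian (B : LinearMap.BilinForm ℝ F) (L : Submodule ℝ F) : Prop :=
  B.orthogonal L = L

/-- If `L` is transverse to `W` then `L` is the graph of a linear map `A : V → W` over any
complement `V` of `W`, and this is the quadratic form `v ↦ B (v, A v)` on `V`.
Here `v + A v` is the projection of `v` to `L` along `W`, and `B (v, v) = 0`. -/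
def graphForm (B : LinearMap.BilinForm ℝ F) (V W L : Submodule ℝ F) (h : IsCompl L W) :
    QuadraticForm ℝ V :=
  LinearMap.BilinMap.toQuadraticMap
    (LinearMap.compl₁₂ B V.subtype (L.projection W h ∘ₗ V.subtype - V.subtype))

open scoped Classical in
/-- The signature (number of positive minus number of negative squares) of `graphForm`. -/
def graphSign (B : LinearMap.BilinForm ℝ F) (V W L : Submodule ℝ F) : ℤ :=
  if h : IsCompl L W then
    (sigPos (graphForm B V W L h) : ℤ) - sigNeg (graphForm B V W L h)
  else 0

/-- `r` is the Robbin-Salamon index of the path `Λ` of Lagrangians on `[a, b]` relative to the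
Lagrangian `V`, computed by catenation and localization: there are a subdivision
`a = t 0 ≤ ⋯ ≤ t N = b` and Lagrangian complements `W i` of `V` such that `Λ s` is transverse to
`W i` for `t i ≤ s ≤ t (i + 1)`; there `Λ s` is the graph of a linear map `A s : V → W i`, and this
piece contributes `(sign A (t (i + 1)) - sign A (t i)) / 2`. -/
def HasIndex (B : LinearMap.BilinForm ℝ F) (Λ : ℝ → Submodule ℝ F) (V : Submodule ℝ F)
    (a b r : ℝ) : Prop :=
  ∃ (N : ℕ) (t : ℕ → ℝ) (W : ℕ → Submodule ℝ F),
    t 0 = a ∧ t N = b ∧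
    (∀ i < N, t i ≤ t (i + 1) ∧ IsLagrangian B (W i) ∧ IsCompl V (W i) ∧
      ∀ s ∈ Set.Icc (t i) (t (i + 1)), IsCompl (Λ s) (W i)) ∧
    r = ∑ i ∈ Finset.range N,
      ((graphSign B V (W i) (Λ (t (i + 1))) : ℝ) - (graphSign B V (W i) (Λ (t i)) : ℝ)) / 2

open scoped Classical in
/-- The Robbin-Salamon index of the path `Λ` of Lagrangians on `[a, b]` relative to `V`. -/
def index (B : LinearMap.BilinForm ℝ F) (Λ : ℝ → Submodule ℝ F) (V : Submodule ℝ F)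
    (a b : ℝ) : ℝ :=
  if h : ∃ r, HasIndex B Λ V a b r then h.choose else 0

/-- The standard symplectic form `dx ∧ dy` on the plane. -/
def omegaStd : LinearMap.BilinForm ℝ (ℝ × ℝ) :=
  LinearMap.mk₂ ℝ (fun u v => u.1 * v.2 - u.2 * v.1)
    (by intros; simp only [Prod.fst_add, Prod.snd_add]; ring)
    (by intros; simp only [Prod.smul_fst, Prod.smul_snd, smul_eq_mul]; ring)
    (by intros; simp only [Prod.fst_add, Prod.snd_add]; ring)
    (by intros; simp only [Prod.smul_fst, Prod.smul_snd, smul_eq_mul]; ring)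

/-- The symplectic form `(-omegaStd) ⊕ omegaStd` on `ℝ² × ℝ²`, for which graphs of symplectic maps are
Lagrangian. -/
def omegaGraph : LinearMap.BilinForm ℝ ((ℝ × ℝ) × (ℝ × ℝ)) :=
  -(omegaStd.compl₁₂ (LinearMap.fst ℝ (ℝ × ℝ) (ℝ × ℝ)) (LinearMap.fst ℝ (ℝ × ℝ) (ℝ × ℝ))) +
    omegaStd.compl₁₂ (LinearMap.snd ℝ (ℝ × ℝ) (ℝ × ℝ)) (LinearMap.snd ℝ (ℝ × ℝ) (ℝ × ℝ))

/-- The real axis in the plane. -/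
def realAxis : Submodule ℝ (ℝ × ℝ) := LinearMap.ker (LinearMap.snd ℝ ℝ ℝ)

/-- The diagonal in `ℝ² × ℝ²`. -/
def diagonal : Submodule ℝ ((ℝ × ℝ) × (ℝ × ℝ)) :=
  LinearMap.graph (LinearMap.id : (ℝ × ℝ) →ₗ[ℝ] (ℝ × ℝ))

/-- The Conley-Zehnder index of `Ψ` on `[0, T]`: the Robbin-Salamon index of the path of graphs
relative to the diagonal. -/
def conleyZehnder (Ψ : ℝ → (ℝ × ℝ) →ₗ[ℝ] (ℝ × ℝ)) (T : ℝ) : ℝ :=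
  index omegaGraph (fun t => LinearMap.graph (Ψ t)) diagonal 0 T

/-- The Robbin-Salamon index of the path `Ψ(t)ℝ`, `t ∈ [0, T]`, relative to the real axis. -/
def realAxisIndex (Ψ : ℝ → (ℝ × ℝ) →ₗ[ℝ] (ℝ × ℝ)) (T : ℝ) : ℝ :=
  index omegaStd (fun t => realAxis.map (Ψ t)) realAxis 0 T

end RobbinSalamon

/-! ### Contact forms, the Reeb flow, orbits and chords -/

namespace RealContact

section Form

variable {E : Type*} [NormedAddCommGroup E] [NormedSpace ℝ E]
  {M : Type*} [TopologicalSpace M] [ChartedSpace E M]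

/-- The one-form `α` written in the chart at `p`, i.e. its pullback under the inverse chart. -/
def chartForm (α : ∀ p : M, TangentSpace 𝓘(ℝ, E) p →L[ℝ] ℝ) (p : M) (x : E) : E →L[ℝ] ℝ :=
  (α ((extChartAt 𝓘(ℝ, E) p).symm x)).comp
    (mfderiv 𝓘(ℝ, E) 𝓘(ℝ, E) (extChartAt 𝓘(ℝ, E) p).symm x)

/-- The exterior derivative of the one-form `α` at `p`, evaluated on two tangent vectors:
`dα (v, w) = ∂_v (α w) - ∂_w (α v)` in the chart at `p`. -/
def extD (α : ∀ p : M, TangentSpace 𝓘(ℝ, E) p →L[ℝ] ℝ) (p : M)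
    (v w : TangentSpace 𝓘(ℝ, E) p) : ℝ :=
  let x : E := extChartAt 𝓘(ℝ, E) p p
  let v' : E := mfderiv 𝓘(ℝ, E) 𝓘(ℝ, E) (extChartAt 𝓘(ℝ, E) p) p v
  let w' : E := mfderiv 𝓘(ℝ, E) 𝓘(ℝ, E) (extChartAt 𝓘(ℝ, E) p) p w
  fderiv ℝ (chartForm α p) x v' w' - fderiv ℝ (chartForm α p) x w' v'

/-- A smooth one-form, nowhere zero, whose exterior derivative is nondegenerate on its kernel. -/
structure IsContactForm [IsManifold 𝓘(ℝ, E) ∞ M]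
    (α : ∀ p : M, TangentSpace 𝓘(ℝ, E) p →L[ℝ] ℝ) :
    Prop where
  smooth : ContMDiff 𝓘(ℝ, E).tangent 𝓘(ℝ, ℝ) ∞
    (fun v : TangentBundle 𝓘(ℝ, E) M => α v.proj v.snd)
  ne_zero : ∀ p, α p ≠ 0
  nondegenerate : ∀ p v, α p v = 0 → (∀ w, α p w = 0 → extD α p v w = 0) → v = 0

/-- The Reeb vector field: the vector `X` with `α X = 1` and `dα (X, ·) = 0`. -/
def reebField (α : ∀ p : M, TangentSpace 𝓘(ℝ, E) p →L[ℝ] ℝ) (p : M) : TangentSpace 𝓘(ℝ, E) p :=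
  Classical.epsilon fun X => α p X = 1 ∧ ∀ w, extD α p X w = 0

/-- `φ : D → M` is the maximal smooth flow of the vector field `X`. -/
structure IsMaximalFlow (X : ∀ p : M, TangentSpace 𝓘(ℝ, E) p) (D : Set (ℝ × M))
    (φ : ℝ → M → M) : Prop where
  isOpen : IsOpen D
  zero_mem : ∀ p, ((0 : ℝ), p) ∈ D
  ordConnected : ∀ p, {t : ℝ | (t, p) ∈ D}.OrdConnected
  smooth : ContMDiffOn (𝓘(ℝ, ℝ).prod 𝓘(ℝ, E)) 𝓘(ℝ, E) ∞ (fun x : ℝ × M => φ x.1 x.2) D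
  map_zero : ∀ p, φ 0 p = p
  integral : ∀ p, IsMIntegralCurveOn (I := 𝓘(ℝ, E)) (fun t => φ t p) X {t : ℝ | (t, p) ∈ D}
  maximal : ∀ (γ : ℝ → M) (a b : ℝ), a < 0 → 0 < b →
    IsMIntegralCurveOn (I := 𝓘(ℝ, E)) γ X (Set.Ioo a b) → ∀ t ∈ Set.Ioo a b, (t, γ 0) ∈ D

/-- A `T`-periodic orbit of the Reeb field (`T` need not be the minimal period). The `m`-th iterate
of `(P, T)` is `(P, m * T)`. -/
structure IsPeriodicOrbit (α : ∀ p : M, TangentSpace 𝓘(ℝ, E) p →L[ℝ] ℝ) (P : ℝ → M) (T : ℝ) :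
    Prop where
  pos : 0 < T
  integral : IsMIntegralCurve (I := 𝓘(ℝ, E)) P (reebField α)
  periodic : Function.Periodic P T

/-- A smooth involution with `ρ^* α = -α`. -/
structure IsRealStructure (α : ∀ p : M, TangentSpace 𝓘(ℝ, E) p →L[ℝ] ℝ) (ρ : M → M) : Prop where
  smooth : ContMDiff 𝓘(ℝ, E) 𝓘(ℝ, E) ∞ ρ
  involutive : Function.Involutive ρ
  pullback : ∀ p v, α (ρ p) (mfderiv 𝓘(ℝ, E) 𝓘(ℝ, E) ρ p v) = -α p v

/-- A Reeb chord `C : [0, τ] → M` with end points in the fixed point set of `ρ`. -/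
structure IsChord (α : ∀ p : M, TangentSpace 𝓘(ℝ, E) p →L[ℝ] ℝ) (ρ : M → M) (C : ℝ → M) (τ : ℝ) :
    Prop where
  pos : 0 < τ
  integral : IsMIntegralCurveOn (I := 𝓘(ℝ, E)) C (reebField α) (Set.Icc 0 τ)
  left_fixed : ρ (C 0) = C 0
  right_fixed : ρ (C τ) = C τ

/-- The `2τ`-periodic curve which follows `C` on `[0, τ]` and the reflected chord
`t ↦ ρ (C (2τ - t))` on `[τ, 2τ]`. The iterate `C^m` of a chord is the restriction of this curve to
`[0, m * τ]`; in particular `C^2` is one period of it. -/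
def chordCurve (ρ : M → M) (C : ℝ → M) (τ : ℝ) (t : ℝ) : M :=
  let s : ℝ := t - 2 * τ * ⌊t / (2 * τ)⌋
  if s ≤ τ then C s else ρ (C (2 * τ - s))

/-- A continuous `T`-periodic symplectic trivialization of `ker α` along the curve `P`. These are
exactly the `T`-periodic trivializations that are unitary for some compatible complex structure
on the pullback of `ker α`, namely the one carried over by `Φ` from the plane. -/
structure IsTrivialization [IsManifold 𝓘(ℝ, E) ∞ M]
    (α : ∀ p : M, TangentSpace 𝓘(ℝ, E) p →L[ℝ] ℝ) (P : ℝ → M) (T : ℝ)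
    (Φ : ∀ t : ℝ, (ℝ × ℝ) →L[ℝ] TangentSpace 𝓘(ℝ, E) (P t)) : Prop where
  continuous : ∀ u, Continuous fun t => (⟨P t, Φ t u⟩ : TangentBundle 𝓘(ℝ, E) M)
  mem_ker : ∀ t u, α (P t) (Φ t u) = 0
  symplectic : ∀ t u v, extD α (P t) (Φ t u) (Φ t v) = RobbinSalamon.omegaStd u v
  periodic : ∀ t u, (⟨P (t + T), Φ (t + T) u⟩ : TangentBundle 𝓘(ℝ, E) M) = ⟨P t, Φ t u⟩

/-- A symmetric trivialization: moreover `Tρ ∘ Φ(t) = Φ(-t) ∘ I` with `I (x, y) = (x, -y)`. -/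
structure IsSymmetricTrivialization [IsManifold 𝓘(ℝ, E) ∞ M]
    (α : ∀ p : M, TangentSpace 𝓘(ℝ, E) p →L[ℝ] ℝ) (ρ : M → M)
    (P : ℝ → M) (T : ℝ) (Φ : ∀ t : ℝ, (ℝ × ℝ) →L[ℝ] TangentSpace 𝓘(ℝ, E) (P t)) : Prop
    extends IsTrivialization α P T Φ where
  symmetric : ∀ t x y, tangentMap 𝓘(ℝ, E) 𝓘(ℝ, E) ρ ⟨P t, Φ t (x, y)⟩ = ⟨P (-t), Φ (-t) (x, -y)⟩

/-- The linearized flow `Φ(t)⁻¹ ∘ Tφ^t ∘ Φ(0)` along `P`: the linear map `A` of the plane with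
`Tφ^t ∘ Φ(0) = Φ(t) ∘ A`. -/
def linearizedFlow (φ : ℝ → M → M) (P : ℝ → M)
    (Φ : ∀ t : ℝ, (ℝ × ℝ) →L[ℝ] TangentSpace 𝓘(ℝ, E) (P t)) (t : ℝ) : (ℝ × ℝ) →ₗ[ℝ] (ℝ × ℝ) :=
  Classical.epsilon fun A => ∀ u,
    tangentMap 𝓘(ℝ, E) 𝓘(ℝ, E) (φ t) ⟨P 0, Φ 0 u⟩ = ⟨P t, Φ t (A u)⟩

/-- The Conley-Zehnder index of the orbit `P : [0, T] → M` with respect to `Φ`. -/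
def muCZ (φ : ℝ → M → M) (P : ℝ → M)
    (Φ : ∀ t : ℝ, (ℝ × ℝ) →L[ℝ] TangentSpace 𝓘(ℝ, E) (P t)) (T : ℝ) : ℝ :=
  RobbinSalamon.conleyZehnder (linearizedFlow φ P Φ) T

/-- The Robbin-Salamon index of the chord `P : [0, τ] → M` with respect to `Φ`. -/
def muRS (φ : ℝ → M → M) (P : ℝ → M)
    (Φ : ∀ t : ℝ, (ℝ × ℝ) →L[ℝ] TangentSpace 𝓘(ℝ, E) (P t)) (τ : ℝ) : ℝ :=
  RobbinSalamon.realAxisIndex (linearizedFlow φ P Φ) τ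

end Form

end RealContact

end

/-! In a symplectic frame the linearized Reeb flow is a continuous path `Ψ` in SL(2, ℝ) starting at
the identity, with `Ψ (t + T) = Ψ t ∘ Ψ T`; a symmetric frame adds the time reversal Ψ(-t) I = I
Ψ(t). The action on directions lifts to strictly increasing maps θ_t of the line, angles being
measured in half turns, which commute with integer translations (`IsLift`). The theorem becomes a
statement about these maps.

The dictionary is `le_conleyZehnder_iff` (index at least 2k + 1 iff θ_T(x) > x + 2k for all x) and
`le_realAxisIndex_iff` (index at least k + 1/2 iff θ_τ(0) > k). For orbits θ_{mT} is the m-th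
iterate of θ_T, so a displacement above 2k everywhere becomes one above 2mk, while a point with
θ_T(x) ≤ x stays at or below x by monotonicity. For chords with period 2τ, time reversal gives
θ_τ(x) = -θ_τ(-θ_{2τ}(x)) (`IsLift.reflect`). Hence θ_τ(0) > k iff θ_{2τ}(0) > 2k, which yields both
the iteration over chords and the comparison of the two indices.

The dictionary rests on closed formulas for the indices. By `index_eq_sub` it suffices to find a
function μ such that half the signature in any chart minus μ is locally constant where the path is
transverse to the complement defining the chart. For lines, μ is (⌊y⌋ + ⌈y⌉) / 2; for graphs it is
`rotationIndex`, and `eventually_defect_eq` is the decisive local statement.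

On the contact side, Cartan's formula shows that the Reeb flow preserves α, hence dα, which makes
`Ψ` symplectic. A real structure reverses the Reeb field, which makes the doubled chord a Reeb orbit
and gives the time reversal of `Ψ`. -/

noncomputable section

namespace RobbinSalamon

/-! ### Signatures of binary quadratic forms -/

/-- The signature of the binary quadratic form `p x² + 2 q x y + r y²`. -/
def planeSig (p q r : ℝ) : ℤ :=
  if 0 < p * r - q ^ 2 then 2 * (SignType.sign (p + r) : ℤ)
  else if p * r - q ^ 2 = 0 then (SignType.sign (p + r) : ℤ) else 0

section Signature

variable {V : Type*} [AddCommGroup V] [Module ℝ V] [FiniteDimensional ℝ V]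

lemma one_le_sigPos (Q : QuadraticForm ℝ V) (v : V) (hv : 0 < Q v) : 1 ≤ sigPos Q := by
  have hv0 : v ≠ 0 := by rintro rfl; simp at hv
  rw [← finrank_span_singleton (K := ℝ) hv0]
  refine le_sigPos_of_posDef Q ?_
  rintro ⟨x, hx⟩ hx0
  obtain ⟨c, rfl⟩ := Submodule.mem_span_singleton.1 hx
  have hc : c ≠ 0 := by rintro rfl; simp at hx0
  rw [QuadraticMap.restrict_apply, QuadraticMap.map_smul]
  exact smul_pos (mul_self_pos.2 hc) hv

/-- A line on which `Q` is nonpositive takes one dimension away from every positive definite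
subspace. -/
lemma sigPos_lt_finrank (Q : QuadraticForm ℝ V) (v : V) (hv0 : v ≠ 0) (hv : Q v ≤ 0) :
    sigPos Q + 1 ≤ Module.finrank ℝ V := by
  rw [← finrank_span_singleton (K := ℝ) hv0]
  refine QuadraticForm.sigPos_add_finrank_le_of_nonpos ?_
  intro x hx
  obtain ⟨c, rfl⟩ := Submodule.mem_span_singleton.1 hx
  rw [QuadraticMap.map_smul]
  exact smul_nonpos_of_nonneg_of_nonpos (mul_self_nonneg c) hv

lemma sigPos_eq_zero (Q : QuadraticForm ℝ V) (hQ : ∀ v, Q v ≤ 0) : sigPos Q = 0 := by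
  have := QuadraticForm.sigPos_add_finrank_le_of_nonpos (Q := Q) (V := ⊤) (fun x _ => hQ x)
  rw [finrank_top] at this
  omega

lemma sigPos_eq_finrank (Q : QuadraticForm ℝ V) (hQ : ∀ v ≠ 0, 0 < Q v) :
    sigPos Q = Module.finrank ℝ V := by
  refine le_antisymm (sigPos_le_finrank Q) ?_
  rw [← finrank_top (R := ℝ) (M := V)]
  refine le_sigPos_of_posDef Q ?_
  rintro ⟨x, hx⟩ hx0
  exact hQ x (by simpa using hx0)

end Signature

section Plane

variable (Q : QuadraticForm ℝ (ℝ × ℝ)) {p q r : ℝ}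
  (hQ : ∀ x y, Q (x, y) = p * x ^ 2 + 2 * q * x * y + r * y ^ 2)

include hQ

/-- Determinant and trace of the Gram matrix decide the signs of its two eigenvalues. -/
lemma sigPos_plane : (sigPos Q : ℤ) =
    if 0 < p * r - q ^ 2 ∧ 0 < p + r then 2 else if 0 ≤ p * r - q ^ 2 ∧ p + r ≤ 0 then 0 else 1 := by
  have h2 : Module.finrank ℝ (ℝ × ℝ) = 2 := by simp
  split_ifs with h h'
  · rw [sigPos_eq_finrank, h2]; · rfl
    rintro ⟨x, y⟩ hxy
    rw [hQ]
    obtain ⟨h, hs⟩ := h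
    have hp : 0 < p := by
      by_contra hp
      have : 0 < r := by linarith
      nlinarith [sq_nonneg q]
    -- Completing the square after multiplication by `p` avoids division.
    have : 0 < p * (p * x ^ 2 + 2 * q * x * y + r * y ^ 2) := by
      have e : p * (p * x ^ 2 + 2 * q * x * y + r * y ^ 2) =
        (p * x + q * y) ^ 2 + (p * r - q ^ 2) * y ^ 2 := by ring
      rw [e]
      by_cases hy : y = 0
      · have hx : x ≠ 0 := by rintro rfl; exact hxy (by simp [hy])
        subst hy; simp; positivity
      · positivity
    exact pos_of_mul_pos_right this hp.le |>.trans_le le_rfl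
  · rw [sigPos_eq_zero]; · rfl
    rintro ⟨x, y⟩
    rw [hQ]
    obtain ⟨h, hs⟩ := h'
    have hp : p ≤ 0 := by
      by_contra hp
      have : r < 0 := by linarith
      nlinarith [sq_nonneg q]
    have hr : r ≤ 0 := by
      by_contra hp
      have : p < 0 := by linarith
      nlinarith [sq_nonneg q]
    rcases eq_or_lt_of_le hp with hp | hp
    · have : q = 0 := by
        subst hp; nlinarith [sq_nonneg q]
      subst hp this; nlinarith [sq_nonneg y]
    · have e : p * (p * x ^ 2 + 2 * q * x * y + r * y ^ 2) =
        (p * x + q * y) ^ 2 + (p * r - q ^ 2) * y ^ 2 := by ring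
      have : 0 ≤ p * (p * x ^ 2 + 2 * q * x * y + r * y ^ 2) := by rw [e]; positivity
      by_contra hc
      push Not at hc
      nlinarith
  · have hle : sigPos Q + 1 ≤ 2 := by
      rw [← h2]
      have hd : 0 < p → p * r - q ^ 2 ≤ 0 := by
        intro hp
        by_contra hc
        push Not at hc
        have : 0 < r := by
          by_contra hr
          nlinarith [sq_nonneg q]
        exact h ⟨hc, by linarith⟩
      by_cases hp : p ≤ 0
      · exact sigPos_lt_finrank Q (1, 0) (by simp) (by rw [hQ]; simpa using hp)
      · push Not at hp
        -- The vector (q, -p) is orthogonal to (1, 0), and its value is p times the determinant.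
        refine sigPos_lt_finrank Q (q, -p) (by simp; intro _; exact hp.ne') ?_
        rw [hQ]
        nlinarith [hd hp]
    have hge : 1 ≤ sigPos Q := by
      by_cases hp : 0 < p
      · exact one_le_sigPos Q (1, 0) (by rw [hQ]; simpa using hp)
      by_cases hr : 0 < r
      · exact one_le_sigPos Q (0, 1) (by rw [hQ]; simpa using hr)
      push Not at hp hr
      have hd : p * r - q ^ 2 < 0 := by
        by_contra hc
        exact h' ⟨by linarith, by linarith⟩
      rcases eq_or_lt_of_le hp with hp | hp
      · subst hp
        have hq : q ≠ 0 := by rintro rfl; simp at hd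
        -- With p = 0 the form is affine in x along y = 1; this x makes its value 1.
        refine one_le_sigPos Q ((1 - r) / (2 * q), 1) ?_
        rw [hQ]
        have : 2 * q * ((1 - r) / (2 * q)) = 1 - r := by field_simp
        rw [this]; norm_num
      · refine one_le_sigPos Q (q, -p) ?_
        rw [hQ]
        nlinarith
    omega

lemma signature_plane : (sigPos Q : ℤ) - sigNeg Q = planeSig p q r := by
  have h1 := sigPos_plane Q hQ
  have h2 := sigPos_plane (-Q) (p := -p) (q := -q) (r := -r) (by intro x y; simp [hQ]; ring)
  rw [sigPos_neg] at h2
  rw [h1, h2, planeSig]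
  have e : -p * -r - (-q) ^ 2 = p * r - q ^ 2 := by ring
  rw [e]
  rcases lt_trichotomy (p * r - q ^ 2) 0 with hd | hd | hd
  · simp [hd.not_gt, hd.not_ge, hd.ne]
  · rcases lt_trichotomy (p + r) 0 with h | h | h
    · have h' : ¬ (-p + -r ≤ 0) := by linarith
      simp [hd, h', h.le]; simp [h]
    · have h' : (-p + -r ≤ 0) := by linarith
      simp [hd, h', h]
    · have h' : (-p + -r ≤ 0) := by linarith
      simp [hd, h', h.not_ge]; simp [h]
  · rcases lt_trichotomy (p + r) 0 with h | h | h
    · have h' : (0 < -p + -r) := by linarith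
      simp [hd, h', h.le, h.not_gt, hd.le]; simp [h]
    · exfalso
      have : r = -p := by linarith
      subst this; nlinarith [sq_nonneg p, sq_nonneg q]
    · have h' : (-p + -r ≤ 0) := by linarith
      have h'' : ¬ (0 < -p + -r) := by linarith
      simp [hd, h', h, h'', hd.le]

end Plane

/-- The signature of a quadratic form on a plane, computed in a basis. -/
lemma signature_of_equiv {V : Type*} [AddCommGroup V] [Module ℝ V] (Q : QuadraticForm ℝ V)
    (e : (ℝ × ℝ) ≃ₗ[ℝ] V) {p q r : ℝ}
    (hQ : ∀ x y, Q (e (x, y)) = p * x ^ 2 + 2 * q * x * y + r * y ^ 2) :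
    (sigPos Q : ℤ) - sigNeg Q = planeSig p q r := by
  have he : QuadraticMap.Equivalent (Q.comp e.toLinearMap) Q := ⟨⟨e, fun m => rfl⟩⟩
  rw [← he.sigPos_eq, ← he.sigNeg_eq]
  exact signature_plane _ (fun x y => by simp [hQ])

/-- The signature of a quadratic form on a line. -/
lemma signature_line {V : Type*} [AddCommGroup V] [Module ℝ V] [FiniteDimensional ℝ V]
    (Q : QuadraticForm ℝ V)
    (h1 : Module.finrank ℝ V = 1) (v : V) (hv : v ≠ 0) :
    (sigPos Q : ℤ) - sigNeg Q = SignType.sign (Q v) := by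
  have hall : ∀ w, ∃ c : ℝ, Q w = c ^ 2 * Q v := by
    intro w
    obtain ⟨c, rfl⟩ := (finrank_eq_one_iff_of_nonzero' v hv).1 h1 w
    exact ⟨c, by rw [QuadraticMap.map_smul, smul_eq_mul]; ring⟩
  have hl := sigPos_le_finrank Q
  have hl' := sigPos_le_finrank (-Q)
  rw [h1] at hl hl'
  have hneg : sigNeg Q = sigPos (-Q) := sigPos_neg.symm
  rw [hneg]
  rcases lt_trichotomy (Q v) 0 with h | h | h
  · have a := one_le_sigPos (-Q) v (by simpa using h)
    have b := sigPos_eq_zero Q (fun w => by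
      obtain ⟨c, hc⟩ := hall w; rw [hc]; nlinarith [sq_nonneg c])
    rw [b, sign_neg h, show sigPos (-Q) = 1 by omega]; rfl
  · have a := sigPos_eq_zero (-Q) (fun w => by
      obtain ⟨c, hc⟩ := hall w; simp [hc, h])
    have b := sigPos_eq_zero Q (fun w => by
      obtain ⟨c, hc⟩ := hall w; simp [hc, h])
    rw [a, b, h]; simp
  · have a := sigPos_eq_zero (-Q) (fun w => by
      obtain ⟨c, hc⟩ := hall w
      rw [neg_apply, hc]; nlinarith [sq_nonneg c])
    have b := one_le_sigPos Q v h
    rw [a, sign_pos h, show sigPos Q = 1 by omega]; rfl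

end RobbinSalamon

/-! ### Lagrangian complements of the diagonal and the chart expressions of graphs -/

namespace RobbinSalamon

/-- The linear map of the plane with matrix entries `a b c d`. -/
def planeMap (a b c d : ℝ) : (ℝ × ℝ) →ₗ[ℝ] (ℝ × ℝ) where
  toFun z := (a * z.1 + b * z.2, c * z.1 + d * z.2)
  map_add' x y := by ext <;> simp <;> ring
  map_smul' m x := by ext <;> simp <;> ring

@[simp] lemma planeMap_apply (a b c d : ℝ) (z : ℝ × ℝ) :
    planeMap a b c d z = (a * z.1 + b * z.2, c * z.1 + d * z.2) := rfl

@[simp] lemma omegaStd_apply (u v : ℝ × ℝ) : omegaStd u v = u.1 * v.2 - u.2 * v.1 := rfl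

@[simp] lemma omegaGraph_apply (u v : (ℝ × ℝ) × (ℝ × ℝ)) :
    omegaGraph u v = -(u.1.1 * v.1.2 - u.1.2 * v.1.1) + (u.2.1 * v.2.2 - u.2.2 * v.2.1) := rfl

lemma mem_diagonal {u : (ℝ × ℝ) × (ℝ × ℝ)} : u ∈ diagonal ↔ u.2 = u.1 := by
  simp [diagonal]

/-- `W` is the complement of the diagonal with parameters `P Q R`: with
`X = ((1/2 - P, -Q), (-R, 1/2 + P))` it consists of the vectors `(-X d, d - X d)`. -/
def IsSlice (W : Submodule ℝ ((ℝ × ℝ) × (ℝ × ℝ))) (P Q R : ℝ) : Prop :=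
  ∀ w, w ∈ W ↔ w.1.1 = -((1 / 2 - P) * (w.2.1 - w.1.1) - Q * (w.2.2 - w.1.2)) ∧
    w.1.2 = -(-R * (w.2.1 - w.1.1) + (1 / 2 + P) * (w.2.2 - w.1.2))

/-- A complement of the diagonal is parametrized by the difference d of the two components, as (-X
d, d - X d). Isotropy amounts to tr X = 1, which leaves three parameters and explains the entries
1/2 ∓ P. -/
lemma exists_isSlice {W : Submodule ℝ ((ℝ × ℝ) × (ℝ × ℝ))} (hW : IsLagrangian omegaGraph W)
    (hc : IsCompl diagonal W) : ∃ P Q R, IsSlice W P Q R := by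
  have key : ∀ d : ℝ × ℝ, ∃ x : ℝ × ℝ, ((-x, d - x) : (ℝ × ℝ) × (ℝ × ℝ)) ∈ W := by
    intro d
    have : ((0, d) : (ℝ × ℝ) × (ℝ × ℝ)) ∈ diagonal ⊔ W := by rw [hc.sup_eq_top]; trivial
    obtain ⟨y, hy, z, hz, e⟩ := Submodule.mem_sup.1 this
    rw [mem_diagonal] at hy
    refine ⟨y.1, ?_⟩
    have e1 : z = (0, d) - y := by rw [← e]; abel
    rw [e1] at hz
    convert hz using 1
    ext <;> simp [hy]
  have iso : ∀ u ∈ W, ∀ v ∈ W, omegaGraph u v = 0 := by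
    intro u hu v hv
    have : v ∈ omegaGraph.orthogonal W := by rw [hW]; exact hv
    exact this u hu
  obtain ⟨⟨α1, α2⟩, h1⟩ := key (1, 0)
  obtain ⟨⟨β1, β2⟩, h2⟩ := key (0, 1)
  -- Isotropy of the two basis vectors is the trace condition on X.
  have tr := iso _ h1 _ h2
  simp at tr
  have fwd : ∀ w ∈ W, w.1 = (-(α1 * (w.2.1 - w.1.1) + β1 * (w.2.2 - w.1.2)),
      -(α2 * (w.2.1 - w.1.1) + β2 * (w.2.2 - w.1.2))) := by
    intro w hw
    have hm : w - (w.2.1 - w.1.1) • (((-(α1, α2), (1, 0) - (α1, α2))) : (ℝ × ℝ) × (ℝ × ℝ))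
        - (w.2.2 - w.1.2) • ((-(β1, β2), (0, 1) - (β1, β2)) : (ℝ × ℝ) × (ℝ × ℝ)) ∈ W :=
      W.sub_mem (W.sub_mem hw (W.smul_mem _ h1)) (W.smul_mem _ h2)
    have h0 := (Submodule.disjoint_def.1 hc.disjoint) _
      (by rw [mem_diagonal]; ext <;> simp <;> ring) hm
    have a := congrArg (fun z => z.1.1) h0
    have b := congrArg (fun z => z.1.2) h0
    simp at a b
    ext
    · simp; linarith
    · simp; linarith
  refine ⟨1 / 2 - α1, -β1, -α2, fun w => ⟨fun hw => ?_, fun hw => ?_⟩⟩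
  · have := fwd w hw
    rw [Prod.ext_iff] at this
    obtain ⟨a, b⟩ := this
    simp only at a b
    refine ⟨by linear_combination a, ?_⟩
    linear_combination b + (w.2.2 - w.1.2) * tr
  · have e : w = (w.2.1 - w.1.1) • (((-(α1, α2), (1, 0) - (α1, α2))) : (ℝ × ℝ) × (ℝ × ℝ))
        + (w.2.2 - w.1.2) • ((-(β1, β2), (0, 1) - (β1, β2)) : (ℝ × ℝ) × (ℝ × ℝ)) := by
      obtain ⟨a, b⟩ := hw
      ext
      · simp; linear_combination a
      · simp; linear_combination b - (w.2.2 - w.1.2) * tr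
      · simp; linear_combination a
      · simp; linear_combination b - (w.2.2 - w.1.2) * tr
    rw [e]
    exact W.add_mem (W.smul_mem _ h1) (W.smul_mem _ h2)

/-- The complement of the diagonal with given parameters. -/
def slice (P Q R : ℝ) : Submodule ℝ ((ℝ × ℝ) × (ℝ × ℝ)) where
  carrier := {w | w.1.1 = -((1 / 2 - P) * (w.2.1 - w.1.1) - Q * (w.2.2 - w.1.2)) ∧
    w.1.2 = -(-R * (w.2.1 - w.1.1) + (1 / 2 + P) * (w.2.2 - w.1.2))}
  zero_mem' := by simp
  add_mem' := by
    rintro u v ⟨a, b⟩ ⟨c, d⟩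
    exact ⟨by simp only [Prod.fst_add, Prod.snd_add]; linear_combination a + c,
      by simp only [Prod.fst_add, Prod.snd_add]; linear_combination b + d⟩
  smul_mem' := by
    rintro m v ⟨c, d⟩
    exact ⟨by simp only [Prod.smul_fst, Prod.smul_snd, smul_eq_mul]; linear_combination m * c,
      by simp only [Prod.smul_fst, Prod.smul_snd, smul_eq_mul]; linear_combination m * d⟩

lemma isSlice_slice (P Q R : ℝ) : IsSlice (slice P Q R) P Q R := fun _ => Iff.rfl

lemma isLagrangian_slice (P Q R : ℝ) : IsLagrangian omegaGraph (slice P Q R) := by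
  ext w
  rw [LinearMap.BilinForm.mem_orthogonal_iff, isSlice_slice P Q R w]
  constructor
  · intro h
    -- The test vectors are the elements of the slice with difference (1, 0) and (0, 1).
    have h1 := h ((-(1 / 2 - P), R), (1 / 2 + P, R))
      ((isSlice_slice P Q R _).2 ⟨by simp; ring, by simp; ring⟩)
    have h2 := h ((Q, -(1 / 2 + P)), (Q, 1 / 2 - P))
      ((isSlice_slice P Q R _).2 ⟨by simp; ring, by simp; ring⟩)
    simp at h1 h2
    exact ⟨by linear_combination -h2, by linear_combination h1⟩
  · rintro ⟨h3, h4⟩ n hn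
    obtain ⟨h1, h2⟩ := (isSlice_slice P Q R n).1 hn
    show omegaGraph n w = 0
    rw [omegaGraph_apply]
    obtain ⟨⟨a, b⟩, c, d⟩ := n
    obtain ⟨⟨a', b'⟩, c', d'⟩ := w
    simp only at *
    linear_combination (d' - b') * h1 + (a' - c') * h2 + (b - d) * h3 + (c - a) * h4

lemma isCompl_diagonal_slice (P Q R : ℝ) : IsCompl diagonal (slice P Q R) := by
  refine ⟨Submodule.disjoint_def.2 ?_, codisjoint_iff.2 (eq_top_iff.2 ?_)⟩
  · rintro ⟨x, y⟩ hx hw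
    rw [mem_diagonal] at hx
    simp only at hx
    subst hx
    obtain ⟨h1, h2⟩ := (isSlice_slice P Q R _).1 hw
    simp at h1 h2
    ext <;> simp [h1, h2]
  · rintro ⟨⟨a, b⟩, c, d⟩ -
    let x : ℝ := (1 / 2 - P) * (c - a) - Q * (d - b)
    let y : ℝ := -R * (c - a) + (1 / 2 + P) * (d - b)
    refine Submodule.mem_sup.2 ⟨((a + x, b + y), (a + x, b + y)), by rw [mem_diagonal],
      ((-x, -y), (c - a - x, d - b - y)), (isSlice_slice P Q R _).2 ⟨?_, ?_⟩, ?_⟩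
    · simp only [x, y]; ring
    · simp only [x, y]; ring
    · ext <;> simp

/-- The determinant which decides transversality of a graph to a slice. -/
def sliceDet (P Q R a b c d : ℝ) : ℝ :=
  (1 + (1 / 2 - P) * (a - 1) - Q * c) * (1 - R * b + (1 / 2 + P) * (d - 1)) -
    ((1 / 2 - P) * b - Q * (d - 1)) * (-R * (a - 1) + (1 / 2 + P) * c)

lemma eq_zero_of_det_ne_zero {a b c d x y : ℝ} (h : a * d - b * c ≠ 0)
    (h1 : a * x + b * y = 0) (h2 : c * x + d * y = 0) : x = 0 ∧ y = 0 := by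
  constructor
  · have : (a * d - b * c) * x = 0 := by linear_combination d * h1 - b * h2
    exact (mul_eq_zero.1 this).resolve_left h
  · have : (a * d - b * c) * y = 0 := by linear_combination a * h2 - c * h1
    exact (mul_eq_zero.1 this).resolve_left h

lemma exists_ne_zero_of_det_eq_zero {a b c d : ℝ} (h : a * d - b * c = 0) :
    ∃ x y : ℝ, (x ≠ 0 ∨ y ≠ 0) ∧ a * x + b * y = 0 ∧ c * x + d * y = 0 := by
  by_cases h1 : a = 0 ∧ b = 0
  · by_cases h2 : c = 0 ∧ d = 0
    · exact ⟨1, 0, by simp, by simp [h1.1], by simp [h2.1]⟩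
    · refine ⟨d, -c, ?_, by simp [h1.1, h1.2], by ring⟩
      by_contra hc
      push Not at hc
      exact h2 ⟨by simpa using hc.2, hc.1⟩
  · refine ⟨b, -a, ?_, by ring, by linear_combination -h⟩
    by_contra hc
    push Not at hc
    exact h1 ⟨by simpa using hc.2, hc.1⟩

lemma mem_graph_planeMap {a b c d : ℝ} {w : (ℝ × ℝ) × (ℝ × ℝ)} :
    w ∈ (planeMap a b c d).graph ↔ w.2 = (a * w.1.1 + b * w.1.2, c * w.1.1 + d * w.1.2) := by
  simp

/-- A vector (z, Az) lies in the slice iff (1 + X(A - 1)) z = 0, and `sliceDet` is the determinant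
of N = 1 + X(A - 1). When it is nonzero, Cramer's rule gives the decomposition of an arbitrary
vector. -/
lemma isCompl_graph_slice_iff {W : Submodule ℝ ((ℝ × ℝ) × (ℝ × ℝ))} {P Q R : ℝ}
    (hW : IsSlice W P Q R) (a b c d : ℝ) :
    IsCompl (planeMap a b c d).graph W ↔ sliceDet P Q R a b c d ≠ 0 := by
  constructor
  · intro h h0
    obtain ⟨x, y, hxy, h1, h2⟩ := exists_ne_zero_of_det_eq_zero h0
    have := Submodule.disjoint_def.1 h.disjoint ((x, y), (a * x + b * y, c * x + d * y))
      (by rw [mem_graph_planeMap])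
      ((hW _).2 ⟨by simp only; linear_combination h1, by simp only; linear_combination h2⟩)
    simp at this
    tauto
  · intro h0
    refine ⟨Submodule.disjoint_def.2 ?_, codisjoint_iff.2 (eq_top_iff.2 ?_)⟩
    · rintro ⟨⟨x, y⟩, z⟩ hx hw
      rw [mem_graph_planeMap] at hx
      simp only at hx
      subst hx
      obtain ⟨h1, h2⟩ := (hW _).1 hw
      simp only at h1 h2
      obtain ⟨rfl, rfl⟩ := eq_zero_of_det_ne_zero (x := x) (y := y) h0
        (by linear_combination h1) (by linear_combination h2)
      simp
    · rintro ⟨⟨p1, p2⟩, q1, q2⟩ -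
      set N11 := 1 + (1 / 2 - P) * (a - 1) - Q * c with hN11
      set N12 := (1 / 2 - P) * b - Q * (d - 1) with hN12
      set N21 := -R * (a - 1) + (1 / 2 + P) * c with hN21
      set N22 := 1 - R * b + (1 / 2 + P) * (d - 1) with hN22
      have h0' : N11 * N22 - N12 * N21 ≠ 0 := h0
      let s1 := p1 + (1 / 2 - P) * (q1 - p1) - Q * (q2 - p2)
      let s2 := p2 - R * (q1 - p1) + (1 / 2 + P) * (q2 - p2)
      let x := (N22 * s1 - N12 * s2) / (N11 * N22 - N12 * N21)
      let y := (N11 * s2 - N21 * s1) / (N11 * N22 - N12 * N21)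
      have hx' : x * (N11 * N22 - N12 * N21) = N22 * s1 - N12 * s2 := div_mul_cancel₀ _ h0'
      have hy' : y * (N11 * N22 - N12 * N21) = N11 * s2 - N21 * s1 := div_mul_cancel₀ _ h0'
      have hx : N11 * x + N12 * y = s1 :=
        mul_right_cancel₀ h0' (by linear_combination N11 * hx' + N12 * hy')
      have hy : N21 * x + N22 * y = s2 :=
        mul_right_cancel₀ h0' (by linear_combination N21 * hx' + N22 * hy')
      refine Submodule.mem_sup.2 ⟨((x, y), (a * x + b * y, c * x + d * y)),
        by rw [mem_graph_planeMap],
        ((p1 - x, p2 - y), (q1 - (a * x + b * y), q2 - (c * x + d * y))),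
        (hW _).2 ⟨?_, ?_⟩, ?_⟩
      · simp only
        simp only [s1, hN11, hN12] at hx
        linear_combination -hx
      · simp only
        simp only [s2, hN21, hN22] at hy
        linear_combination -hy
      · ext <;> simp

/-- The signature of the graph of `planeMap a b c d` in the chart of the slice. -/
def sliceSig (P Q R a b c d : ℝ) : ℤ :=
  planeSig
    ((1 + (1 / 2 - P) * (a - 1) - Q * c) * c - (-R * (a - 1) + (1 / 2 + P) * c) * (a - 1))
    (((1 + (1 / 2 - P) * (a - 1) - Q * c) * (d - 1) + ((1 / 2 - P) * b - Q * (d - 1)) * c -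
      (-R * (a - 1) + (1 / 2 + P) * c) * b - (1 - R * b + (1 / 2 + P) * (d - 1)) * (a - 1)) / 2)
    (((1 / 2 - P) * b - Q * (d - 1)) * (d - 1) - (1 - R * b + (1 / 2 + P) * (d - 1)) * b)

/-- The projection to the diagonal along `W` sends (z, Az) to (Nz, Nz). In the coordinate z the
graph form is therefore ω(Nz, (A - 1)z), whose coefficients are those in `sliceSig`. -/
lemma graphSign_graph {W : Submodule ℝ ((ℝ × ℝ) × (ℝ × ℝ))} {P Q R : ℝ}
    (hW : IsSlice W P Q R) {a b c d : ℝ} (h : sliceDet P Q R a b c d ≠ 0) :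
    graphSign omegaGraph diagonal W (planeMap a b c d).graph = sliceSig P Q R a b c d := by
  have hc := (isCompl_graph_slice_iff hW a b c d).2 h
  rw [graphSign, dif_pos hc, sliceSig]
  let f : (ℝ × ℝ) →ₗ[ℝ] diagonal :=
    LinearMap.codRestrict diagonal ((planeMap (1 + (1 / 2 - P) * (a - 1) - Q * c)
      ((1 / 2 - P) * b - Q * (d - 1)) (-R * (a - 1) + (1 / 2 + P) * c)
      (1 - R * b + (1 / 2 + P) * (d - 1))).prod (planeMap (1 + (1 / 2 - P) * (a - 1) - Q * c)
      ((1 / 2 - P) * b - Q * (d - 1)) (-R * (a - 1) + (1 / 2 + P) * c)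
      (1 - R * b + (1 / 2 + P) * (d - 1)))) (fun z => by rw [mem_diagonal]; rfl)
  have finj : Function.Injective f := by
    rw [injective_iff_map_eq_zero]
    rintro ⟨x, y⟩ hxy
    have := congrArg (fun z : diagonal => z.1.1) hxy
    simp only [f, LinearMap.codRestrict_apply, LinearMap.prod_apply, Function.prod, planeMap_apply] at this
    rw [Prod.ext_iff] at this
    obtain ⟨rfl, rfl⟩ := eq_zero_of_det_ne_zero h this.1 this.2
    rfl
  have fdim : Module.finrank ℝ (ℝ × ℝ) = Module.finrank ℝ diagonal := by
    have := (LinearEquiv.ofInjective (LinearMap.id.prod (LinearMap.id : (ℝ × ℝ) →ₗ[ℝ] (ℝ × ℝ)))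
      (fun x y h => (Prod.ext_iff.1 h).1)).finrank_eq
    rw [this, diagonal, LinearMap.graph_eq_range_prod]
  let e := LinearEquiv.ofInjectiveOfFinrankEq f finj fdim
  refine signature_of_equiv _ e ?_
  intro x y
  have he : (e (x, y) : (ℝ × ℝ) × (ℝ × ℝ)) = (planeMap (1 + (1 / 2 - P) * (a - 1) - Q * c)
      ((1 / 2 - P) * b - Q * (d - 1)) (-R * (a - 1) + (1 / 2 + P) * c)
      (1 - R * b + (1 / 2 + P) * (d - 1)) (x, y), planeMap (1 + (1 / 2 - P) * (a - 1) - Q * c)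
      ((1 / 2 - P) * b - Q * (d - 1)) (-R * (a - 1) + (1 / 2 + P) * c)
      (1 - R * b + (1 / 2 + P) * (d - 1)) (x, y)) := rfl
  simp only [planeMap_apply] at he
  have hproj : (planeMap a b c d).graph.projection W hc (e (x, y) : (ℝ × ℝ) × (ℝ × ℝ)) =
      ((x, y), (a * x + b * y, c * x + d * y)) := by
    have h1 : ((x, y), (a * x + b * y, c * x + d * y)) ∈ (planeMap a b c d).graph := by
      rw [mem_graph_planeMap]
    have h2 : (e (x, y) : (ℝ × ℝ) × (ℝ × ℝ)) - ((x, y), (a * x + b * y, c * x + d * y)) ∈ W := by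
      refine (hW _).2 ⟨?_, ?_⟩
      · rw [he]; simp; ring
      · rw [he]; simp; ring
    have h3 : (e (x, y) : (ℝ × ℝ) × (ℝ × ℝ)) = ((x, y), (a * x + b * y, c * x + d * y)) +
      ((e (x, y) : (ℝ × ℝ) × (ℝ × ℝ)) - ((x, y), (a * x + b * y, c * x + d * y))) := by abel
    rw [h3, map_add, Submodule.projection_apply_of_mem_left hc h1,
      Submodule.projection_apply_of_mem_right hc h2, add_zero]
  simp only [graphForm, LinearMap.BilinMap.toQuadraticMap_apply, LinearMap.compl₁₂_apply,
    LinearMap.sub_apply, LinearMap.comp_apply, Submodule.subtype_apply, hproj, omegaGraph_apply]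
  rw [he]
  simp
  ring

/-! ### Lines in the plane -/

lemma mem_realAxis {u : ℝ × ℝ} : u ∈ realAxis ↔ u.2 = 0 := by simp [realAxis]

/-- `W` is the line spanned by `(w, 1)`. -/
def IsSteep (W : Submodule ℝ (ℝ × ℝ)) (w : ℝ) : Prop := ∀ z, z ∈ W ↔ z.1 = w * z.2

lemma exists_isSteep {W : Submodule ℝ (ℝ × ℝ)} (hW : IsCompl realAxis W) : ∃ w, IsSteep W w := by
  have : ((0, 1) : ℝ × ℝ) ∈ realAxis ⊔ W := by rw [hW.sup_eq_top]; trivial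
  obtain ⟨y, hy, z, hz, e⟩ := Submodule.mem_sup.1 this
  rw [mem_realAxis] at hy
  have hz2 : z.2 = 1 := by have := congrArg Prod.snd e; simpa [hy] using this
  refine ⟨z.1, fun x => ⟨fun hx => ?_, fun hx => ?_⟩⟩
  · have hm : x - x.2 • z ∈ W := W.sub_mem hx (W.smul_mem _ hz)
    have := Submodule.disjoint_def.1 hW.disjoint _ (by rw [mem_realAxis]; simp [hz2]) hm
    have := congrArg Prod.fst this
    simp at this
    linarith
  · have : x = x.2 • z := by ext <;> simp [hz2, hx, mul_comm]
    rw [this]; exact W.smul_mem _ hz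

/-- The line spanned by `(w, 1)`. -/
def steep (w : ℝ) : Submodule ℝ (ℝ × ℝ) where
  carrier := {z | z.1 = w * z.2}
  zero_mem' := by simp
  add_mem' := by
    intro a b ha hb
    simp only [Set.mem_ofPred_eq, Prod.fst_add, Prod.snd_add] at *
    rw [ha, hb]; ring
  smul_mem' := by
    intro c a ha
    simp only [Set.mem_ofPred_eq, Prod.smul_fst, Prod.smul_snd, smul_eq_mul] at *
    rw [ha]; ring

lemma isSteep_steep (w : ℝ) : IsSteep (steep w) w := fun _ => Iff.rfl

lemma isLagrangian_steep (w : ℝ) : IsLagrangian omegaStd (steep w) := by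
  ext z
  rw [LinearMap.BilinForm.mem_orthogonal_iff, isSteep_steep w z]
  constructor
  · intro h
    have h1 := h (w, 1) ((isSteep_steep w _).2 (by simp))
    simp at h1
    linarith
  · intro hz n hn
    have := (isSteep_steep w n).1 hn
    show omegaStd n z = 0
    rw [omegaStd_apply]
    rw [this, hz]; ring

lemma isCompl_realAxis_steep (w : ℝ) : IsCompl realAxis (steep w) := by
  refine ⟨Submodule.disjoint_def.2 ?_, codisjoint_iff.2 (eq_top_iff.2 ?_)⟩
  · rintro ⟨x, y⟩ hx hw
    rw [mem_realAxis] at hx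
    have := (isSteep_steep w _).1 hw
    simp only at hx this
    subst hx
    simp [this]
  · rintro ⟨x, y⟩ -
    refine Submodule.mem_sup.2 ⟨(x - w * y, 0), by rw [mem_realAxis], (w * y, y),
      (isSteep_steep w _).2 rfl, by ext <;> simp⟩

lemma mem_map_realAxis {Ψ : (ℝ × ℝ) →ₗ[ℝ] (ℝ × ℝ)} {z : ℝ × ℝ} :
    z ∈ realAxis.map Ψ ↔ ∃ x : ℝ, z = x • Ψ (1, 0) := by
  rw [Submodule.mem_map]
  constructor
  · rintro ⟨⟨x, y⟩, hy, rfl⟩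
    rw [mem_realAxis] at hy
    refine ⟨x, ?_⟩
    rw [← map_smul]; simp only at hy; simp [hy]
  · rintro ⟨x, rfl⟩
    exact ⟨(x, 0), by rw [mem_realAxis], by rw [← map_smul]; simp⟩

lemma isCompl_map_steep_iff {W : Submodule ℝ (ℝ × ℝ)} {w : ℝ} (hW : IsSteep W w)
    {Ψ : (ℝ × ℝ) →ₗ[ℝ] (ℝ × ℝ)} {a c : ℝ} (hΨ : Ψ (1, 0) = (a, c)) (h0 : a ≠ 0 ∨ c ≠ 0) :
    IsCompl (realAxis.map Ψ) W ↔ a - w * c ≠ 0 := by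
  constructor
  · intro h h1
    have := Submodule.disjoint_def.1 h.disjoint (a, c)
      (mem_map_realAxis.2 ⟨1, by simp [hΨ]⟩) ((hW _).2 (by simp only; linarith))
    simp at this
    tauto
  · intro h
    refine ⟨Submodule.disjoint_def.2 ?_, codisjoint_iff.2 (eq_top_iff.2 ?_)⟩
    · intro z hz hw
      obtain ⟨x, rfl⟩ := mem_map_realAxis.1 hz
      have h1 := (hW _).1 hw
      simp only [hΨ, Prod.smul_fst, Prod.smul_snd, smul_eq_mul] at h1
      have : x * (a - w * c) = 0 := by linear_combination h1
      rw [(mul_eq_zero.1 this).resolve_right h, zero_smul]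
    · rintro ⟨p, q⟩ -
      let x := (p - w * q) / (a - w * c)
      have hx : x * (a - w * c) = p - w * q := by simp only [x]; field_simp
      refine Submodule.mem_sup.2 ⟨x • Ψ (1, 0), mem_map_realAxis.2 ⟨x, rfl⟩,
        (p - x * a, q - x * c), (hW _).2 (by simp only; linear_combination -hx), ?_⟩
      ext <;> simp [hΨ]

/-- The vector (a - wc, 0) is the projection of (a, c) to the axis along `W`, and the graph form
takes the value (a - wc)c on it. -/
lemma graphSign_map {W : Submodule ℝ (ℝ × ℝ)} {w : ℝ} (hW : IsSteep W w)
    {Ψ : (ℝ × ℝ) →ₗ[ℝ] (ℝ × ℝ)} {a c : ℝ} (hΨ : Ψ (1, 0) = (a, c)) (h0 : a ≠ 0 ∨ c ≠ 0)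
    (h : a - w * c ≠ 0) :
    graphSign omegaStd realAxis W (realAxis.map Ψ) = SignType.sign (c * (a - w * c)) := by
  have hc := (isCompl_map_steep_iff hW hΨ h0).2 h
  rw [graphSign, dif_pos hc]
  let v : realAxis := ⟨(a - w * c, 0), by rw [mem_realAxis]⟩
  have hv : v ≠ 0 := by
    intro hv
    have := congrArg (fun z : realAxis => z.1.1) hv
    exact h this
  have hdim : Module.finrank ℝ realAxis = 1 := by
    refine finrank_eq_one_iff_of_nonzero' v hv |>.2 ?_
    rintro ⟨⟨x, y⟩, hy⟩
    rw [mem_realAxis] at hy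
    simp only at hy
    subst hy
    refine ⟨x / (a - w * c), ?_⟩
    ext
    · simp [v]; field_simp
    · simp [v]
  rw [signature_line _ hdim v hv]
  have hproj : (realAxis.map Ψ).projection W hc (v : ℝ × ℝ) = (a, c) := by
    have h1 : (a, c) ∈ realAxis.map Ψ := mem_map_realAxis.2 ⟨1, by simp [hΨ]⟩
    have h2 : (v : ℝ × ℝ) - (a, c) ∈ W := (hW _).2 (by simp [v])
    have h3 : (v : ℝ × ℝ) = (a, c) + ((v : ℝ × ℝ) - (a, c)) := by abel
    rw [h3, map_add, Submodule.projection_apply_of_mem_left hc h1,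
      Submodule.projection_apply_of_mem_right hc h2, add_zero]
  congr 2
  simp only [graphForm, LinearMap.BilinMap.toQuadraticMap_apply, LinearMap.compl₁₂_apply,
    LinearMap.sub_apply, LinearMap.comp_apply, Submodule.subtype_apply, hproj, omegaStd_apply]
  simp [v]
  ring

end RobbinSalamon

namespace RobbinSalamon

open Filter Topology

/-! ### Local constancy of the index defect -/

lemma planeSig_of_pos {p q r : ℝ} (h : 0 < p * r - q ^ 2) :
    planeSig p q r = 2 * (SignType.sign p : ℤ) := by
  rw [planeSig, if_pos h]
  rcases lt_trichotomy p 0 with hp | hp | hp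
  · have : r < 0 := by by_contra hr; nlinarith [sq_nonneg q]
    rw [sign_neg hp, sign_neg (by linarith)]
  · subst hp; nlinarith [sq_nonneg q]
  · have : 0 < r := by by_contra hr; nlinarith [sq_nonneg q]
    rw [sign_pos hp, sign_pos (by linarith)]

lemma planeSig_of_neg {p q r : ℝ} (h : p * r - q ^ 2 < 0) : planeSig p q r = 0 := by
  rw [planeSig, if_neg h.not_gt, if_neg h.ne]

lemma planeSig_of_zero {p q r : ℝ} (h : p * r - q ^ 2 = 0) :
    planeSig p q r = SignType.sign (p + r) := by
  rw [planeSig, if_neg h.not_gt, if_pos h]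

lemma planeSig_eq_mul (p q r : ℝ) : planeSig p q r = SignType.sign (p + r) * (1 + SignType.sign (p * r - q ^ 2) : ℤ) := by
  rcases lt_trichotomy (p * r - q ^ 2) 0 with hd | hd | hd
  · rw [planeSig_of_neg hd, sign_neg hd]; simp
  · rw [planeSig_of_zero hd, hd]; simp
  · rw [planeSig, if_pos hd, sign_pos hd]; simp; ring

lemma eventually_sign_eq {f : ℝ → ℝ} {t₀ : ℝ} (hf : ContinuousAt f t₀) (h : f t₀ ≠ 0) :
    ∀ᶠ t in 𝓝 t₀, SignType.sign (f t) = SignType.sign (f t₀) := by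
  rcases lt_or_gt_of_ne h with h | h
  · filter_upwards [hf.eventually_lt_const h] with t ht
    rw [sign_neg ht, sign_neg h]
  · filter_upwards [hf.eventually_const_lt h] with t ht
    rw [sign_pos ht, sign_pos h]

/-- Signatures can jump only at degenerate forms; in the definite case `p` does not vanish and its
sign carries the signature. -/
lemma eventually_planeSig_eq {p q r : ℝ → ℝ} {t₀ : ℝ} (hp : ContinuousAt p t₀)
    (hq : ContinuousAt q t₀) (hr : ContinuousAt r t₀)
    (h : p t₀ * r t₀ - q t₀ ^ 2 ≠ 0) :
    ∀ᶠ t in 𝓝 t₀, planeSig (p t) (q t) (r t) = planeSig (p t₀) (q t₀) (r t₀) := by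
  have hc : ContinuousAt (fun t => p t * r t - q t ^ 2) t₀ := by fun_prop
  rcases lt_or_gt_of_ne h with h | h
  · filter_upwards [hc.eventually_lt_const h] with t ht
    rw [planeSig_of_neg ht, planeSig_of_neg h]
  · have h0 : p t₀ ≠ 0 := by intro h0; rw [h0] at h; nlinarith [sq_nonneg (q t₀)]
    filter_upwards [hc.eventually_const_lt h, eventually_sign_eq hp h0] with t ht hs
    rw [planeSig_of_pos ht, planeSig_of_pos h, hs]

section Entries

variable {a b c d : ℝ}

/-- This is det(1 + XB) = 1 + tr(XB) + det X det B for B = A - 1, where det B = 2 - tr A because det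
A = 1. -/
lemma sliceDet_eq (P Q R : ℝ) (h : a * d - b * c = 1) : sliceDet P Q R a b c d =
    1 - (2 - (a + d)) / 4 - (P * (a - d) + Q * c + R * b) -
      (P ^ 2 + Q * R) * (2 - (a + d)) := by
  unfold sliceDet
  linear_combination (1 / 4 - P ^ 2 - Q * R) * h

/-- The coefficients of the quadratic form whose signature is `sliceSig`. -/
def sliceP (P Q R a c : ℝ) : ℝ :=
  (1 + (1 / 2 - P) * (a - 1) - Q * c) * c - (-R * (a - 1) + (1 / 2 + P) * c) * (a - 1)

/-- The coefficients of the quadratic form whose signature is `sliceSig`. -/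
def sliceQ (P Q R a b c d : ℝ) : ℝ :=
  ((1 + (1 / 2 - P) * (a - 1) - Q * c) * (d - 1) + ((1 / 2 - P) * b - Q * (d - 1)) * c -
      (-R * (a - 1) + (1 / 2 + P) * c) * b - (1 - R * b + (1 / 2 + P) * (d - 1)) * (a - 1)) / 2

/-- The coefficients of the quadratic form whose signature is `sliceSig`. -/
def sliceR (P Q R b d : ℝ) : ℝ :=
  ((1 / 2 - P) * b - Q * (d - 1)) * (d - 1) - (1 - R * b + (1 / 2 + P) * (d - 1)) * b

lemma sliceSig_eq (P Q R a b c d : ℝ) : sliceSig P Q R a b c d =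
    planeSig (sliceP P Q R a c) (sliceQ P Q R a b c d) (sliceR P Q R b d) := rfl

/-- The bilinear form ω(Nz, (A - 1)z') is symmetric, so its determinant is det N det(A - 1). The
coefficient q equals either off-diagonal entry; using each of them once turns p r - q² into that
determinant. -/
lemma slice_disc (P Q R : ℝ) (h : a * d - b * c = 1) :
    sliceP P Q R a c * sliceR P Q R b d - sliceQ P Q R a b c d ^ 2 =
      (2 - (a + d)) * sliceDet P Q R a b c d := by
  have hq : sliceQ P Q R a b c d =
      (1 + (1 / 2 - P) * (a - 1) - Q * c) * (d - 1) - (-R * (a - 1) + (1 / 2 + P) * c) * b := by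
    unfold sliceQ; linear_combination (-1 / 2) * h
  have hq' : sliceQ P Q R a b c d =
      ((1 / 2 - P) * b - Q * (d - 1)) * c - (1 - R * b + (1 / 2 + P) * (d - 1)) * (a - 1) := by
    unfold sliceQ; linear_combination (1 / 2) * h
  rw [sq]
  nth_rewrite 1 [hq]
  rw [hq']
  unfold sliceP sliceR sliceDet
  linear_combination ((1 + (1 / 2 - P) * (a - 1) - Q * c) * (1 - R * b + (1 / 2 + P) * (d - 1)) -
    ((1 / 2 - P) * b - Q * (d - 1)) * (-R * (a - 1) + (1 / 2 + P) * c)) * h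

/-- At trace 2 the map A - 1 is nilpotent, so the forms of all charts are multiples of one square.
The chart with X = 1/2 gives trace c - b, and the ratio is det N. -/
lemma slice_trace (P Q R : ℝ) (h : a * d - b * c = 1) (h2 : a + d = 2) :
    sliceP P Q R a c + sliceR P Q R b d = sliceDet P Q R a b c d * (c - b) := by
  have hd : d = 2 - a := by linarith
  subst hd
  rw [sliceDet_eq P Q R h]
  unfold sliceP sliceR
  have h' : (a - 1) ^ 2 = - (b * c) := by linear_combination -h
  linear_combination (R - Q) * h'

end Entries
end RobbinSalamon

/-! ### The candidate index on SL(2, ℝ) and its agreement with chart signatures -/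

namespace RobbinSalamon

open Filter Topology

/-- The Maslov-type index of the endpoint of a path in `SL(2, ℝ)`: `a b c d` are the matrix
entries and `y` is the rotation, in half turns, of the first basis vector. -/
def rotationIndex (a b c d y : ℝ) : ℝ :=
  if a + d < 2 then 2 * (⌊y / 2⌋ : ℝ) + 1
  else 2 * (round (y / 2) : ℝ) + if a + d = 2 then (SignType.sign (c - b) : ℝ) / 2 else 0

/-- `(a, c)` is a positive multiple of the unit vector with angle `y` half turns. -/
def HasAngle (a c y : ℝ) : Prop :=
  ∃ r > 0, a = r * Real.cos (Real.pi * y) ∧ c = r * Real.sin (Real.pi * y)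

section

variable {a b c d y : ℝ}

lemma cos_pi_even (n : ℤ) : Real.cos (Real.pi * (2 * n)) = 1 := by
  rw [← Real.cos_int_mul_two_pi n]; ring_nf

lemma sin_pi_even (n : ℤ) : Real.sin (Real.pi * (2 * n)) = 0 := by
  rw [← Real.sin_int_mul_pi (2 * n)]; push_cast; ring_nf

lemma HasAngle.even {n : ℤ} (h : HasAngle a c (2 * n)) : 0 < a ∧ c = 0 := by
  obtain ⟨r, hr, rfl, rfl⟩ := h
  rw [cos_pi_even, sin_pi_even]; simp [hr]

lemma HasAngle.odd {n : ℤ} (h : HasAngle a c (2 * n + 1)) : a < 0 ∧ c = 0 := by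
  obtain ⟨r, hr, rfl, rfl⟩ := h
  rw [show Real.pi * (2 * n + 1) = Real.pi * (2 * n) + Real.pi by ring, Real.cos_add_pi,
    Real.sin_add_pi, cos_pi_even, sin_pi_even]
  simp [hr]

lemma HasAngle.pos_iff {n : ℤ} (h : HasAngle a c y) (hy : |y - 2 * n| < 1) :
    0 < c ↔ 2 * n < y := by
  obtain ⟨r, hr, rfl, rfl⟩ := h
  have e : Real.sin (Real.pi * y) = Real.sin (Real.pi * (y - 2 * n)) := by
    rw [mul_sub, Real.sin_sub, cos_pi_even, sin_pi_even]; ring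
  rw [e, mul_pos_iff_of_pos_left hr]
  rw [abs_lt] at hy
  have hpi := Real.pi_pos
  constructor
  · intro h
    by_contra hc
    push Not at hc
    have := Real.sin_nonpos_of_nonpos_of_neg_pi_le (x := Real.pi * (y - 2 * n))
      (by nlinarith) (by nlinarith)
    linarith
  · intro h
    exact Real.sin_pos_of_pos_of_lt_pi (by nlinarith) (by nlinarith)

/-- At an even angle the first basis vector is an eigenvector with eigenvalue a > 0, so the trace is
a + 1/a ≥ 2. -/
lemma HasAngle.ne_even (h : HasAngle a c y) (hdet : a * d - b * c = 1) (htr : a + d < 2)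
    (n : ℤ) : y ≠ 2 * n := by
  rintro rfl
  obtain ⟨ha, rfl⟩ := h.even
  have hd : 0 < d := by by_contra hd; nlinarith
  nlinarith [sq_nonneg (a - d)]

/-- At an odd angle both eigenvalues a and 1/a are negative. -/
lemma HasAngle.ne_odd (h : HasAngle a c y) (hdet : a * d - b * c = 1) (htr : 2 ≤ a + d)
    (n : ℤ) : y ≠ 2 * n + 1 := by
  rintro rfl
  obtain ⟨ha, rfl⟩ := h.odd
  nlinarith

lemma HasAngle.abs_sub_round (h : HasAngle a c y) (hdet : a * d - b * c = 1) (htr : 2 ≤ a + d) :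
    |y - 2 * round (y / 2)| < 1 := by
  have h1 := _root_.abs_sub_round (y / 2)
  have h2 : |y - 2 * round (y / 2)| ≤ 1 := by
    have : y - 2 * round (y / 2) = 2 * (y / 2 - round (y / 2)) := by ring
    rw [this, abs_mul, abs_two]; linarith
  refine lt_of_le_of_ne h2 fun h3 => ?_
  rcases (abs_eq (by norm_num : (0 : ℝ) ≤ 1)).1 h3 with h3 | h3
  · exact h.ne_odd hdet htr (round (y / 2)) (by linarith)
  · exact h.ne_odd hdet htr (round (y / 2) - 1) (by push_cast; linarith)

lemma round_half_eq {n : ℤ} (h : |y - 2 * n| < 1) : round (y / 2) = n := by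
  rw [abs_lt] at h
  rw [round_eq, Int.floor_eq_iff]
  constructor <;> linarith

/-- Near parabolic matrices the index is half the signature in the standard chart. -/
lemma rotationIndex_eq_sliceSig {n : ℤ} (hdet : a * d - b * c = 1) (h : HasAngle a c y)
    (hy : |y - 2 * n| < 1) (htr : 0 < a + d) :
    rotationIndex a b c d y = 2 * n + (sliceSig 0 0 0 a b c d : ℝ) / 2 := by
  have hdisc := slice_disc 0 0 0 hdet
  have hD : 0 < sliceDet 0 0 0 a b c d := by rw [sliceDet_eq _ _ _ hdet]; linarith
  rw [sliceSig_eq]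
  rcases lt_trichotomy (a + d) 2 with ht | ht | ht
  · rw [rotationIndex, if_pos ht, planeSig_of_pos (by rw [hdisc]; nlinarith)]
    have hp : sliceP 0 0 0 a c = c := by unfold sliceP; ring
    rw [hp]
    -- An elliptic or negative hyperbolic matrix of trace in (0, 2) is elliptic and cannot be
    -- triangular.
    have hc : c ≠ 0 := by
      rintro rfl
      nlinarith [sq_nonneg (a - d)]
    rw [abs_lt] at hy
    rcases lt_or_gt_of_ne hc with hc | hc
    · have hlt : y < 2 * n := by
        have h1 := (h.pos_iff (abs_lt.2 hy)).not.1 hc.not_gt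
        exact lt_of_le_of_ne (not_lt.1 h1) (h.ne_even hdet ht n)
      have : ⌊y / 2⌋ = n - 1 := by
        rw [Int.floor_eq_iff]; push_cast; constructor <;> linarith
      rw [this, sign_neg hc]; push_cast; norm_num; ring
    · have hlt : 2 * n < y := (h.pos_iff (abs_lt.2 hy)).1 hc
      have : ⌊y / 2⌋ = n := by
        rw [Int.floor_eq_iff]; constructor <;> linarith
      rw [this, sign_pos hc]; push_cast; norm_num
  · rw [rotationIndex, if_neg ht.not_lt, if_pos ht, round_half_eq hy,
      planeSig_of_zero (by rw [hdisc, ht]; ring), slice_trace _ _ _ hdet ht, sign_mul,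
      sign_pos hD, one_mul]
    norm_num
  · rw [rotationIndex, if_neg ht.not_gt, if_neg ht.ne', round_half_eq hy,
      planeSig_of_neg (by rw [hdisc]; nlinarith)]
    simp

end

section Paths

variable {a b c d y : ℝ → ℝ}

/-- Changing the chart alters the signature by a locally constant amount, also at degenerate points.
If A(t₀) ≠ 1, the trace of the form is nonzero and the jump is sign(c - b) sign(2 - tr A) in every
chart. If A(t₀) = 1, the parameters are scaled to 0 with no loss of transversality. -/
lemma eventually_sliceSig_eq_zero_slice (ha : Continuous a) (hb : Continuous b)
    (hc : Continuous c) (hd : Continuous d) (hdet : ∀ t, a t * d t - b t * c t = 1)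
    (P Q R : ℝ) {t₀ : ℝ} (ht₀ : a t₀ + d t₀ = 2)
    (hN : sliceDet P Q R (a t₀) (b t₀) (c t₀) (d t₀) ≠ 0) :
    ∀ᶠ t in 𝓝 t₀,
      sliceSig P Q R (a t) (b t) (c t) (d t) - sliceSig 0 0 0 (a t) (b t) (c t) (d t) =
      sliceSig P Q R (a t₀) (b t₀) (c t₀) (d t₀) -
        sliceSig 0 0 0 (a t₀) (b t₀) (c t₀) (d t₀) := by
  have cP : ∀ P Q R, Continuous fun t => sliceP P Q R (a t) (c t) := by
    intro P Q R; unfold sliceP; fun_prop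
  have cR : ∀ P Q R, Continuous fun t => sliceR P Q R (b t) (d t) := by
    intro P Q R; unfold sliceR; fun_prop
  have cN : ∀ P Q R, Continuous fun t => sliceDet P Q R (a t) (b t) (c t) (d t) := by
    intro P Q R; unfold sliceDet; fun_prop
  have hN0 : sliceDet 0 0 0 (a t₀) (b t₀) (c t₀) (d t₀) ≠ 0 := by
    rw [sliceDet_eq _ _ _ (hdet t₀), ht₀]; norm_num
  by_cases hcb : c t₀ - b t₀ = 0
  -- A symmetric matrix with determinant 1 and trace 2 is the identity.
  · have hsq : (a t₀ - 1) ^ 2 + b t₀ ^ 2 = 0 := by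
      linear_combination -hdet t₀ + a t₀ * ht₀ - b t₀ * hcb
    have hb0 : b t₀ = 0 := by nlinarith [sq_nonneg (a t₀ - 1), sq_nonneg (b t₀)]
    have hc0 : c t₀ = 0 := by linarith
    have ha0 : a t₀ = 1 := by nlinarith [sq_nonneg (a t₀ - 1), sq_nonneg (b t₀)]
    have hd0 : d t₀ = 1 := by linarith
    have e1 : ∀ᶠ t in 𝓝 t₀, |(2 - (a t + d t)) / 4| < 1 / 4 := by
      have : ContinuousAt (fun t => |(2 - (a t + d t)) / 4|) t₀ := by fun_prop
      exact this.eventually_lt_const (by simp [ha0, hd0]; norm_num)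
    have e2 : ∀ᶠ t in 𝓝 t₀, |P * (a t - d t) + Q * c t + R * b t| < 1 / 4 := by
      have : ContinuousAt (fun t => |P * (a t - d t) + Q * c t + R * b t|) t₀ := by fun_prop
      exact this.eventually_lt_const (by simp [ha0, hd0, hb0, hc0])
    have e3 : ∀ᶠ t in 𝓝 t₀, |(P ^ 2 + Q * R) * (2 - (a t + d t))| < 1 / 4 := by
      have : ContinuousAt (fun t => |(P ^ 2 + Q * R) * (2 - (a t + d t))|) t₀ := by fun_prop
      exact this.eventually_lt_const (by simp [ha0, hd0]; norm_num)
    have key : ∀ᶠ t in 𝓝 t₀, sliceSig P Q R (a t) (b t) (c t) (d t) =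
        sliceSig 0 0 0 (a t) (b t) (c t) (d t) := by
      filter_upwards [e1, e2, e3] with t h1 h2 h3
      have hs : ∀ s : ℝ, 0 ≤ s → s ≤ 1 →
          0 < sliceDet (s * P) (s * Q) (s * R) (a t) (b t) (c t) (d t) := by
        intro s hs0 hs1
        rw [sliceDet_eq _ _ _ (hdet t)]
        have h2' : |s * (P * (a t - d t) + Q * c t + R * b t)| < 1 / 4 := by
          rw [abs_mul, abs_of_nonneg hs0]
          nlinarith [abs_nonneg (P * (a t - d t) + Q * c t + R * b t)]
        have h3' : |s ^ 2 * ((P ^ 2 + Q * R) * (2 - (a t + d t)))| < 1 / 4 := by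
          rw [abs_mul, abs_of_nonneg (sq_nonneg s)]
          have : s ^ 2 ≤ 1 := by nlinarith
          nlinarith [abs_nonneg ((P ^ 2 + Q * R) * (2 - (a t + d t)))]
        rw [abs_lt] at h1 h2' h3'
        have e : s * P * (a t - d t) + s * Q * c t + s * R * b t =
          s * (P * (a t - d t) + Q * c t + R * b t) := by ring
        have e' : ((s * P) ^ 2 + s * Q * (s * R)) * (2 - (a t + d t)) =
          s ^ 2 * ((P ^ 2 + Q * R) * (2 - (a t + d t))) := by ring
        rw [e, e']
        linarith
      have hs0 := hs 0 le_rfl zero_le_one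
      have hs1 := hs 1 zero_le_one le_rfl
      simp only [zero_mul, one_mul] at hs0 hs1
      rw [sliceSig_eq, sliceSig_eq]
      rcases lt_trichotomy (a t + d t) 2 with ht | ht | ht
      -- The form stays definite along the deformation. Its first coefficient is affine in s without
      -- zeros on [0, 1]; opposite signs at the ends would put a zero at s = p0 / (p0 - p1).
      · have hpos : ∀ s : ℝ, 0 ≤ s → s ≤ 1 → sliceP (s * P) (s * Q) (s * R) (a t) (c t) ≠ 0 := by
          intro s hs0 hs1 h0
          have := slice_disc (s * P) (s * Q) (s * R) (hdet t)
          rw [h0] at this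
          nlinarith [sq_nonneg (sliceQ (s * P) (s * Q) (s * R) (a t) (b t) (c t) (d t)),
            hs s hs0 hs1]
        rw [planeSig_of_pos (by rw [slice_disc _ _ _ (hdet t)]; nlinarith),
          planeSig_of_pos (by rw [slice_disc _ _ _ (hdet t)]; nlinarith)]
        have aff : ∀ s : ℝ, sliceP (s * P) (s * Q) (s * R) (a t) (c t) =
            sliceP 0 0 0 (a t) (c t) + s * (sliceP P Q R (a t) (c t) -
              sliceP 0 0 0 (a t) (c t)) := by
          intro s; unfold sliceP; ring
        have hp0 := hpos 0 le_rfl zero_le_one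
        have hp1 := hpos 1 zero_le_one le_rfl
        simp only [zero_mul, one_mul] at hp0 hp1
        congr 2
        set p0 := sliceP 0 0 0 (a t) (c t)
        set p1 := sliceP P Q R (a t) (c t)
        rcases lt_or_gt_of_ne hp0 with h0 | h0 <;> rcases lt_or_gt_of_ne hp1 with h1 | h1
        · rw [sign_neg h0, sign_neg h1]
        · refine absurd ?_ (hpos (p0 / (p0 - p1)) (div_nonneg_of_nonpos h0.le (by linarith)) ?_)
          · rw [aff]; have : p0 - p1 ≠ 0 := by linarith
            field_simp; ring
          · rw [div_le_one_of_neg (by linarith)]; linarith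
        · refine absurd ?_ (hpos (p0 / (p0 - p1)) (div_nonneg h0.le (by linarith)) ?_)
          · rw [aff]; have : p0 - p1 ≠ 0 := by linarith
            field_simp; ring
          · rw [div_le_one (by linarith)]; linarith
        · rw [sign_pos h0, sign_pos h1]
      · rw [planeSig_of_zero (by rw [slice_disc _ _ _ (hdet t), ht]; ring),
          planeSig_of_zero (by rw [slice_disc _ _ _ (hdet t), ht]; ring),
          slice_trace _ _ _ (hdet t) ht, slice_trace _ _ _ (hdet t) ht, sign_mul, sign_mul,
          sign_pos hs0, sign_pos hs1]
      · rw [planeSig_of_neg (by rw [slice_disc _ _ _ (hdet t)]; nlinarith),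
          planeSig_of_neg (by rw [slice_disc _ _ _ (hdet t)]; nlinarith)]
    filter_upwards [key] with t ht
    rw [ht, key.self_of_nhds, sub_self, sub_self]
  · have hev : ∀ P Q R, sliceDet P Q R (a t₀) (b t₀) (c t₀) (d t₀) ≠ 0 → ∀ᶠ t in 𝓝 t₀,
        sliceSig P Q R (a t) (b t) (c t) (d t) - sliceSig P Q R (a t₀) (b t₀) (c t₀) (d t₀) =
        SignType.sign (c t₀ - b t₀) * SignType.sign (2 - (a t + d t)) := by
      intro P Q R hN
      have htr := slice_trace P Q R (hdet t₀) ht₀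
      have h1 := eventually_sign_eq
        (f := fun t => sliceP P Q R (a t) (c t) + sliceR P Q R (b t) (d t))
        ((cP P Q R).add (cR P Q R)).continuousAt (t₀ := t₀)
        (by rw [htr]; exact mul_ne_zero hN hcb)
      have h2 := eventually_sign_eq (cN P Q R).continuousAt hN
      filter_upwards [h1, h2] with t h1 h2
      rw [sliceSig_eq, sliceSig_eq, planeSig_eq_mul, planeSig_eq_mul, h1,
        slice_disc _ _ _ (hdet t), slice_disc _ _ _ (hdet t₀), sign_mul, h2, ht₀, htr, sub_self,
        zero_mul, sign_zero, sign_mul]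
      set s := SignType.sign (sliceDet P Q R (a t₀) (b t₀) (c t₀) (d t₀)) with hs
      have hs2 : (s : ℤ) * s = 1 := by
        rcases lt_or_gt_of_ne hN with h | h
        · rw [hs, sign_neg h]; rfl
        · rw [hs, sign_pos h]; rfl
      push_cast
      rw [SignType.coe_zero]
      linear_combination (SignType.sign (c t₀ - b t₀) : ℤ) *
        (SignType.sign (2 - (a t + d t)) : ℤ) * hs2
    filter_upwards [hev P Q R hN, hev 0 0 0 hN0] with t h1 h2
    linarith

/-- Away from trace 2 both terms are locally constant. At trace 2 both jump, but
`rotationIndex_eq_sliceSig` identifies the jump of the index with that in the standard chart, and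
the preceding comparison carries it to any chart. -/
lemma eventually_defect_eq (ha : Continuous a) (hb : Continuous b)
    (hc : Continuous c) (hd : Continuous d) (hy : Continuous y)
    (hdet : ∀ t, a t * d t - b t * c t = 1) (hang : ∀ t, HasAngle (a t) (c t) (y t))
    (P Q R : ℝ) {t₀ : ℝ} (hN : sliceDet P Q R (a t₀) (b t₀) (c t₀) (d t₀) ≠ 0) :
    ∀ᶠ t in 𝓝 t₀,
      (sliceSig P Q R (a t) (b t) (c t) (d t) : ℝ) / 2 -
        rotationIndex (a t) (b t) (c t) (d t) (y t) =
      (sliceSig P Q R (a t₀) (b t₀) (c t₀) (d t₀) : ℝ) / 2 -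
        rotationIndex (a t₀) (b t₀) (c t₀) (d t₀) (y t₀) := by
  have cadd : ContinuousAt (fun t => a t + d t) t₀ := by fun_prop
  by_cases ht₀ : a t₀ + d t₀ = 2
  · have hy₀ := (hang t₀).abs_sub_round (hdet t₀) ht₀.ge
    have e1 : ∀ᶠ t in 𝓝 t₀, |y t - 2 * round (y t₀ / 2)| < 1 := by
      have : ContinuousAt (fun t => |y t - 2 * round (y t₀ / 2)|) t₀ := by fun_prop
      exact this.eventually_lt_const hy₀
    have e2 : ∀ᶠ t in 𝓝 t₀, 0 < a t + d t := cadd.eventually_const_lt (by simp [ht₀])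
    filter_upwards [e1, e2, eventually_sliceSig_eq_zero_slice ha hb hc hd hdet P Q R ht₀ hN]
      with t h1 h2 h3
    rw [rotationIndex_eq_sliceSig (hdet t) (hang t) h1 h2,
      rotationIndex_eq_sliceSig (hdet t₀) (hang t₀) hy₀ (by rw [ht₀]; norm_num)]
    have h3' : (sliceSig P Q R (a t) (b t) (c t) (d t) : ℝ) -
        sliceSig 0 0 0 (a t) (b t) (c t) (d t) = sliceSig P Q R (a t₀) (b t₀) (c t₀) (d t₀) -
        sliceSig 0 0 0 (a t₀) (b t₀) (c t₀) (d t₀) := by exact_mod_cast h3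
    linarith
  · have hsig : ∀ᶠ t in 𝓝 t₀, sliceSig P Q R (a t) (b t) (c t) (d t) =
        sliceSig P Q R (a t₀) (b t₀) (c t₀) (d t₀) := by
      refine eventually_planeSig_eq (p := fun t => sliceP P Q R (a t) (c t))
        (q := fun t => sliceQ P Q R (a t) (b t) (c t) (d t))
        (r := fun t => sliceR P Q R (b t) (d t)) ?_ ?_ ?_ ?_
      · unfold sliceP; fun_prop
      · unfold sliceQ; fun_prop
      · unfold sliceR; fun_prop
      · rw [slice_disc _ _ _ (hdet t₀)]
        exact mul_ne_zero (by intro h; apply ht₀; linarith) hN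
    have hrot : ∀ᶠ t in 𝓝 t₀, rotationIndex (a t) (b t) (c t) (d t) (y t) =
        rotationIndex (a t₀) (b t₀) (c t₀) (d t₀) (y t₀) := by
      rcases lt_or_gt_of_ne ht₀ with h | h
      · have h1 : (⌊y t₀ / 2⌋ : ℝ) < y t₀ / 2 := by
          refine lt_of_le_of_ne (Int.floor_le _) fun h1 => ?_
          exact (hang t₀).ne_even (hdet t₀) h ⌊y t₀ / 2⌋ (by linarith)
        have h2 := Int.lt_floor_add_one (y t₀ / 2)
        have cy : ContinuousAt (fun t => y t / 2) t₀ := by fun_prop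
        filter_upwards [cadd.eventually_lt_const h, cy.eventually_const_lt h1,
          cy.eventually_lt_const h2] with t g1 g2 g3
        rw [rotationIndex, if_pos g1, rotationIndex, if_pos h,
          Int.floor_eq_iff.2 ⟨g2.le, g3⟩]
      · have hy₀ := (hang t₀).abs_sub_round (hdet t₀) h.le
        have e1 : ∀ᶠ t in 𝓝 t₀, |y t - 2 * round (y t₀ / 2)| < 1 := by
          have : ContinuousAt (fun t => |y t - 2 * round (y t₀ / 2)|) t₀ := by fun_prop
          exact this.eventually_lt_const hy₀
        filter_upwards [cadd.eventually_const_lt h, e1] with t g1 g2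
        rw [rotationIndex, if_neg g1.not_gt, if_neg g1.ne', rotationIndex, if_neg h.not_gt,
          if_neg h.ne', round_half_eq g2]
    filter_upwards [hsig, hrot] with t h1 h2
    rw [h1, h2]

/-- A function which is locally constant along an interval takes the same value at its ends. -/
lemma eq_of_eventually_eq {f : ℝ → ℝ} {s t : ℝ} (hst : s ≤ t)
    (h : ∀ x ∈ Set.Icc s t, ∀ᶠ x' in 𝓝 x, f x' = f x) : f t = f s := by
  -- Local constancy gives zero derivative without any prior continuity assumption.
  have hd : ∀ x ∈ Set.Icc s t, HasDerivAt f 0 x := fun x hx =>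
    (hasDerivAt_const x (f x)).congr_of_eventuallyEq (h x hx)
  exact constant_of_has_deriv_right_zero
    (fun x hx => (hd x hx).continuousAt.continuousWithinAt)
    (fun x hx => (hd x (Set.Ico_subset_Icc_self hx)).hasDerivWithinAt) t
    (Set.right_mem_Icc.2 hst)

end Paths

end RobbinSalamon

namespace RobbinSalamon

open Filter Topology

/-! ### Computation of the index -/

/-- Compactness of [0, T] supplies an admissible subdivision. This excludes the default value 0 of
`index`. -/
lemma exists_hasIndex {F : Type*} [AddCommGroup F] [Module ℝ F] (B : LinearMap.BilinForm ℝ F)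
    (Λ : ℝ → Submodule ℝ F) (V : Submodule ℝ F) {T : ℝ} (hT : 0 ≤ T)
    (h : ∀ t₀, ∃ W, IsLagrangian B W ∧ IsCompl V W ∧ ∀ᶠ s in 𝓝 t₀, IsCompl (Λ s) W) :
    ∃ r, HasIndex B Λ V 0 T r := by
  choose W hL hV hW using h
  obtain ⟨t, h0, hmono, ⟨N, hN⟩, hsub⟩ := exists_monotone_Icc_subset_open_cover_Icc hT
    (c := fun i : ℝ => Subtype.val ⁻¹' interior {s | IsCompl (Λ s) (W i)})
    (fun i => isOpen_interior.preimage continuous_subtype_val)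
    (fun x _ => Set.mem_iUnion.2 ⟨x.1, mem_interior_iff_mem_nhds.2 (hW x.1)⟩)
  choose i hi using hsub
  refine ⟨_, N, fun n => (t n : ℝ), fun n => W (i n), h0, hN N le_rfl,
    fun n _ => ⟨hmono (Nat.le_succ n), hL _, hV _, fun s hs => ?_⟩, rfl⟩
  have hs' : s ∈ Set.Icc (0 : ℝ) T := ⟨(t n).2.1.trans hs.1, hs.2.trans (t (n + 1)).2.2⟩
  exact interior_subset (s := {s | IsCompl (Λ s) (W (i n))}) (hi n (show (⟨s, hs'⟩ : Set.Icc (0 : ℝ) T) ∈ _ from ⟨hs.1, hs.2⟩))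

/-- On each piece the change of half the signature equals the change of μ, and the sum telescopes.
In particular the value does not depend on the subdivision or the complements. -/
lemma HasIndex.eq_sub {F : Type*} [AddCommGroup F] [Module ℝ F] {B : LinearMap.BilinForm ℝ F}
    {Λ : ℝ → Submodule ℝ F} {V : Submodule ℝ F} {s t r : ℝ} (μ : ℝ → ℝ)
    (hμ : ∀ W, IsLagrangian B W → IsCompl V W → ∀ t₀, IsCompl (Λ t₀) W → ∀ᶠ s in 𝓝 t₀,
      (graphSign B V W (Λ s) : ℝ) / 2 - μ s = (graphSign B V W (Λ t₀) : ℝ) / 2 - μ t₀)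
    (h : HasIndex B Λ V s t r) : r = μ t - μ s := by
  obtain ⟨N, τ, W, rfl, rfl, hi, rfl⟩ := h
  rw [← Finset.sum_range_sub (fun n => μ (τ n))]
  refine Finset.sum_congr rfl fun n hn => ?_
  obtain ⟨hle, hL, hV, hc⟩ := hi n (Finset.mem_range.1 hn)
  have := eq_of_eventually_eq (f := fun s => (graphSign B V (W n) (Λ s) : ℝ) / 2 - μ s) hle
    (fun x hx => hμ (W n) hL hV x (hc x hx))
  linarith

lemma index_eq_sub {F : Type*} [AddCommGroup F] [Module ℝ F] {B : LinearMap.BilinForm ℝ F}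
    {Λ : ℝ → Submodule ℝ F} {V : Submodule ℝ F} {T : ℝ} (hT : 0 ≤ T) (μ : ℝ → ℝ)
    (hμ : ∀ W, IsLagrangian B W → IsCompl V W → ∀ t₀, IsCompl (Λ t₀) W → ∀ᶠ s in 𝓝 t₀,
      (graphSign B V W (Λ s) : ℝ) / 2 - μ s = (graphSign B V W (Λ t₀) : ℝ) / 2 - μ t₀)
    (h : ∀ t₀, ∃ W, IsLagrangian B W ∧ IsCompl V W ∧ ∀ᶠ s in 𝓝 t₀, IsCompl (Λ s) W) :
    index B Λ V 0 T = μ T - μ 0 := by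
  have hex := exists_hasIndex B Λ V hT h
  rw [index, dif_pos hex]
  exact hex.choose_spec.eq_sub μ hμ

/-- The standard chart fails only at trace -2. There the determinants for P = 1 and P = -1 add up to
-8, so one of them is nonzero. -/
lemma exists_sliceDet_ne_zero {a b c d : ℝ} (h : a * d - b * c = 1) :
    ∃ P Q R, sliceDet P Q R a b c d ≠ 0 := by
  by_cases htr : a + d = -2
  · by_contra hc
    push Not at hc
    have h1 := hc 1 0 0
    have h2 := hc (-1) 0 0
    rw [sliceDet_eq _ _ _ h, htr] at h1 h2
    linarith
  · refine ⟨0, 0, 0, ?_⟩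
    rw [sliceDet_eq _ _ _ h]
    intro h0
    exact htr (by linarith)

lemma conleyZehnder_eq {Ψ : ℝ → (ℝ × ℝ) →ₗ[ℝ] (ℝ × ℝ)} {a b c d y : ℝ → ℝ}
    (hΨ : ∀ t, Ψ t = planeMap (a t) (b t) (c t) (d t)) (hΨ0 : Ψ 0 = LinearMap.id)
    (ha : Continuous a) (hb : Continuous b) (hc : Continuous c) (hd : Continuous d)
    (hy : Continuous y) (hdet : ∀ t, a t * d t - b t * c t = 1)
    (hang : ∀ t, HasAngle (a t) (c t) (y t)) (hy0 : y 0 = 0) {T : ℝ} (hT : 0 ≤ T) :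
    conleyZehnder Ψ T = rotationIndex (a T) (b T) (c T) (d T) (y T) := by
  have h0 : rotationIndex (a 0) (b 0) (c 0) (d 0) (y 0) = 0 := by
    have e1 : Ψ 0 (1, 0) = (1, 0) := by rw [hΨ0]; rfl
    have e2 : Ψ 0 (0, 1) = (0, 1) := by rw [hΨ0]; rfl
    rw [hΨ, planeMap_apply, Prod.ext_iff] at e1 e2
    obtain ⟨e1, e1'⟩ := e1
    obtain ⟨e2, e2'⟩ := e2
    simp only [mul_one, mul_zero, add_zero, zero_add] at e1 e1' e2 e2'
    rw [e1, e1', e2, e2', hy0, rotationIndex]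
    norm_num
  have key := index_eq_sub (B := omegaGraph) (Λ := fun t => LinearMap.graph (Ψ t))
    (V := diagonal) hT (fun t => rotationIndex (a t) (b t) (c t) (d t) (y t)) ?_ ?_
  · rw [conleyZehnder, key, h0, sub_zero]
  · intro W hL hV t₀ hW
    obtain ⟨P, Q, R, hs⟩ := exists_isSlice hL hV
    have hN : ∀ t, IsCompl (LinearMap.graph (Ψ t)) W ↔
        sliceDet P Q R (a t) (b t) (c t) (d t) ≠ 0 := fun t => by
      rw [hΨ, isCompl_graph_slice_iff hs]
    have hN0 := (hN t₀).1 hW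
    have cN : ContinuousAt (fun t => sliceDet P Q R (a t) (b t) (c t) (d t)) t₀ := by
      unfold sliceDet; fun_prop
    filter_upwards [eventually_defect_eq ha hb hc hd hy hdet hang P Q R hN0,
      cN.eventually_ne hN0] with t h1 h2
    rw [hΨ t, hΨ t₀, graphSign_graph hs h2, graphSign_graph hs hN0, h1]
  · intro t₀
    obtain ⟨P, Q, R, hN0⟩ := exists_sliceDet_ne_zero (hdet t₀)
    have cN : ContinuousAt (fun t => sliceDet P Q R (a t) (b t) (c t) (d t)) t₀ := by
      unfold sliceDet; fun_prop
    refine ⟨slice P Q R, isLagrangian_slice P Q R, isCompl_diagonal_slice P Q R, ?_⟩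
    filter_upwards [cN.eventually_ne hN0] with t ht
    rw [hΨ, isCompl_graph_slice_iff (isSlice_slice P Q R)]
    exact ht

/-- Reaching an integer and leaving it on the other side each change the sum by one. Half of it thus
counts crossings with weight 1/2 at an endpoint. -/
lemma eventually_floor_add_ceil {y : ℝ → ℝ} {t₀ : ℝ} (hy : ContinuousAt y t₀) :
    ∀ᶠ t in 𝓝 t₀, ((⌊y t⌋ : ℝ) + ⌈y t⌉ - (⌊y t₀⌋ + ⌈y t₀⌉) : ℝ) =
      if (⌊y t₀⌋ : ℝ) = y t₀ then (SignType.sign (y t - y t₀) : ℝ) else 0 := by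
  by_cases h : (⌊y t₀⌋ : ℝ) = y t₀
  · set n := ⌊y t₀⌋
    have hc : ⌈y t₀⌉ = n := by rw [← h, Int.ceil_intCast]
    filter_upwards [hy.eventually_const_lt (show y t₀ - 1 < y t₀ by linarith),
      hy.eventually_lt_const (show y t₀ < y t₀ + 1 by linarith)] with t h1 h2
    rw [if_pos h, hc]
    rw [← h] at h1 h2 ⊢
    rcases lt_trichotomy (y t) n with h3 | h3 | h3
    · rw [sign_neg (by linarith), show ⌊y t⌋ = n - 1 from Int.floor_eq_iff.2 (by push_cast; constructor <;> linarith),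
       
        show ⌈y t⌉ = n from Int.ceil_eq_iff.2 (by constructor <;> linarith)]
      push_cast; norm_num
    · rw [h3, Int.floor_intCast, Int.ceil_intCast]; simp
    · rw [sign_pos (by linarith), show ⌊y t⌋ = n from Int.floor_eq_iff.2 (by constructor <;> linarith),
        show ⌈y t⌉ = n + 1 from Int.ceil_eq_iff.2 (by push_cast; constructor <;> linarith)]
      push_cast; norm_num
  · have h1 : (⌊y t₀⌋ : ℝ) < y t₀ := lt_of_le_of_ne (Int.floor_le _) h
    have h2 := Int.lt_floor_add_one (y t₀)
    have hc : ⌈y t₀⌉ = ⌊y t₀⌋ + 1 := by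
      rw [Int.ceil_eq_iff]; push_cast; constructor <;> linarith
    filter_upwards [hy.eventually_const_lt h1, hy.eventually_lt_const h2] with t h3 h4
    rw [if_neg h, hc, show ⌊y t⌋ = ⌊y t₀⌋ from Int.floor_eq_iff.2 ⟨h3.le, h4⟩,
      show ⌈y t⌉ = ⌊y t₀⌋ + 1 from Int.ceil_eq_iff.2 (by push_cast; constructor <;> linarith)]
    ring

lemma HasAngle.ne_zero {a c y : ℝ} (h : HasAngle a c y) : a ≠ 0 ∨ c ≠ 0 := by
  obtain ⟨r, hr, rfl, rfl⟩ := h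
  by_contra hc
  push Not at hc
  obtain ⟨h1, h2⟩ := hc
  have h3 := Real.sin_sq_add_cos_sq (Real.pi * y)
  rw [(mul_eq_zero.1 h1).resolve_left hr.ne', (mul_eq_zero.1 h2).resolve_left hr.ne'] at h3
  norm_num at h3

lemma HasAngle.sin_eq_zero_iff {a c y : ℝ} (h : HasAngle a c y) : c = 0 ↔ (⌊y⌋ : ℝ) = y := by
  obtain ⟨r, hr, rfl, rfl⟩ := h
  rw [mul_eq_zero, or_iff_right hr.ne', Real.sin_eq_zero_iff]
  constructor
  · rintro ⟨n, hn⟩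
    have : (n : ℝ) = y := by
      rw [mul_comm] at hn; exact mul_left_cancel₀ Real.pi_ne_zero hn
    rw [← this, Int.floor_intCast]
  · intro hy; exact ⟨⌊y⌋, by rw [hy]; ring⟩

/-- Near the real axis the product of the coordinates detects the direction of rotation. -/
lemma HasAngle.sign_mul_eq {a c y : ℝ} {n : ℤ} (h : HasAngle a c y) (hy : |y - n| < 1 / 2) :
    SignType.sign (c * a) = SignType.sign (y - n) := by
  obtain ⟨r, hr, rfl, rfl⟩ := h
  have hpi := Real.pi_pos
  rw [abs_lt] at hy
  have e : r * Real.sin (Real.pi * y) * (r * Real.cos (Real.pi * y)) =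
      r ^ 2 * Real.cos (Real.pi * (y - n)) * Real.sin (Real.pi * (y - n)) := by
    have e1 : Real.pi * (y - n) = Real.pi * y - n * Real.pi := by ring
    rw [e1, Real.sin_sub_int_mul_pi, Real.cos_sub_int_mul_pi]
    have : ((-1 : ℝ) ^ n) * (-1) ^ n = 1 := by
      rw [← mul_zpow]; norm_num
    linear_combination (-r ^ 2 * Real.sin (Real.pi * y) * Real.cos (Real.pi * y)) * this
  have hcos : 0 < Real.cos (Real.pi * (y - n)) :=
    Real.cos_pos_of_mem_Ioo ⟨by nlinarith, by nlinarith⟩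
  rw [e, sign_mul, sign_pos (by positivity), one_mul]
  rcases lt_trichotomy (y - n) 0 with h | h | h
  · rw [sign_neg h, sign_neg (Real.sin_neg_of_neg_of_neg_pi_lt (by nlinarith) (by nlinarith))]
  · rw [h]; simp
  · rw [sign_pos h, sign_pos (Real.sin_pos_of_pos_of_lt_pi (by nlinarith) (by nlinarith))]

lemma realAxisIndex_eq {Ψ : ℝ → (ℝ × ℝ) →ₗ[ℝ] (ℝ × ℝ)} {a c y : ℝ → ℝ}
    (hΨ : ∀ t, Ψ t (1, 0) = (a t, c t)) (ha : Continuous a) (hc : Continuous c)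
    (hy : Continuous y) (hang : ∀ t, HasAngle (a t) (c t) (y t)) (hy0 : y 0 = 0)
    {T : ℝ} (hT : 0 ≤ T) :
    realAxisIndex Ψ T = ((⌊y T⌋ : ℝ) + ⌈y T⌉) / 2 := by
  have key := index_eq_sub (B := omegaStd) (Λ := fun t => realAxis.map (Ψ t))
    (V := realAxis) hT (fun t => ((⌊y t⌋ : ℝ) + ⌈y t⌉) / 2) ?_ ?_
  · rw [realAxisIndex, key, hy0]; simp
  · intro W hL hV t₀ hW
    obtain ⟨w, hs⟩ := exists_isSteep hV
    have hN0 := (isCompl_map_steep_iff hs (hΨ t₀) (hang t₀).ne_zero).1 hW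
    have cN : ContinuousAt (fun t => a t - w * c t) t₀ := by fun_prop
    have cNc : ContinuousAt (fun t => c t * (a t - w * c t)) t₀ := by fun_prop
    have e1 : ∀ᶠ t in 𝓝 t₀, SignType.sign (c t * (a t - w * c t)) =
        if (⌊y t₀⌋ : ℝ) = y t₀ then SignType.sign (y t - y t₀)
        else SignType.sign (c t₀ * (a t₀ - w * c t₀)) := by
      by_cases h : (⌊y t₀⌋ : ℝ) = y t₀
      · have hc0 := (hang t₀).sin_eq_zero_iff.2 h
        have ha0 : a t₀ ≠ 0 := by simpa [hc0] using hN0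
        have cy : ContinuousAt (fun t => |y t - ⌊y t₀⌋|) t₀ := by fun_prop
        filter_upwards [eventually_sign_eq cN hN0, eventually_sign_eq ha.continuousAt ha0,
          cy.eventually_lt_const (show |y t₀ - ⌊y t₀⌋| < 1 / 2 by rw [h]; norm_num)]
          with t h1 h2 h3
        -- At a crossing c vanishes, so a - wc has the sign of a nearby up to a fixed factor equal
        -- to 1; the complement `W` plays no role.
        have := (hang t).sign_mul_eq h3
        rw [if_pos h, ← h, ← this, sign_mul, sign_mul, h1, h2, hc0]
        simp
      · have hc0 := (hang t₀).sin_eq_zero_iff.not.2 h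
        filter_upwards [eventually_sign_eq cNc (mul_ne_zero hc0 hN0)] with t ht
        rw [if_neg h, ht]
    filter_upwards [cN.eventually_ne hN0, e1, eventually_floor_add_ceil hy.continuousAt]
      with t h1 h2 h3
    rw [graphSign_map hs (hΨ t) (hang t).ne_zero h1,
      graphSign_map hs (hΨ t₀) (hang t₀).ne_zero hN0, h2]
    by_cases h : (⌊y t₀⌋ : ℝ) = y t₀
    · rw [if_pos h] at h3 ⊢
      rw [(hang t₀).sin_eq_zero_iff.2 h]
      simp
      linarith
    · rw [if_neg h] at h3 ⊢
      linarith
  · intro t₀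
    obtain ⟨w, hw⟩ : ∃ w, a t₀ - w * c t₀ ≠ 0 := by
      by_cases h : a t₀ = 0
      · have := (hang t₀).ne_zero.resolve_left (not_not.2 h)
        exact ⟨1, by simpa [h] using this⟩
      · exact ⟨0, by simpa using h⟩
    have cN : ContinuousAt (fun t => a t - w * c t) t₀ := by fun_prop
    refine ⟨steep w, isLagrangian_steep w, isCompl_realAxis_steep w, ?_⟩
    filter_upwards [cN.eventually_ne hw] with t ht
    rw [isCompl_map_steep_iff (isSteep_steep w) (hΨ t) (hang t).ne_zero]
    exact ht

end RobbinSalamon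

namespace RobbinSalamon

open Filter Topology

/-! ### Lifts to the universal cover -/

/-- The unit vector with angle `x` half turns. -/
def unitVec (x : ℝ) : ℝ × ℝ := (Real.cos (Real.pi * x), Real.sin (Real.pi * x))

/-- `z` is a positive multiple of the unit vector with angle `y` half turns. -/
def HasDir (z : ℝ × ℝ) (y : ℝ) : Prop := ∃ r : ℝ, 0 < r ∧ z = r • unitVec y

lemma HasDir.hasAngle {z : ℝ × ℝ} {y : ℝ} (h : HasDir z y) : HasAngle z.1 z.2 y := by
  obtain ⟨r, hr, rfl⟩ := h
  exact ⟨r, hr, rfl, rfl⟩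

lemma hasDir_unitVec (x : ℝ) : HasDir (unitVec x) x := ⟨1, one_pos, by simp⟩

lemma unitVec_add_int (x : ℝ) (n : ℤ) : unitVec (x + n) = (-1 : ℝ) ^ n • unitVec x := by
  have : Real.pi * (x + n) = Real.pi * x + n * Real.pi := by ring
  ext
  · simp only [unitVec, this, Real.cos_add_int_mul_pi]; simp
  · simp only [unitVec, this, Real.sin_add_int_mul_pi]; simp

lemma HasDir.exists_sub_eq {z : ℝ × ℝ} {y y' : ℝ} (h : HasDir z y) (h' : HasDir z y') :
    ∃ n : ℤ, y - y' = 2 * n := by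
  obtain ⟨r, hr, rfl⟩ := h
  obtain ⟨r', hr', h⟩ := h'
  rw [Prod.ext_iff] at h
  obtain ⟨h1, h2⟩ := h
  simp only [unitVec, Prod.smul_fst, Prod.smul_snd, smul_eq_mul] at h1 h2
  have e := Real.sin_sq_add_cos_sq (Real.pi * y)
  have e' := Real.sin_sq_add_cos_sq (Real.pi * y')
  have hrr : r = r' := by
    have : r ^ 2 = r' ^ 2 := by
      linear_combination (r * Real.cos (Real.pi * y) + r' * Real.cos (Real.pi * y')) * h1 +
        (r * Real.sin (Real.pi * y) + r' * Real.sin (Real.pi * y')) * h2 - r ^ 2 * e + r' ^ 2 * e'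
    nlinarith
  subst hrr
  have h1 := mul_left_cancel₀ hr.ne' h1
  have h2 := mul_left_cancel₀ hr.ne' h2
  have hc : Real.cos (Real.pi * y - Real.pi * y') = 1 := by
    rw [Real.cos_sub, h1, h2]; linarith
  obtain ⟨n, hn⟩ := (Real.cos_eq_one_iff _).1 hc
  refine ⟨n, mul_left_cancel₀ Real.pi_ne_zero ?_⟩
  linarith

lemma HasDir.add_int {z : ℝ × ℝ} {y : ℝ} (h : HasDir z y) (n : ℤ) :
    HasDir ((-1 : ℝ) ^ n • z) (y + n) := by
  obtain ⟨r, hr, rfl⟩ := h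
  exact ⟨r, hr, by rw [unitVec_add_int, smul_comm]⟩

lemma HasDir.smul {z : ℝ × ℝ} {y r : ℝ} (h : HasDir z y) (hr : 0 < r) : HasDir (r • z) y := by
  obtain ⟨s, hs, rfl⟩ := h
  exact ⟨r * s, mul_pos hr hs, by rw [smul_smul]⟩

lemma HasDir.map {z : ℝ × ℝ} {x y : ℝ} (A : (ℝ × ℝ) →ₗ[ℝ] (ℝ × ℝ)) (h : HasDir z x)
    (hA : HasDir (A (unitVec x)) y) : HasDir (A z) y := by
  obtain ⟨s, hs, rfl⟩ := h
  rw [map_smul]; exact hA.smul hs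

lemma HasDir.conj {z : ℝ × ℝ} {y : ℝ} (h : HasDir z y) : HasDir (z.1, -z.2) (-y) := by
  obtain ⟨s, hs, rfl⟩ := h
  exact ⟨s, hs, by ext <;> simp [unitVec]⟩

/-- The difference is continuous with values in the discrete set 2ℤ, hence constant. -/
lemma eq_of_even_sub {y y' : ℝ → ℝ} (hy : Continuous y) (hy' : Continuous y')
    (h : ∀ t, ∃ n : ℤ, y t - y' t = 2 * n) (h0 : y 0 = y' 0) (t : ℝ) : y t = y' t := by
  have hloc : ∀ x, ∀ᶠ x' in 𝓝 x, y x' - y' x' = y x - y' x := by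
    intro x
    have hc : ContinuousAt (fun x' => |(y x' - y' x') - (y x - y' x)|) x := by fun_prop
    filter_upwards [hc.eventually_lt_const (show |(y x - y' x) - (y x - y' x)| < 1 by simp)]
      with x' hx'
    obtain ⟨m, hm⟩ := h x
    obtain ⟨n, hn⟩ := h x'
    rw [hm, hn] at hx' ⊢
    rw [← mul_sub, abs_lt] at hx'
    have h1 : -1 < 2 * (n - m) := by exact_mod_cast hx'.1
    have h2 : 2 * (n - m) < 1 := by exact_mod_cast hx'.2
    rw [show n = m by omega]
  have : y t - y' t = y 0 - y' 0 := by
    rcases le_total 0 t with ht | ht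
    · exact eq_of_eventually_eq (f := fun t => y t - y' t) ht fun x _ => hloc x
    · exact (eq_of_eventually_eq (f := fun t => y t - y' t) ht fun x _ => hloc x).symm
  linarith

lemma hasDir_lift_unique {z : ℝ → ℝ × ℝ} {y y' : ℝ → ℝ} (hy : Continuous y)
    (hy' : Continuous y') (h : ∀ t, HasDir (z t) (y t)) (h' : ∀ t, HasDir (z t) (y' t))
    (h0 : y 0 = y' 0) (t : ℝ) : y t = y' t :=
  eq_of_even_sub hy hy' (fun t => (h t).exists_sub_eq (h' t)) h0 t

/-- A continuous path of symplectic maps of the plane starting at the identity. -/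
structure IsSymplecticPath (Ψ : ℝ → (ℝ × ℝ) →ₗ[ℝ] (ℝ × ℝ)) : Prop where
  continuous : ∀ u, Continuous fun t => Ψ t u
  symplectic : ∀ t u v, omegaStd (Ψ t u) (Ψ t v) = omegaStd u v
  map_zero : Ψ 0 = LinearMap.id

/-- `θ` is the lift of the action of `Ψ` on directions, with angles in half turns. -/
structure IsLift (Ψ : ℝ → (ℝ × ℝ) →ₗ[ℝ] (ℝ × ℝ)) (θ : ℝ → ℝ → ℝ) : Prop where
  continuous : Continuous fun p : ℝ × ℝ => θ p.1 p.2
  map_zero : ∀ x, θ 0 x = x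
  hasDir : ∀ t x, HasDir (Ψ t (unitVec x)) (θ t x)

section Lift

variable {Ψ : ℝ → (ℝ × ℝ) →ₗ[ℝ] (ℝ × ℝ)} {θ : ℝ → ℝ → ℝ}

lemma apply_eq_basis (A : (ℝ × ℝ) →ₗ[ℝ] (ℝ × ℝ)) (u : ℝ × ℝ) :
    A u = u.1 • A (1, 0) + u.2 • A (0, 1) := by
  rw [← map_smul, ← map_smul, ← map_add]; simp

lemma IsSymplecticPath.injective (h : IsSymplecticPath Ψ) (t : ℝ) : Function.Injective (Ψ t) := by
  rw [injective_iff_map_eq_zero]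
  rintro ⟨x, y⟩ hu
  have h1 := h.symplectic t (x, y) (0, 1)
  have h2 := h.symplectic t (x, y) (1, 0)
  rw [hu] at h1 h2
  simp at h1 h2
  simp [← h1, h2]

/-- The map (t, x) ↦ Ψ_t(unitVec x) avoids 0, so it lifts through the covering exp from ℂ to ℂ minus
0, the plane being simply connected. The imaginary part of the lift over π is the angle. -/
lemma IsSymplecticPath.exists_isLift (h : IsSymplecticPath Ψ) : ∃ θ, IsLift Ψ θ := by
  have hcont : Continuous fun p : ℝ × ℝ => Ψ p.1 (unitVec p.2) := by
    have h1 := (h.continuous (1, 0)).comp (continuous_fst (X := ℝ) (Y := ℝ))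
    have h2 := (h.continuous (0, 1)).comp (continuous_fst (X := ℝ) (Y := ℝ))
    simp only [Function.comp_def] at h1 h2
    have : (fun p : ℝ × ℝ => Ψ p.1 (unitVec p.2)) = fun p : ℝ × ℝ =>
      Real.cos (Real.pi * p.2) • Ψ p.1 (1, 0) + Real.sin (Real.pi * p.2) • Ψ p.1 (0, 1) := by
      funext p; rw [apply_eq_basis]; rfl
    rw [this]
    have hc : Continuous fun p : ℝ × ℝ => Real.cos (Real.pi * p.2) := by fun_prop
    have hs : Continuous fun p : ℝ × ℝ => Real.sin (Real.pi * p.2) := by fun_prop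
    exact (hc.smul h1).add (hs.smul h2)
  have hunit : ∀ x, unitVec x ≠ 0 := by
    intro x hx
    have e := Real.sin_sq_add_cos_sq (Real.pi * x)
    simp only [unitVec, Prod.mk_eq_zero] at hx
    rw [hx.1, hx.2] at e
    norm_num at e
  have hne : ∀ p : ℝ × ℝ, (⟨(Ψ p.1 (unitVec p.2)).1, (Ψ p.1 (unitVec p.2)).2⟩ : ℂ) ≠ 0 := by
    intro p hp
    rw [Complex.ext_iff] at hp
    have : Ψ p.1 (unitVec p.2) = 0 := Prod.ext hp.1 hp.2
    exact hunit _ (h.injective p.1 (by rw [this, _root_.map_zero]))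
  have hcc : Continuous fun p : ℝ × ℝ =>
      (⟨(Ψ p.1 (unitVec p.2)).1, (Ψ p.1 (unitVec p.2)).2⟩ : ℂ) := by
    have : (fun p : ℝ × ℝ => (⟨(Ψ p.1 (unitVec p.2)).1, (Ψ p.1 (unitVec p.2)).2⟩ : ℂ)) =
      fun p => Complex.equivRealProdCLM.symm (Ψ p.1 (unitVec p.2)) := by
      funext p; apply Complex.ext <;> simp
    rw [this]
    exact Complex.equivRealProdCLM.symm.continuous.comp hcont
  let f : C(ℝ × ℝ, {z : ℂ // z ≠ 0}) := ⟨fun p => ⟨_, hne p⟩, hcc.subtype_mk _⟩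
  obtain ⟨F, ⟨hF0, hF⟩, -⟩ := Complex.isCoveringMap_exp.existsUnique_continuousMap_lifts f
    (0, 0) 0 (by
      apply Subtype.ext
      apply Complex.ext <;> simp [f, h.map_zero, unitVec])
  have hdir : ∀ t x, HasDir (Ψ t (unitVec x)) ((F (t, x)).im / Real.pi) := by
    intro t x
    have e := congrArg Subtype.val (congrFun hF (t, x))
    simp only [Function.comp_apply, f, ContinuousMap.coe_mk] at e
    refine ⟨Real.exp (F (t, x)).re, Real.exp_pos _, ?_⟩
    rw [Complex.ext_iff] at e
    dsimp only at e
    have e3 : Real.pi * ((F (t, x)).im / Real.pi) = (F (t, x)).im := by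
      field_simp
    ext
    · rw [← e.1, Complex.exp_re]; simp [unitVec, e3]
    · rw [← e.2, Complex.exp_im]; simp [unitVec, e3]
  refine ⟨fun t x => (F (t, x)).im / Real.pi, ?_, fun x => ?_, hdir⟩
  · exact (Complex.continuous_im.comp F.continuous).div_const _
  · refine hasDir_lift_unique (z := unitVec) (y := fun x => (F (0, x)).im / Real.pi)
      (y' := fun x => x) (by fun_prop) continuous_id (fun x => ?_) hasDir_unitVec ?_ x
    · have := hdir 0 x
      rwa [h.map_zero] at this
    · simp [hF0]

lemma IsLift.continuous_left (hθ : IsLift Ψ θ) (x : ℝ) : Continuous fun t => θ t x :=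
  hθ.continuous.comp (continuous_id.prodMk continuous_const)

lemma IsLift.continuous_right (hθ : IsLift Ψ θ) (t : ℝ) : Continuous (θ t) :=
  hθ.continuous.comp (continuous_const.prodMk continuous_id)

lemma IsLift.add_int (hθ : IsLift Ψ θ) (t x : ℝ) (n : ℤ) : θ t (x + n) = θ t x + n := by
  refine hasDir_lift_unique (z := fun t => Ψ t (unitVec (x + n))) (y := fun t => θ t (x + n))
    (y' := fun t => θ t x + n) (hθ.continuous_left _) ((hθ.continuous_left x).add_const _)
    (fun t => hθ.hasDir _ _) (fun t => ?_) ?_ t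
  · rw [unitVec_add_int, map_smul]
    exact (hθ.hasDir t x).add_int n
  · simp [hθ.map_zero]

/-- Order holds at time 0. If it failed later, two angles would coincide at some time s; injectivity
of Ψ_s makes the initial angles differ by an even integer, and translation equivariance then
preserves that difference. -/
lemma IsLift.strictMono (h : IsSymplecticPath Ψ) (hθ : IsLift Ψ θ) (t : ℝ) :
    StrictMono (θ t) := by
  intro x x' hx
  by_contra hc
  push Not at hc
  have hcont : Continuous fun s => θ s x' - θ s x :=
    (hθ.continuous_left x').sub (hθ.continuous_left x)
  obtain ⟨s, hs⟩ := mem_range_of_exists_le_of_exists_ge hcont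
    (c := 0) ⟨t, by linarith⟩ ⟨0, by rw [hθ.map_zero, hθ.map_zero]; linarith⟩
  have h1 := hθ.hasDir s x
  have h2 := hθ.hasDir s x'
  rw [show θ s x' = θ s x by linarith] at h2
  have hpar : HasDir (unitVec x) x' := by
    obtain ⟨r, hr, e⟩ := h1
    obtain ⟨r', hr', e'⟩ := h2
    refine ⟨r / r', div_pos hr hr', h.injective s ?_⟩
    rw [map_smul, e, e', smul_smul]
    congr 1
    field_simp
  obtain ⟨n, hn⟩ := hpar.exists_sub_eq (hasDir_unitVec x)
  have h3 := hθ.add_int s x (2 * n)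
  push_cast at h3
  rw [← hn] at h3
  simp only [add_sub_cancel] at h3
  linarith

lemma IsLift.comp (hθ : IsLift Ψ θ) {T : ℝ} (hT : ∀ t, Ψ (t + T) = Ψ t ∘ₗ Ψ T) (t x : ℝ) :
    θ (t + T) x = θ t (θ T x) := by
  refine hasDir_lift_unique (z := fun t => Ψ t (Ψ T (unitVec x))) (y := fun t => θ (t + T) x)
    (y' := fun t => θ t (θ T x)) ((hθ.continuous_left x).comp (continuous_add_const T))
    (hθ.continuous_left _) (fun t => ?_) (fun t => (hθ.hasDir T x).map _ (hθ.hasDir _ _)) ?_ t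
  · have := hθ.hasDir (t + T) x
    rwa [hT] at this
  · simp [hθ.map_zero]

lemma IsLift.neg (hθ : IsLift Ψ θ)
    (hI : ∀ t x y, Ψ (-t) (x, -y) = ((Ψ t (x, y)).1, -(Ψ t (x, y)).2)) (t x : ℝ) :
    θ (-t) (-x) = -θ t x := by
  refine hasDir_lift_unique (z := fun t => Ψ (-t) (unitVec (-x))) (y := fun t => θ (-t) (-x))
    (y' := fun t => -θ t x) ((hθ.continuous_left _).comp continuous_neg)
    (hθ.continuous_left _).neg (fun t => hθ.hasDir _ _) (fun t => ?_) ?_ t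
  · have e : unitVec (-x) = ((unitVec x).1, -(unitVec x).2) := by ext <;> simp [unitVec]
    rw [e, hI]
    exact (hθ.hasDir t x).conj
  · simp [hθ.map_zero]

lemma IsSymplecticPath.eq_planeMap (t : ℝ) : Ψ t =
    planeMap (Ψ t (1, 0)).1 (Ψ t (0, 1)).1 (Ψ t (1, 0)).2 (Ψ t (0, 1)).2 := by
  refine LinearMap.ext fun u => ?_
  rw [apply_eq_basis]
  ext <;> simp [mul_comm]

lemma unitVec_zero : unitVec 0 = (1, 0) := by simp [unitVec]

lemma exists_angle (x y : ℝ) (h : x ≠ 0 ∨ y ≠ 0) : ∃ s, HasDir (x, y) s := by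
  have hz : (⟨x, y⟩ : ℂ) ≠ 0 := by
    intro h0
    rw [Complex.ext_iff] at h0
    simp at h0
    tauto
  refine ⟨Complex.arg ⟨x, y⟩ / Real.pi, ‖(⟨x, y⟩ : ℂ)‖, norm_pos_iff.2 hz, ?_⟩
  have e : Real.pi * (Complex.arg ⟨x, y⟩ / Real.pi) = Complex.arg ⟨x, y⟩ := by field_simp
  ext
  · simp only [unitVec, e, Prod.smul_mk, smul_eq_mul, Complex.norm_mul_cos_arg]
  · simp only [unitVec, e, Prod.smul_mk, smul_eq_mul, Complex.norm_mul_sin_arg]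

/-- The Conley-Zehnder index in terms of the lift. -/
lemma le_conleyZehnder_iff (h : IsSymplecticPath Ψ) (hθ : IsLift Ψ θ) {T : ℝ} (hT : 0 ≤ T)
    (k : ℤ) : 2 * (k : ℝ) + 1 ≤ conleyZehnder Ψ T ↔ ∀ x, x + 2 * k < θ T x := by
  have hdet : ∀ t, (Ψ t (1, 0)).1 * (Ψ t (0, 1)).2 - (Ψ t (0, 1)).1 * (Ψ t (1, 0)).2 = 1 := by
    intro t
    have := h.symplectic t (1, 0) (0, 1)
    simp at this
    linarith
  have hang : ∀ t, HasAngle (Ψ t (1, 0)).1 (Ψ t (1, 0)).2 (θ t 0) := fun t => by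
    have := (hθ.hasDir t 0).hasAngle
    rwa [unitVec_zero] at this
  rw [conleyZehnder_eq (fun t => IsSymplecticPath.eq_planeMap t) h.map_zero
    (continuous_fst.comp (h.continuous _)) (continuous_fst.comp (h.continuous _))
    (continuous_snd.comp (h.continuous _)) (continuous_snd.comp (h.continuous _))
    (hθ.continuous_left 0) hdet hang (hθ.map_zero 0) hT]
  have hdetT := hdet T
  have hangT := hang T
  set a := (Ψ T (1, 0)).1
  set b := (Ψ T (0, 1)).1
  set c := (Ψ T (1, 0)).2
  set d := (Ψ T (0, 1)).2
  set y := θ T 0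
  have hΨ : ∀ u v, Ψ T (u, v) = (a * u + b * v, c * u + d * v) := fun u v => by
    rw [apply_eq_basis]
    ext <;> simp [a, b, c, d, mul_comm]
  have hmono := hθ.strictMono h T
  -- Monotonicity and integer equivariance bound the oscillation of the displacement by a half turn.
  have hdev : ∀ x x', θ T x - x < θ T x' - x' + 1 := by
    intro x x'
    have h1 : x - x' < ⌊x - x'⌋ + 1 := Int.lt_floor_add_one _
    have h2 : (⌊x - x'⌋ : ℝ) ≤ x - x' := Int.floor_le _
    have h3 := hθ.add_int T x' (⌊x - x'⌋ + 1)
    have h4 : θ T x < θ T (x' + (⌊x - x'⌋ + 1 : ℤ)) := hmono (by push_cast; linarith)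
    rw [h3] at h4
    push_cast at h4
    linarith
  rcases lt_or_ge (a + d) 2 with htr | htr
  · rw [rotationIndex, if_pos htr]
    -- An even displacement means a positive eigenvalue r, and r² + 1 = r tr A < 2r is impossible.
    -- The displacement therefore stays between consecutive even integers.
    have hne : ∀ x, ∀ n : ℤ, θ T x - x ≠ 2 * n := by
      intro x n hx
      have h1 := hθ.hasDir T x
      obtain ⟨r, hr, e⟩ := h1
      rw [show θ T x = x + (2 * n : ℤ) by push_cast; linarith, unitVec_add_int] at e
      have e2 : (-1 : ℝ) ^ (2 * n) = 1 := by rw [zpow_mul]; norm_num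
      rw [e2, one_smul] at e
      set u := unitVec x with hu
      have e' := hΨ u.1 u.2
      rw [Prod.mk.eta, e, Prod.ext_iff] at e'
      simp only [Prod.smul_fst, Prod.smul_snd, smul_eq_mul] at e'
      have hchar : (a - r) * (d - r) - b * c = 0 := by
        by_contra hc
        obtain ⟨h1, h2⟩ := eq_zero_of_det_ne_zero (x := u.1) (y := u.2) hc
          (by linarith [e'.1]) (by linarith [e'.2])
        have := Real.sin_sq_add_cos_sq (Real.pi * x)
        simp only [hu, unitVec] at h1 h2
        rw [h1, h2] at this
        norm_num at this
      have : r ^ 2 - (a + d) * r + 1 = 0 := by linear_combination hchar - hdetT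
      nlinarith [sq_nonneg (r - 1)]
    constructor
    · intro hk x
      have hk' : k ≤ ⌊y / 2⌋ := by
        have : (k : ℝ) ≤ ⌊y / 2⌋ := by linarith
        exact_mod_cast this
      have hy : 2 * (k : ℝ) ≤ y := by
        have := Int.le_floor.1 hk'
        linarith
      by_contra hc
      push Not at hc
      obtain ⟨s, hs⟩ := mem_range_of_exists_le_of_exists_ge (c := 2 * (k : ℝ))
        ((hθ.continuous_right T).sub continuous_id) ⟨x, by simp; linarith⟩
        ⟨0, by simpa using hy⟩
      exact hne s k hs
    · intro hx
      have h0 := hx 0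
      have : k ≤ ⌊y / 2⌋ := Int.le_floor.2 (by simp only [y]; linarith)
      have : (k : ℝ) ≤ ⌊y / 2⌋ := by exact_mod_cast this
      linarith
  -- The larger eigenvalue is positive, and its eigendirection is displaced by an even integer 2n.
  -- All displacements then lie in (2n - 1, 2n + 1).
  · obtain ⟨x₀, n, hx₀⟩ : ∃ x₀, ∃ n : ℤ, θ T x₀ - x₀ = 2 * n := by
      set r := (a + d + Real.sqrt ((a + d) ^ 2 - 4)) / 2 with hr
      have hr0 : 0 < r := by positivity
      have hr1 : r ^ 2 - (a + d) * r + 1 = 0 := by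
        have := Real.sq_sqrt (show 0 ≤ (a + d) ^ 2 - 4 by nlinarith)
        rw [hr]; linear_combination this / 4
      obtain ⟨u, v, huv, h1, h2⟩ := exists_ne_zero_of_det_eq_zero
        (show (a - r) * (d - r) - b * c = 0 by linear_combination hr1 + hdetT)
      obtain ⟨s, hs⟩ := exists_angle u v huv
      have e : Ψ T (u, v) = r • (u, v) := by
        rw [hΨ]; ext
        · simp; linarith
        · simp; linarith
      obtain ⟨n, hn⟩ := (hs.map (Ψ T) (hθ.hasDir T s)).exists_sub_eq (e ▸ hs.smul hr0)
      exact ⟨s, n, hn⟩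
    have hyn : |y - 2 * n| < 1 := by
      have h1 := hdev 0 x₀
      have h2 := hdev x₀ 0
      rw [abs_lt]
      constructor <;> simp only [y] <;> linarith
    -- The parabolic correction is too small to matter: both sides of the equivalence amount to k <
    -- n.
    have hsgn : |(if a + d = 2 then (SignType.sign (c - b) : ℝ) / 2 else 0)| ≤ 1 / 2 := by
      split_ifs
      · rcases lt_trichotomy (c - b) 0 with h | h | h
        · simp [sign_neg h, abs_div]
        · simp [h]
        · simp [sign_pos h]
      · simp
    rw [abs_le] at hsgn
    rw [rotationIndex, if_neg htr.not_gt, round_half_eq hyn]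
    constructor
    · intro hk x
      have hkn : k < n := by
        by_contra hc
        push Not at hc
        have : (n : ℝ) ≤ k := by exact_mod_cast hc
        linarith [hsgn.2]
      have : (k : ℝ) + 1 ≤ n := by exact_mod_cast hkn
      have := hdev x₀ x
      linarith
    · intro hx
      have h1 := hx x₀
      have hkn : k < n := by
        have : (k : ℝ) < n := by linarith
        exact_mod_cast this
      have : (k : ℝ) + 1 ≤ n := by exact_mod_cast hkn
      linarith [hsgn.1]

/-- The index of a path of lines in terms of the lift. -/
lemma le_realAxisIndex_iff (h : IsSymplecticPath Ψ) (hθ : IsLift Ψ θ) {T : ℝ} (hT : 0 ≤ T)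
    (k : ℤ) : (k : ℝ) + 1 / 2 ≤ realAxisIndex Ψ T ↔ (k : ℝ) < θ T 0 := by
  have hang : ∀ t, HasAngle (Ψ t (1, 0)).1 (Ψ t (1, 0)).2 (θ t 0) := fun t => by
    have := (hθ.hasDir t 0).hasAngle
    rwa [unitVec_zero] at this
  rw [realAxisIndex_eq (fun t => rfl) (continuous_fst.comp (h.continuous _))
    (continuous_snd.comp (h.continuous _)) (hθ.continuous_left 0) hang (hθ.map_zero 0) hT]
  constructor
  · intro hk
    by_contra hc
    push Not at hc
    have h1 := Int.floor_le (θ T 0)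
    have h2 : ⌈θ T 0⌉ ≤ k := Int.ceil_le.2 hc
    have h2 : (⌈θ T 0⌉ : ℝ) ≤ k := by exact_mod_cast h2
    linarith
  · intro hk
    have h1 : k ≤ ⌊θ T 0⌋ := Int.le_floor.2 hk.le
    have h2 : k < ⌈θ T 0⌉ := Int.lt_ceil.2 hk
    have h1 : (k : ℝ) ≤ ⌊θ T 0⌋ := by exact_mod_cast h1
    have h2 : (k : ℝ) + 1 ≤ ⌈θ T 0⌉ := by exact_mod_cast h2
    linarith

/-! ### Iteration -/

/-- The index bounds become lower bounds 0 and 2 for the displacement of θ_T, which add up under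
iteration. Below 1 there is a point not moved forward, and its orbit under the increasing map θ_T
never exceeds it. -/
theorem conleyZehnder_iterate (h : IsSymplecticPath Ψ) {T : ℝ} (hT : 0 < T)
    (hper : ∀ t, Ψ (t + T) = Ψ t ∘ₗ Ψ T) {m : ℕ} (hm : 1 ≤ m) :
    (conleyZehnder Ψ T < 1 → conleyZehnder Ψ (m * T) < 1) ∧
    (1 ≤ conleyZehnder Ψ T → 1 ≤ conleyZehnder Ψ (m * T)) ∧
    (3 ≤ conleyZehnder Ψ T → 2 * (m : ℝ) + 1 ≤ conleyZehnder Ψ (m * T)) := by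
  obtain ⟨θ, hθ⟩ := h.exists_isLift
  have hmT : 0 ≤ m * T := by positivity
  have hcomp := hθ.comp hper
  have up : ∀ k : ℤ, (∀ x, x + 2 * k < θ T x) → ∀ n : ℕ, 1 ≤ n → ∀ x,
      x + 2 * (n * k) < θ (n * T) x := by
    intro k hk n hn
    induction n, hn using Nat.le_induction with
    | base => intro x; simpa using hk x
    | succ n hn ih =>
      intro x
      have h1 := ih (θ T x)
      rw [← hcomp] at h1
      rw [show ((n + 1 : ℕ) : ℝ) * T = n * T + T by push_cast; ring]
      push_cast
      linarith [hk x]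
  have e0 : ∀ t, 0 ≤ t → (1 ≤ conleyZehnder Ψ t ↔ ∀ x, x < θ t x) := fun t ht => by
    have := le_conleyZehnder_iff h hθ ht 0
    simpa using this
  refine ⟨?_, ?_, ?_⟩
  · rw [← not_le, ← not_le, e0 T hT.le, e0 _ hmT]
    intro hx hall
    push Not at hx
    obtain ⟨x, hx⟩ := hx
    have : ∀ n : ℕ, θ (n * T) x ≤ x := by
      intro n
      induction n with
      | zero => simp [hθ.map_zero]
      | succ n ih =>
        rw [show ((n + 1 : ℕ) : ℝ) * T = n * T + T by push_cast; ring, hcomp]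
        exact ((hθ.strictMono h _).monotone hx).trans ih
    exact absurd (hall x) (this m).not_gt
  · rw [e0 T hT.le, e0 _ hmT]
    intro hx x
    have := up 0 (by simpa using hx) m hm x
    simpa using this
  · intro h3
    have h3' := (le_conleyZehnder_iff h hθ hT.le 1).1 (by push_cast; linarith)
    have := (le_conleyZehnder_iff h hθ hmT m).2 (fun x => by
      have := up 1 h3' m hm x
      push_cast at this ⊢
      linarith)
    exact_mod_cast this

/-- Write τ = -τ + 2τ and use θ_{-τ}(z) = -θ_τ(-z). -/
lemma IsLift.reflect {τ : ℝ} (hθ : IsLift Ψ θ)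
    (hper : ∀ t, Ψ (t + 2 * τ) = Ψ t ∘ₗ Ψ (2 * τ))
    (hI : ∀ t x y, Ψ (-t) (x, -y) = ((Ψ t (x, y)).1, -(Ψ t (x, y)).2)) (x : ℝ) :
    θ τ x = -θ τ (-θ (2 * τ) x) := by
  rw [← hθ.neg hI, neg_neg, ← hθ.comp hper]
  congr 1; ring

/-- Only 2τ is a period, so the induction advances two chords at a time. Reflection supplies the
base case of two chords. -/
theorem realAxisIndex_iterate (h : IsSymplecticPath Ψ) {τ : ℝ} (hτ : 0 < τ)
    (hper : ∀ t, Ψ (t + 2 * τ) = Ψ t ∘ₗ Ψ (2 * τ))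
    (hI : ∀ t x y, Ψ (-t) (x, -y) = ((Ψ t (x, y)).1, -(Ψ t (x, y)).2)) {m : ℕ} (hm : 1 ≤ m) :
    (realAxisIndex Ψ τ < 1 / 2 → realAxisIndex Ψ (m * τ) < 1 / 2) ∧
    (1 / 2 ≤ realAxisIndex Ψ τ → 1 / 2 ≤ realAxisIndex Ψ (m * τ)) ∧
    (3 / 2 ≤ realAxisIndex Ψ τ → (2 * (m : ℝ) + 1) / 2 ≤ realAxisIndex Ψ (m * τ)) := by
  obtain ⟨θ, hθ⟩ := h.exists_isLift
  have hmT : 0 ≤ m * τ := by positivity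
  have hcomp := hθ.comp hper
  have hmono := hθ.strictMono h
  have href := hθ.reflect hper hI
  have hsucc : ∀ n : ℕ, θ ((n + 2 : ℕ) * τ) 0 = θ (n * τ) (θ (2 * τ) 0) := by
    intro n
    rw [← hcomp]
    congr 1; push_cast; ring
  have up : ∀ k : ℤ, (k : ℝ) < θ τ 0 → ∀ n : ℕ, (n + 1 : ℝ) * k < θ ((n + 1 : ℕ) * τ) 0 := by
    intro k hk
    -- If θ_{2τ}(0) ≤ 2k, reflection and monotonicity give θ_τ(0) ≤ -θ_τ(-2k) = 2k - θ_τ(0),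
    -- contradicting θ_τ(0) > k.
    have h2 : 2 * (k : ℝ) < θ (2 * τ) 0 := by
      by_contra hc
      push Not at hc
      have h1 := (hmono τ).monotone (neg_le_neg hc)
      have h2 := hθ.add_int τ 0 (-(2 * k))
      push_cast at h2
      rw [zero_add] at h2
      linarith [href 0]
    intro n
    induction n using Nat.twoStepInduction with
    | zero => simpa using hk
    | one => norm_num; exact h2
    | more n ih _ =>
      rw [show n + 2 + 1 = (n + 1) + 2 by ring, hsucc]
      have h3 := hmono ((n + 1 : ℕ) * τ) h2
      have h4 := hθ.add_int ((n + 1 : ℕ) * τ) 0 (2 * k)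
      push_cast at h4 h3 ih ⊢
      rw [zero_add] at h4
      linarith
  obtain ⟨n, rfl⟩ : ∃ n, m = n + 1 := ⟨m - 1, by omega⟩
  have e0 : ∀ t, 0 ≤ t → (1 / 2 ≤ realAxisIndex Ψ t ↔ 0 < θ t 0) := fun t ht => by
    have := le_realAxisIndex_iff h hθ ht 0
    simpa using this
  refine ⟨?_, ?_, ?_⟩
  · rw [← not_le, ← not_le, e0 τ hτ.le, e0 _ hmT, not_lt, not_lt]
    intro h0
    have h2 : θ (2 * τ) 0 ≤ 0 := by
      by_contra hc
      push Not at hc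
      have := hmono τ (neg_lt_zero.2 hc)
      linarith [href 0]
    clear hm hmT
    induction n using Nat.twoStepInduction with
    | zero => simpa using h0
    | one => norm_num; exact h2
    | more n ih _ =>
      rw [show n + 2 + 1 = (n + 1) + 2 by ring, hsucc]
      exact ((hmono _).monotone h2).trans ih
  · rw [e0 τ hτ.le, e0 _ hmT]
    intro h0
    have := up 0 (by simpa using h0) n
    simpa using this
  · intro h3
    have h3' := (le_realAxisIndex_iff h hθ hτ.le 1).1 (by push_cast; linarith)
    have := (le_realAxisIndex_iff h hθ hmT (n + 1 : ℕ)).2 (by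
      have := up 1 h3' n
      push_cast at this ⊢
      linarith)
    push_cast at this ⊢
    linarith

/-- From θ_{2τ}(0) > 2, reflection gives θ_τ(0) > -θ_τ(-2) = 2 - θ_τ(0), that is θ_τ(0) > 1. -/
theorem le_realAxisIndex_of_le_conleyZehnder (h : IsSymplecticPath Ψ) {τ : ℝ} (hτ : 0 < τ)
    (hper : ∀ t, Ψ (t + 2 * τ) = Ψ t ∘ₗ Ψ (2 * τ))
    (hI : ∀ t x y, Ψ (-t) (x, -y) = ((Ψ t (x, y)).1, -(Ψ t (x, y)).2))
    (h3 : 3 ≤ conleyZehnder Ψ (2 * τ)) : 3 / 2 ≤ realAxisIndex Ψ τ := by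
  obtain ⟨θ, hθ⟩ := h.exists_isLift
  have h1 := (le_conleyZehnder_iff h hθ (T := 2 * τ) (by positivity) 1).1 (by push_cast; linarith) 0
  have key : ((1 : ℤ) : ℝ) < θ τ 0 := by
    by_contra hc
    push Not at hc
    push_cast at hc h1
    have h2 := hθ.strictMono h τ (show -θ (2 * τ) 0 < -2 by linarith)
    have h3 := hθ.add_int τ 0 (-2)
    push_cast at h3
    rw [zero_add] at h3
    linarith [hθ.reflect hper hI 0]
  have := (le_realAxisIndex_iff h hθ hτ.le 1).2 key
  push_cast at this
  linarith

end Lift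

end RobbinSalamon

/-! ### One-forms in charts and naturality of the exterior derivative -/

namespace RealContact

open Filter Topology

section Calculus

variable {V E : Type*} [NormedAddCommGroup V] [NormedSpace ℝ V] [NormedAddCommGroup E]
  [NormedSpace ℝ E]

/-- The exterior derivative of one-forms on normed spaces commutes with pullback. -/
lemma hasFDerivAt_pullback {F : V → E} {a : E → E →L[ℝ] ℝ} {z : V} (hF : ContDiffAt ℝ 2 F z)
    (ha : DifferentiableAt ℝ a (F z)) :
    DifferentiableAt ℝ (fun z => (a (F z)).comp (fderiv ℝ F z)) z ∧ ∀ e₁ e₂,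
    fderiv ℝ (fun z => (a (F z)).comp (fderiv ℝ F z)) z e₁ e₂ -
      fderiv ℝ (fun z => (a (F z)).comp (fderiv ℝ F z)) z e₂ e₁ =
    fderiv ℝ a (F z) (fderiv ℝ F z e₁) (fderiv ℝ F z e₂) -
      fderiv ℝ a (F z) (fderiv ℝ F z e₂) (fderiv ℝ F z e₁) := by
  have hF1 : HasFDerivAt F (fderiv ℝ F z) z :=
    (hF.differentiableAt (by norm_num)).hasFDerivAt
  have hF2 : HasFDerivAt (fderiv ℝ F) (fderiv ℝ (fderiv ℝ F) z) z :=
    ((hF.fderiv_right (m := 1) (by norm_num)).differentiableAt (by norm_num)).hasFDerivAt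
  have h := (ha.hasFDerivAt.comp z hF1).clm_comp hF2
  refine ⟨h.differentiableAt, fun e₁ e₂ => ?_⟩
  have h' : fderiv ℝ (fun z => (a (F z)).comp (fderiv ℝ F z)) z = _ := h.fderiv
  rw [h']
  -- The terms with the second derivative of `F` cancel by its symmetry.
  have hs := hF.isSymmSndFDerivAt (by simp)
  simp [hs.eq e₁ e₂]

end Calculus

variable {E : Type*} [NormedAddCommGroup E] [NormedSpace ℝ E]
  {M : Type*} [TopologicalSpace M] [ChartedSpace E M]

lemma bundle_ext {p q : M} (h : p = q) {v : TangentSpace 𝓘(ℝ, E) p} {w : TangentSpace 𝓘(ℝ, E) q}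
    (hv : (v : E) = (w : E)) : (⟨p, v⟩ : TangentBundle 𝓘(ℝ, E) M) = ⟨q, w⟩ := by
  subst h
  exact congrArg _ hv

lemma bundle_mk_inj {p : M} {v w : TangentSpace 𝓘(ℝ, E) p}
    (h : (⟨p, v⟩ : TangentBundle 𝓘(ℝ, E) M) = ⟨p, w⟩) : v = w := by
  cases h; rfl

/-- A one-form as a function on the tangent bundle. -/
def formFun (α : ∀ p : M, TangentSpace 𝓘(ℝ, E) p →L[ℝ] ℝ) (v : TangentBundle 𝓘(ℝ, E) M) : ℝ :=
  α v.proj v.snd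

lemma tangentMap_congr {V N : Type*} [NormedAddCommGroup V] [NormedSpace ℝ V]
    [TopologicalSpace N] [ChartedSpace V N] {f g : N → M} {x : N}
    (h : f =ᶠ[𝓝 x] g) (w : TangentSpace 𝓘(ℝ, V) x) :
    tangentMap 𝓘(ℝ, V) 𝓘(ℝ, E) f ⟨x, w⟩ = tangentMap 𝓘(ℝ, V) 𝓘(ℝ, E) g ⟨x, w⟩ :=
  bundle_ext h.self_of_nhds (by
    have := h.mfderiv_eq (I := 𝓘(ℝ, V)) (I' := 𝓘(ℝ, E))
    exact congrArg (fun L : V →L[ℝ] E => L w) this)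

section Pullback

variable [IsManifold 𝓘(ℝ, E) ∞ M] {α : ∀ p : M, TangentSpace 𝓘(ℝ, E) p →L[ℝ] ℝ}

/-- On a constant vector the chart form is α composed with the tangent map of the inverse chart,
which is smooth; in finite dimension, evaluation on vectors detects smoothness. -/
lemma differentiableAt_chartForm [FiniteDimensional ℝ E]
    (hα : ContMDiff 𝓘(ℝ, E).tangent 𝓘(ℝ, ℝ) ∞
      (fun v : TangentBundle 𝓘(ℝ, E) M => α v.proj v.snd)) (p : M) :
    DifferentiableAt ℝ (chartForm α p) (extChartAt 𝓘(ℝ, E) p p) := by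
  set U := (extChartAt 𝓘(ℝ, E) p).target with hUdef
  have hU : IsOpen U := isOpen_extChartAt_target p
  have hx0 : extChartAt 𝓘(ℝ, E) p p ∈ U := mem_extChartAt_target p
  have key : ContDiffOn ℝ ∞ (chartForm α p) U := by
    rw [contDiffOn_clm_apply]
    intro w
    have h1 : ContMDiffOn 𝓘(ℝ, E) 𝓘(ℝ, E) ∞ (extChartAt 𝓘(ℝ, E) p).symm U :=
      contMDiffOn_extChartAt_symm p
    have h2 := h1.contMDiffOn_tangentMapWithin (m := ∞) (by simp) hU.uniqueMDiffOn
    have h3 : ContMDiffOn 𝓘(ℝ, E) 𝓘(ℝ, E).tangent ∞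
        (fun x : E => (⟨x, w⟩ : TangentBundle 𝓘(ℝ, E) E)) U := by
      intro x hx
      apply ContMDiffAt.contMDiffWithinAt
      refine (Bundle.contMDiffAt_section (E := TangentSpace 𝓘(ℝ, E) (M := E))
        (s := fun _ => w) x).2 ?_
      simp only [trivializationAt_model_space_apply]
      exact contMDiffAt_const
    have h4 := (hα.comp_contMDiffOn (h2.comp h3 (fun x hx => hx)))
    rw [contMDiffOn_iff_contDiffOn] at h4
    refine h4.congr fun x hx => ?_
    simp only [chartForm, Function.comp_apply, tangentMapWithin,
      mfderivWithin_of_isOpen hU hx]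
    rfl
  exact (key.contDiffAt (hU.mem_nhds hx0)).differentiableAt (by simp)

end Pullback

end RealContact

namespace RealContact

open Filter Topology

variable {E : Type*} [NormedAddCommGroup E] [NormedSpace ℝ E]
  {M : Type*} [TopologicalSpace M] [ChartedSpace E M]
  {α : ∀ p : M, TangentSpace 𝓘(ℝ, E) p →L[ℝ] ℝ}

lemma extD_congr {p q : M} {v w : TangentSpace 𝓘(ℝ, E) p} {v' w' : TangentSpace 𝓘(ℝ, E) q}
    (hv : (⟨p, v⟩ : TangentBundle 𝓘(ℝ, E) M) = ⟨q, v'⟩)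
    (hw : (⟨p, w⟩ : TangentBundle 𝓘(ℝ, E) M) = ⟨q, w'⟩) : extD α p v w = extD α q v' w' := by
  cases hv
  rw [bundle_mk_inj hw]

variable [IsManifold 𝓘(ℝ, E) ∞ M]

lemma contMDiffAt_extChartAt_symm (p : M) :
    ContMDiffAt 𝓘(ℝ, E) 𝓘(ℝ, E) ∞ (extChartAt 𝓘(ℝ, E) p).symm (extChartAt 𝓘(ℝ, E) p p) :=
  (contMDiffOn_extChartAt_symm p).contMDiffAt (extChartAt_target_mem_nhds p)

lemma mfderiv_extChartAt_symm_self (p : M) (v : E) :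
    mfderiv 𝓘(ℝ, E) 𝓘(ℝ, E) (extChartAt 𝓘(ℝ, E) p).symm (extChartAt 𝓘(ℝ, E) p p) v = v := by
  have h := mfderivWithin_extChartAt_symm_comp_mfderiv_extChartAt' (I := 𝓘(ℝ, E))
    (mem_extChartAt_source (I := 𝓘(ℝ, E)) p)
  rw [mfderiv_extChartAt_self, show Set.range 𝓘(ℝ, E) = Set.univ by simp, mfderivWithin_univ] at h
  exact congrArg (fun L : E →L[ℝ] E => L v) h

lemma extD_eq (p : M) (v w : TangentSpace 𝓘(ℝ, E) p) :
    extD α p v w = fderiv ℝ (chartForm α p) (extChartAt 𝓘(ℝ, E) p p) v w -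
      fderiv ℝ (chartForm α p) (extChartAt 𝓘(ℝ, E) p p) w v := by
  simp only [extD, mfderiv_extChartAt_self]
  rfl

variable [FiniteDimensional ℝ E]

/-- The exterior derivative of the pullback of a one-form to a normed space. -/
lemma fderiv_pullback_sub {V : Type*} [NormedAddCommGroup V] [NormedSpace ℝ V]
    (hα : ContMDiff 𝓘(ℝ, E).tangent 𝓘(ℝ, ℝ) ∞
      (fun v : TangentBundle 𝓘(ℝ, E) M => α v.proj v.snd))
    {G : V → M} {z : V} (hG : ContMDiffAt 𝓘(ℝ, V) 𝓘(ℝ, E) 2 G z) {b : V → V →L[ℝ] ℝ}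
    (hb : ∀ᶠ z' in 𝓝 z, ∀ w : V,
      b z' w = formFun α (tangentMap 𝓘(ℝ, V) 𝓘(ℝ, E) G ⟨z', w⟩)) :
    DifferentiableAt ℝ b z ∧ ∀ e₁ e₂ : V, fderiv ℝ b z e₁ e₂ - fderiv ℝ b z e₂ e₁ =
      extD α (G z) (mfderiv 𝓘(ℝ, V) 𝓘(ℝ, E) G z e₁) (mfderiv 𝓘(ℝ, V) 𝓘(ℝ, E) G z e₂) := by
  set ψ := extChartAt 𝓘(ℝ, E) (G z) with hψ
  have hF : ContMDiffAt 𝓘(ℝ, V) 𝓘(ℝ, E) 2 (ψ ∘ G) z :=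
    (contMDiffAt_extChartAt (n := 2)).comp z hG
  have hFc : ContDiffAt ℝ 2 (ψ ∘ G) z := contMDiffAt_iff_contDiffAt.1 hF
  have hsrc : ∀ᶠ z' in 𝓝 z, G z' ∈ ψ.source :=
    hG.continuousAt.eventually_mem (extChartAt_source_mem_nhds _)
  have hGe : ∀ᶠ z' in 𝓝 z, ContMDiffAt 𝓘(ℝ, V) 𝓘(ℝ, E) 2 G z' := (contMDiffAt_iff_contMDiffAt_nhds (by simp)).1 hG
  -- Inserting ψ⁻¹ ∘ ψ writes `b` as a pullback between normed spaces.
  have heq : ∀ᶠ z' in 𝓝 z, b z' = (chartForm α (G z) ((ψ ∘ G) z')).comp (fderiv ℝ (ψ ∘ G) z') := by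
    filter_upwards [hb, hsrc.eventually_nhds, hGe] with z' hb' hs' hG'
    ext w
    rw [hb' w]
    have hs'' := hs'.self_of_nhds
    have hch : MDifferentiableAt 𝓘(ℝ, E) 𝓘(ℝ, E) ψ (G z') :=
      mdifferentiableAt_extChartAt (by simpa [hψ] using hs'')
    have hGd := hG'.mdifferentiableAt (by norm_num)
    have hsymm : MDifferentiableAt 𝓘(ℝ, E) 𝓘(ℝ, E) ψ.symm (ψ (G z')) := by
      have := mdifferentiableWithinAt_extChartAt_symm (I := 𝓘(ℝ, E)) (x := G z)
        (ψ.map_source hs'')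
      rw [show Set.range 𝓘(ℝ, E) = Set.univ by simp, mdifferentiableWithinAt_univ] at this
      exact this
    have h1 : tangentMap 𝓘(ℝ, V) 𝓘(ℝ, E) G ⟨z', w⟩ =
        tangentMap 𝓘(ℝ, V) 𝓘(ℝ, E) (ψ.symm ∘ (ψ ∘ G)) ⟨z', w⟩ := by
      refine tangentMap_congr ?_ w
      filter_upwards [hs'] with y hy
      exact (ψ.left_inv hy).symm
    rw [h1, tangentMap_comp_at (I' := 𝓘(ℝ, E)) _ hsymm (hch.comp z' hGd)]
    simp only [tangentMap, formFun, chartForm, mfderiv_eq_fderiv]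
    rfl
  have hfd : fderiv ℝ b z = _ := Filter.EventuallyEq.fderiv_eq heq
  obtain ⟨hd, hp⟩ := hasFDerivAt_pullback hFc (a := chartForm α (G z))
    (differentiableAt_chartForm hα (G z))
  refine ⟨hd.congr_of_eventuallyEq heq, fun e₁ e₂ => ?_⟩
  rw [hfd, hp e₁ e₂]
  have hder : ∀ e : V, fderiv ℝ (ψ ∘ G) z e =
      mfderiv 𝓘(ℝ, E) 𝓘(ℝ, E) ψ (G z) (mfderiv 𝓘(ℝ, V) 𝓘(ℝ, E) G z e) := by
    intro e
    rw [← mfderiv_eq_fderiv]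
    exact mfderiv_comp_apply z (mdifferentiableAt_extChartAt (by simp))
      (hG.mdifferentiableAt (by norm_num)) e
  rw [hder, hder]
  rfl

/-- A map which rescales a one-form by a constant rescales its exterior derivative. -/
lemma extD_map (hα : ContMDiff 𝓘(ℝ, E).tangent 𝓘(ℝ, ℝ) ∞
      (fun v : TangentBundle 𝓘(ℝ, E) M => α v.proj v.snd))
    {f : M → M} {p : M} (hf : ContMDiffAt 𝓘(ℝ, E) 𝓘(ℝ, E) 2 f p) (κ : ℝ)
    (h : ∀ᶠ q in 𝓝 p, ∀ v, α (f q) (mfderiv 𝓘(ℝ, E) 𝓘(ℝ, E) f q v) = κ * α q v)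
    (v w : TangentSpace 𝓘(ℝ, E) p) :
    extD α (f p) (mfderiv 𝓘(ℝ, E) 𝓘(ℝ, E) f p v) (mfderiv 𝓘(ℝ, E) 𝓘(ℝ, E) f p w) =
      κ * extD α p v w := by
  set ψ := extChartAt 𝓘(ℝ, E) p with hψ
  have hsymm : ContMDiffAt 𝓘(ℝ, E) 𝓘(ℝ, E) 2 ψ.symm (ψ p) :=
    (contMDiffAt_extChartAt_symm p).of_le (by norm_cast)
  have hp : ψ.symm (ψ p) = p := extChartAt_to_inv p
  have hf' : ContMDiffAt 𝓘(ℝ, E) 𝓘(ℝ, E) 2 f (ψ.symm (ψ p)) := by rwa [hp]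
  have hG : ContMDiffAt 𝓘(ℝ, E) 𝓘(ℝ, E) 2 (f ∘ ψ.symm) (ψ p) := hf'.comp (ψ p) hsymm
  have hb : ∀ᶠ z in 𝓝 (ψ p), ∀ w : E, (κ • chartForm α p z) w =
      formFun α (tangentMap 𝓘(ℝ, E) 𝓘(ℝ, E) (f ∘ ψ.symm) ⟨z, w⟩) := by
    have hc : Tendsto ψ.symm (𝓝 (ψ p)) (𝓝 p) := by
      have := hsymm.continuousAt
      rwa [ContinuousAt, hp] at this
    have hfe : ∀ᶠ q in 𝓝 p, ContMDiffAt 𝓘(ℝ, E) 𝓘(ℝ, E) 2 f q := (contMDiffAt_iff_contMDiffAt_nhds (by simp)).1 hf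
    filter_upwards [hc.eventually h, hc.eventually hfe,
      (contMDiffAt_iff_contMDiffAt_nhds (by simp)).1 hsymm] with z h1 h2 h3
    intro w
    rw [tangentMap_comp_at (I' := 𝓘(ℝ, E)) _ (h2.mdifferentiableAt (by norm_num))
      (h3.mdifferentiableAt (by norm_num))]
    exact (h1 (mfderiv 𝓘(ℝ, E) 𝓘(ℝ, E) ψ.symm z w)).symm
  obtain ⟨-, h2⟩ := fderiv_pullback_sub hα hG hb
  have hd : fderiv ℝ (fun z => κ • chartForm α p z) (ψ p) = κ • fderiv ℝ (chartForm α p) (ψ p) :=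
    fderiv_const_smul (differentiableAt_chartForm hα p) κ
  have hm : ∀ v : E, (⟨(f ∘ ψ.symm) (ψ p), mfderiv 𝓘(ℝ, E) 𝓘(ℝ, E) (f ∘ ψ.symm) (ψ p) v⟩ :
      TangentBundle 𝓘(ℝ, E) M) = ⟨f p, mfderiv 𝓘(ℝ, E) 𝓘(ℝ, E) f p v⟩ := by
    intro v
    refine bundle_ext (congrArg f hp) ?_
    refine (mfderiv_comp_apply (ψ p) (hf'.mdifferentiableAt (by norm_num))
      (hsymm.mdifferentiableAt (by norm_num)) v).trans ?_
    have h4 : mfderiv 𝓘(ℝ, E) 𝓘(ℝ, E) ψ.symm (ψ p) v = v := mfderiv_extChartAt_symm_self p v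
    refine (congrArg _ h4).trans ?_
    exact congrArg (fun q => (mfderiv 𝓘(ℝ, E) 𝓘(ℝ, E) f q : E →L[ℝ] E) v) hp
  have h3 : ∀ v w : E, extD α ((f ∘ ψ.symm) (ψ p))
      (mfderiv 𝓘(ℝ, E) 𝓘(ℝ, E) (f ∘ ψ.symm) (ψ p) v)
      (mfderiv 𝓘(ℝ, E) 𝓘(ℝ, E) (f ∘ ψ.symm) (ψ p) w) =
    extD α (f p) (mfderiv 𝓘(ℝ, E) 𝓘(ℝ, E) f p v) (mfderiv 𝓘(ℝ, E) 𝓘(ℝ, E) f p w) :=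
    fun v w => extD_congr (hm v) (hm w)
  refine (h3 v w).symm.trans ((h2 v w).symm.trans ?_)
  rw [hd, extD_eq]
  exact (mul_sub κ _ _).symm

end RealContact

/-! ### The Reeb vector and the tangent map of its flow -/

namespace RealContact

open Filter Topology

/-- The Reeb vector of a linear form and a two-form which is nondegenerate on its kernel. -/
lemma exists_reeb_vector {E : Type*} [AddCommGroup E] [Module ℝ E] [FiniteDimensional ℝ E]
    {a : E →ₗ[ℝ] ℝ} (ha : a ≠ 0) {β : E →ₗ[ℝ] E →ₗ[ℝ] ℝ} (halt : ∀ v, β v v = 0)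
    (nd : ∀ v, a v = 0 → (∀ w, a w = 0 → β v w = 0) → v = 0) :
    ∃ X, a X = 1 ∧ ∀ w, β X w = 0 := by
  obtain ⟨u₀, hu₀⟩ : ∃ u, a u ≠ 0 := by
    by_contra! h
    exact ha (LinearMap.ext h)
  set u := (a u₀)⁻¹ • u₀
  have hu : a u = 1 := by simp [u, hu₀]
  set K := LinearMap.ker a
  let B : K →ₗ[ℝ] Module.Dual ℝ K :=
    { toFun := fun k => β k ∘ₗ K.subtype
      map_add' := fun x y => by ext; simp
      map_smul' := fun c x => by ext; simp }
  have hB : Function.Injective B := by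
    rw [injective_iff_map_eq_zero]
    intro k hk
    refine Subtype.ext (nd k k.2 fun w hw => ?_)
    exact congrArg (fun L : Module.Dual ℝ K => L ⟨w, hw⟩) hk
  have hB' : Function.Surjective B :=
    (LinearMap.injective_iff_surjective_of_finrank_eq_finrank Subspace.dual_finrank_eq.symm).1 hB
  -- Nondegeneracy on the kernel allows u to be corrected by k so that β(u - k, ·) vanishes on it.
  -- Since β is alternating, it then vanishes on u - k too.
  obtain ⟨k, hk⟩ := hB' (β u ∘ₗ K.subtype)
  have hX : a (u - k) = 1 := by
    rw [map_sub, hu, show a k = 0 from k.2, sub_zero]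
  have hK : ∀ w, a w = 0 → β (u - k) w = 0 := fun w hw => by
    have := congrArg (fun L : Module.Dual ℝ K => L ⟨w, hw⟩) hk
    simp only [B, LinearMap.coe_mk, AddHom.coe_mk, LinearMap.comp_apply, Submodule.subtype_apply]
      at this
    rw [map_sub, LinearMap.sub_apply, this, sub_self]
  refine ⟨u - k, hX, fun w => ?_⟩
  have h := hK (w - a w • (u - k)) (by rw [map_sub, map_smul, hX]; simp)
  rw [map_sub, map_smul, halt] at h
  simpa using h

variable {E : Type*} [NormedAddCommGroup E] [NormedSpace ℝ E]
  {M : Type*} [TopologicalSpace M] [ChartedSpace E M]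
  {α : ∀ p : M, TangentSpace 𝓘(ℝ, E) p →L[ℝ] ℝ}

/-- The exterior derivative of a one-form as a bilinear map. -/
def extDBilin (α : ∀ p : M, TangentSpace 𝓘(ℝ, E) p →L[ℝ] ℝ) (p : M) : E →ₗ[ℝ] E →ₗ[ℝ] ℝ :=
  LinearMap.mk₂ ℝ (fun v w : E => fderiv ℝ (chartForm α p) (extChartAt 𝓘(ℝ, E) p p) v w -
      fderiv ℝ (chartForm α p) (extChartAt 𝓘(ℝ, E) p p) w v)
    (by intros; simp; ring) (by intros; simp; ring) (by intros; simp; ring)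
    (by intros; simp; ring)

variable {X : ∀ p : M, TangentSpace 𝓘(ℝ, E) p} {D : Set (ℝ × M)} {φ : ℝ → M → M}

lemma IsMaximalFlow.contMDiffAt (hφ : IsMaximalFlow X D φ) {t : ℝ} {p : M} (h : (t, p) ∈ D) :
    ContMDiffAt (𝓘(ℝ, ℝ).prod 𝓘(ℝ, E)) 𝓘(ℝ, E) ∞ (fun x : ℝ × M => φ x.1 x.2) (t, p) :=
  hφ.smooth.contMDiffAt (hφ.isOpen.mem_nhds h)

lemma IsMaximalFlow.contMDiffAt_time (hφ : IsMaximalFlow X D φ) {t : ℝ} {p : M}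
    (h : (t, p) ∈ D) : ContMDiffAt 𝓘(ℝ, E) 𝓘(ℝ, E) ∞ (φ t) p :=
  (hφ.contMDiffAt h).comp p (contMDiffAt_const.prodMk contMDiffAt_id)

lemma IsMaximalFlow.isOpen_time (hφ : IsMaximalFlow X D φ) (p : M) :
    IsOpen {t : ℝ | (t, p) ∈ D} :=
  hφ.isOpen.preimage (by fun_prop)

lemma IsMaximalFlow.hasMFDerivAt (hφ : IsMaximalFlow X D φ) {t : ℝ} {p : M} (h : (t, p) ∈ D) :
    HasMFDerivAt 𝓘(ℝ, ℝ) 𝓘(ℝ, E) (fun t => φ t p) t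
      ((1 : ℝ →L[ℝ] ℝ).smulRight (X (φ t p))) :=
  (hφ.integral p t h).hasMFDerivAt ((hφ.isOpen_time p).mem_nhds h)

lemma IsMaximalFlow.tangentMap_right (hφ : IsMaximalFlow X D φ) {t : ℝ} {p : M} (h : (t, p) ∈ D)
    (v : TangentSpace 𝓘(ℝ, E) p) :
    tangentMap (𝓘(ℝ, ℝ).prod 𝓘(ℝ, E)) 𝓘(ℝ, E) (fun x : ℝ × M => φ x.1 x.2)
      ((equivTangentBundleProd 𝓘(ℝ, ℝ) ℝ 𝓘(ℝ, E) M).symm (⟨t, (0 : ℝ)⟩, ⟨p, v⟩)) =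
    tangentMap 𝓘(ℝ, E) 𝓘(ℝ, E) (φ t) ⟨p, v⟩ := by
  refine bundle_ext rfl ?_
  have h1 := mfderiv_comp_apply p (g := fun x : ℝ × M => φ x.1 x.2) (f := fun q : M => (t, q))
    (I := 𝓘(ℝ, E)) (I' := 𝓘(ℝ, ℝ).prod 𝓘(ℝ, E)) (I'' := 𝓘(ℝ, E))
    ((hφ.contMDiffAt h).mdifferentiableAt (by simp))
    (mdifferentiableAt_const.prodMk mdifferentiableAt_id) v
  rw [mfderiv_prod_right] at h1
  exact h1.symm

lemma IsMaximalFlow.tangentMap_left (hφ : IsMaximalFlow X D φ) {t : ℝ} {p : M} (h : (t, p) ∈ D) :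
    tangentMap (𝓘(ℝ, ℝ).prod 𝓘(ℝ, E)) 𝓘(ℝ, E) (fun x : ℝ × M => φ x.1 x.2)
      ((equivTangentBundleProd 𝓘(ℝ, ℝ) ℝ 𝓘(ℝ, E) M).symm (⟨t, (1 : ℝ)⟩, ⟨p, 0⟩)) =
    ⟨φ t p, X (φ t p)⟩ := by
  refine bundle_ext rfl ?_
  have h1 := mfderiv_comp_apply t (g := fun x : ℝ × M => φ x.1 x.2) (f := fun s : ℝ => (s, p))
    (I := 𝓘(ℝ, ℝ)) (I' := 𝓘(ℝ, ℝ).prod 𝓘(ℝ, E)) (I'' := 𝓘(ℝ, E))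
    ((hφ.contMDiffAt h).mdifferentiableAt (by simp))
    (mdifferentiableAt_id.prodMk mdifferentiableAt_const) (1 : ℝ)
  rw [mfderiv_prod_left] at h1
  refine h1.symm.trans ?_
  have h2 := (hφ.hasMFDerivAt h).mfderiv
  refine (congrArg (fun L : ℝ →L[ℝ] E => L 1) h2).trans ?_
  exact one_smul ℝ _

variable [IsManifold 𝓘(ℝ, E) ∞ M]

lemma extD_eq_extDBilin (p : M) (v w : TangentSpace 𝓘(ℝ, E) p) :
    extD α p v w = extDBilin α p v w :=
  extD_eq p v w

lemma IsContactForm.reebField_spec [FiniteDimensional ℝ E] (hα : IsContactForm α) (p : M) :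
    α p (reebField α p) = 1 ∧ ∀ w, extD α p (reebField α p) w = 0 := by
  refine Classical.epsilon_spec
    (p := fun X : TangentSpace 𝓘(ℝ, E) p => α p X = 1 ∧ ∀ w, extD α p X w = 0) ?_
  let a : E →L[ℝ] ℝ := α p
  have h0 : (a : E →ₗ[ℝ] ℝ) ≠ 0 := fun h =>
    hα.ne_zero p (ContinuousLinearMap.coe_injective h)
  obtain ⟨X, h1, h2⟩ := exists_reeb_vector h0 (β := extDBilin α p)
    (fun v => sub_self _) (fun v hv hw => hα.nondegenerate p v hv fun w hw' =>
      (extD_eq_extDBilin p v w).trans (hw w hw'))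
  exact ⟨X, h1, fun w => (extD_eq_extDBilin p X w).trans (h2 w)⟩

lemma IsContactForm.eq_reebField [FiniteDimensional ℝ E] (hα : IsContactForm α) {p : M}
    {Y : TangentSpace 𝓘(ℝ, E) p}
    (h1 : α p Y = 1) (h2 : ∀ w, extD α p Y w = 0) : Y = reebField α p := by
  obtain ⟨h3, h4⟩ := hα.reebField_spec p
  refine sub_eq_zero.1 (hα.nondegenerate p _ ?_ fun w _ => ?_)
  · rw [map_sub, h1, h3, sub_self]
  · have h5 := h2 w
    have h6 := h4 w
    rw [extD_eq_extDBilin] at h5 h6 ⊢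
    refine (congrArg (fun L : E →ₗ[ℝ] ℝ => L w) (map_sub (extDBilin α p) Y _)).trans ?_
    exact (congrArg₂ (· - ·) h5 h6).trans (sub_self _)

/-- The tangent map of the flow, as a function of time and of the tangent vector. -/
lemma IsMaximalFlow.contMDiffOn_tangentMap (hφ : IsMaximalFlow X D φ) :
    ContMDiffOn (𝓘(ℝ, ℝ).tangent.prod 𝓘(ℝ, E).tangent) 𝓘(ℝ, E).tangent ∞
      (fun z : TangentBundle 𝓘(ℝ, ℝ) ℝ × TangentBundle 𝓘(ℝ, E) M =>
        tangentMap (𝓘(ℝ, ℝ).prod 𝓘(ℝ, E)) 𝓘(ℝ, E) (fun x : ℝ × M => φ x.1 x.2)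
          ((equivTangentBundleProd 𝓘(ℝ, ℝ) ℝ 𝓘(ℝ, E) M).symm z))
      {z | (z.1.proj, z.2.proj) ∈ D} := by
  have h1 := hφ.smooth.contMDiffOn_tangentMapWithin (m := ∞) (by simp) hφ.isOpen.uniqueMDiffOn
  have h2 : ContMDiff (𝓘(ℝ, ℝ).tangent.prod 𝓘(ℝ, E).tangent) (𝓘(ℝ, ℝ).prod 𝓘(ℝ, E)).tangent ∞
    (equivTangentBundleProd 𝓘(ℝ, ℝ) ℝ 𝓘(ℝ, E) M).symm := contMDiff_equivTangentBundleProd_symm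
  have h3 : Set.MapsTo (equivTangentBundleProd 𝓘(ℝ, ℝ) ℝ 𝓘(ℝ, E) M).symm
      {z | (z.1.proj, z.2.proj) ∈ D}
      (Bundle.TotalSpace.proj (F := ℝ × E) (E := TangentSpace (𝓘(ℝ, ℝ).prod 𝓘(ℝ, E))) ⁻¹' D) :=
    fun z hz => hz
  refine (ContMDiffOn.comp h1 h2.contMDiffOn h3).congr fun z hz => ?_
  simp only [Function.comp_apply, tangentMapWithin, tangentMap]
  rw [mfderivWithin_of_isOpen hφ.isOpen (h3 hz)]

/-- The field is the image of ∂/∂t at time 0 under the tangent map of the flow. Its smoothness,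
needed for uniqueness of integral curves, is thus inherited from the flow. -/
lemma IsMaximalFlow.contMDiff_field (hφ : IsMaximalFlow X D φ) :
    ContMDiff 𝓘(ℝ, E) 𝓘(ℝ, E).tangent ∞ (fun p => (⟨p, X p⟩ : TangentBundle 𝓘(ℝ, E) M)) := by
  have h1 : ContMDiff 𝓘(ℝ, E) (𝓘(ℝ, ℝ).tangent.prod 𝓘(ℝ, E).tangent) ∞
      (fun p : M => ((⟨0, (1 : ℝ)⟩ : TangentBundle 𝓘(ℝ, ℝ) ℝ),
        (⟨p, 0⟩ : TangentBundle 𝓘(ℝ, E) M))) :=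
    contMDiff_const.prodMk (Bundle.contMDiff_zeroSection ℝ (TangentSpace 𝓘(ℝ, E)))
  have h2 := hφ.contMDiffOn_tangentMap.comp_contMDiff h1 fun p => hφ.zero_mem p
  refine h2.congr fun p => ?_
  have h3 := hφ.tangentMap_left (hφ.zero_mem p)
  rw [hφ.map_zero] at h3
  exact h3.symm

end RealContact

/-! ### Uniqueness of integral curves and invariance of α under the Reeb flow -/

namespace RealContact

open Filter Topology

variable {E : Type*} [NormedAddCommGroup E] [NormedSpace ℝ E]
  {M : Type*} [TopologicalSpace M] [ChartedSpace E M]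
  [IsManifold 𝓘(ℝ, E) ∞ M]
  {X : ∀ p : M, TangentSpace 𝓘(ℝ, E) p} {D : Set (ℝ × M)} {φ : ℝ → M → M}

section Chart

variable (φ) in
/-- The flow with its initial point in the chart at `q`. -/
def chartFlow (q : M) (z : ℝ × E) : M := φ z.1 ((extChartAt 𝓘(ℝ, E) q).symm z.2)

lemma IsMaximalFlow.contMDiffAt_chartFlow (hφ : IsMaximalFlow X D φ) {q : M} {z : ℝ × E}
    (hz : z.2 ∈ (extChartAt 𝓘(ℝ, E) q).target)
    (hD : (z.1, (extChartAt 𝓘(ℝ, E) q).symm z.2) ∈ D) :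
    ContMDiffAt 𝓘(ℝ, ℝ × E) 𝓘(ℝ, E) ∞ (chartFlow φ q) z := by
  have h1 : ContMDiffAt 𝓘(ℝ, E) 𝓘(ℝ, E) ∞ (extChartAt 𝓘(ℝ, E) q).symm z.2 :=
    (contMDiffOn_extChartAt_symm q).contMDiffAt
      ((isOpen_extChartAt_target (I := 𝓘(ℝ, E)) q).mem_nhds hz)
  have h2 : ContMDiffAt 𝓘(ℝ, ℝ × E) (𝓘(ℝ, ℝ).prod 𝓘(ℝ, E)) ∞
      (fun z : ℝ × E => (z.1, (extChartAt 𝓘(ℝ, E) q).symm z.2)) z :=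
    contDiff_fst.contMDiff.contMDiffAt.prodMk
      (h1.comp z contDiff_snd.contMDiff.contMDiffAt)
  exact (hφ.contMDiffAt hD).comp z h2

lemma IsMaximalFlow.mfderiv_chartFlow_left (hφ : IsMaximalFlow X D φ) {q : M} {z : ℝ × E}
    (hz : z.2 ∈ (extChartAt 𝓘(ℝ, E) q).target)
    (hD : (z.1, (extChartAt 𝓘(ℝ, E) q).symm z.2) ∈ D) :
    mfderiv 𝓘(ℝ, ℝ × E) 𝓘(ℝ, E) (chartFlow φ q) z ((1 : ℝ), (0 : E)) = X (chartFlow φ q z) := by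
  have hc := hasFDerivAt_prodMk_left (𝕜 := ℝ) z.1 z.2
  have h1 := mfderiv_comp_apply z.1 (g := chartFlow φ q) (f := fun s : ℝ => (s, z.2))
    (I := 𝓘(ℝ, ℝ)) (I' := 𝓘(ℝ, ℝ × E)) (I'' := 𝓘(ℝ, E))
    ((hφ.contMDiffAt_chartFlow hz hD).mdifferentiableAt (by simp))
    hc.differentiableAt.mdifferentiableAt (1 : ℝ)
  rw [hc.hasMFDerivAt.mfderiv] at h1
  refine h1.symm.trans ?_
  have h2 := (hφ.hasMFDerivAt hD).mfderiv
  refine (congrArg (fun L : ℝ →L[ℝ] E => L 1) h2).trans ?_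
  exact one_smul ℝ _

lemma IsMaximalFlow.mfderiv_chartFlow_right (hφ : IsMaximalFlow X D φ) {q : M} {s : ℝ}
    (hD : (s, q) ∈ D) (v : E) :
    tangentMap 𝓘(ℝ, ℝ × E) 𝓘(ℝ, E) (chartFlow φ q)
      ⟨(s, extChartAt 𝓘(ℝ, E) q q), ((0 : ℝ), v)⟩ = tangentMap 𝓘(ℝ, E) 𝓘(ℝ, E) (φ s) ⟨q, v⟩ := by
  have hq : (extChartAt 𝓘(ℝ, E) q).symm (extChartAt 𝓘(ℝ, E) q q) = q := extChartAt_to_inv q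
  have hD' : (s, (extChartAt 𝓘(ℝ, E) q).symm (extChartAt 𝓘(ℝ, E) q q)) ∈ D := by rwa [hq]
  have hc := hasFDerivAt_prodMk_right (𝕜 := ℝ) s (extChartAt 𝓘(ℝ, E) q q)
  have h1 := mfderiv_comp_apply (extChartAt 𝓘(ℝ, E) q q) (g := chartFlow φ q)
    (f := fun x : E => (s, x))
    (I := 𝓘(ℝ, E)) (I' := 𝓘(ℝ, ℝ × E)) (I'' := 𝓘(ℝ, E))
    ((hφ.contMDiffAt_chartFlow (mem_extChartAt_target q) hD').mdifferentiableAt (by simp))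
    hc.differentiableAt.mdifferentiableAt v
  rw [hc.hasMFDerivAt.mfderiv] at h1
  have h2 := mfderiv_comp_apply (extChartAt 𝓘(ℝ, E) q q) (g := φ s)
    (f := (extChartAt 𝓘(ℝ, E) q).symm)
    (I := 𝓘(ℝ, E)) (I' := 𝓘(ℝ, E)) (I'' := 𝓘(ℝ, E))
    ((hφ.contMDiffAt_time hD').mdifferentiableAt (by simp))
    ((contMDiffAt_extChartAt_symm q).mdifferentiableAt (by simp)) v
  refine bundle_ext (congrArg (φ s) hq) (h1.symm.trans (h2.trans ?_))
  have h4 := mfderiv_extChartAt_symm_self q v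
  refine (congrArg _ h4).trans ?_
  exact congrArg (fun q => (mfderiv 𝓘(ℝ, E) 𝓘(ℝ, E) (φ s) q : E →L[ℝ] E) v) hq

end Chart

section Uniqueness

variable [T2Space M]

/-- Maximality concerns open intervals around 0, so one containing both 0 and `t` is found inside
`J`; uniqueness of integral curves applies there. -/
lemma IsMaximalFlow.eq_of_isMIntegralCurveOn (hφ : IsMaximalFlow X D φ) {γ : ℝ → M} {J : Set ℝ}
    (hJ : IsOpen J) (hJ' : J.OrdConnected) (h0 : 0 ∈ J)
    (hγ : IsMIntegralCurveOn (I := 𝓘(ℝ, E)) γ X J) {t : ℝ} (ht : t ∈ J) :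
    (t, γ 0) ∈ D ∧ φ t (γ 0) = γ t := by
  obtain ⟨ε, hε, h1⟩ := Metric.isOpen_iff.1 hJ 0 h0
  obtain ⟨δ, hδ, h2⟩ := Metric.isOpen_iff.1 hJ t ht
  rw [Real.ball_eq_Ioo] at h1 h2
  set a := min (-ε) (t - δ)
  set b := max ε (t + δ)
  have ha : a < 0 := min_lt_iff.2 (.inl (by linarith))
  have hb : 0 < b := lt_max_iff.2 (.inl hε)
  have htab : t ∈ Set.Ioo a b :=
    ⟨min_lt_iff.2 (.inr (by linarith)), lt_max_iff.2 (.inr (by linarith))⟩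
  have hsub : Set.Ioo a b ⊆ J := by
    intro r hr
    simp only [a, b, Set.mem_Ioo, min_lt_iff, lt_max_iff] at hr
    by_cases hr1 : -ε < r ∧ r < ε
    · exact h1 ⟨by linarith [hr1.1], by linarith [hr1.2]⟩
    by_cases hr2 : t - δ < r ∧ r < t + δ
    · exact h2 ⟨by linarith [hr2.1], by linarith [hr2.2]⟩
    rcases le_total 0 t with ht' | ht'
    · refine hJ'.out h0 ht ⟨?_, ?_⟩ <;> grind
    · refine hJ'.out ht h0 ⟨?_, ?_⟩ <;> grind
  have h3 := hφ.maximal γ a b ha hb (hγ.mono hsub)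
  refine ⟨h3 t htab, ?_⟩
  exact isMIntegralCurveOn_Ioo_eqOn_of_contMDiff_boundaryless (I := 𝓘(ℝ, E)) (t₀ := 0) ⟨ha, hb⟩
    (hφ.contMDiff_field.of_le (by norm_cast)) ((hφ.integral (γ 0)).mono h3) (hγ.mono hsub)
    (hφ.map_zero _) htab

lemma IsMaximalFlow.map_add (hφ : IsMaximalFlow X D φ) {s t : ℝ} {q : M} (hs : (s, q) ∈ D)
    (hts : (t + s, q) ∈ D) : (t, φ s q) ∈ D ∧ φ t (φ s q) = φ (t + s) q := by
  have h := hφ.eq_of_isMIntegralCurveOn (J := {r | r + s ∈ {r | (r, q) ∈ D}})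
    ((hφ.isOpen_time q).preimage (by fun_prop))
    ⟨fun x hx y hy z hz => (hφ.ordConnected q).out hx hy ⟨by linarith [hz.1], by linarith [hz.2]⟩⟩
    (by simpa using hs) ((hφ.integral q).comp_add s) hts
  simpa using h

lemma IsMaximalFlow.eq_of_isMIntegralCurve (hφ : IsMaximalFlow X D φ) {γ : ℝ → M}
    (hγ : IsMIntegralCurve (I := 𝓘(ℝ, E)) γ X) (t : ℝ) : (t, γ 0) ∈ D ∧ φ t (γ 0) = γ t :=
  hφ.eq_of_isMIntegralCurveOn isOpen_univ Set.ordConnected_univ (Set.mem_univ 0)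
    (hγ.isMIntegralCurveOn _) (Set.mem_univ t)

end Uniqueness

section Reeb

variable [FiniteDimensional ℝ E] {α : ∀ p : M, TangentSpace 𝓘(ℝ, E) p →L[ℝ] ℝ}

/-- Let b be the pullback of α under (s, x) ↦ φ_s(x). Then b(∂_s) = α(X) = 1 is constant and db(∂_s,
v) = dα(X, ·) = 0, so ∂_s b(v) = 0. This is Cartan's formula for the Lie derivative. -/
lemma IsContactForm.hasDerivAt_flow (hα : IsContactForm α)
    (hφ : IsMaximalFlow (reebField α) D φ) {q : M} {s : ℝ} (hD : (s, q) ∈ D)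
    (v : E) :
    HasDerivAt (fun s => formFun α (tangentMap 𝓘(ℝ, E) 𝓘(ℝ, E) (φ s) ⟨q, v⟩)) 0 s := by
  set x := extChartAt 𝓘(ℝ, E) q q with hx
  have hxt : x ∈ (extChartAt 𝓘(ℝ, E) q).target := mem_extChartAt_target q
  have hq : (extChartAt 𝓘(ℝ, E) q).symm x = q := extChartAt_to_inv q
  have hD' : (s, (extChartAt 𝓘(ℝ, E) q).symm x) ∈ D := by rwa [hq]
  let b : ℝ × E → (ℝ × E →L[ℝ] ℝ) := fun z =>
    (α (chartFlow φ q z)).comp (mfderiv 𝓘(ℝ, ℝ × E) 𝓘(ℝ, E) (chartFlow φ q) z)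
  have hG := hφ.contMDiffAt_chartFlow (z := (s, x)) hxt hD'
  obtain ⟨hd, hb⟩ := fderiv_pullback_sub (b := b) hα.smooth (hG.of_le (by norm_cast))
    (Eventually.of_forall fun z w => rfl)
  have h1 := hb (1, 0) (0, v)
  have hz : extD α (chartFlow φ q (s, x))
      (mfderiv 𝓘(ℝ, ℝ × E) 𝓘(ℝ, E) (chartFlow φ q) (s, x) ((1 : ℝ), (0 : E)))
      (mfderiv 𝓘(ℝ, ℝ × E) 𝓘(ℝ, E) (chartFlow φ q) (s, x) ((0 : ℝ), v)) = 0 := by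
    rw [hφ.mfderiv_chartFlow_left (z := (s, x)) hxt hD']
    exact (hα.reebField_spec _).2 _
  have h2 : ∀ᶠ z in 𝓝 (s, x), b z (1, 0) = 1 := by
    have hc : ContinuousAt (fun z : ℝ × E => (z.1, (extChartAt 𝓘(ℝ, E) q).symm z.2)) (s, x) := by
      refine continuousAt_fst.prodMk (ContinuousAt.comp ?_ continuousAt_snd)
      exact (contMDiffAt_extChartAt_symm q).continuousAt
    filter_upwards [hc.preimage_mem_nhds (hφ.isOpen.mem_nhds hD'),
      continuousAt_snd.preimage_mem_nhds
        ((isOpen_extChartAt_target (I := 𝓘(ℝ, E)) q).mem_nhds hxt)] with z hz1 hz2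
    refine (congrArg (α (chartFlow φ q z)) (hφ.mfderiv_chartFlow_left hz2 hz1)).trans ?_
    exact (hα.reebField_spec _).1
  have h3 : fderiv ℝ b (s, x) (0, v) (1, 0) = 0 := by
    have h4 := hd.hasFDerivAt.clm_apply (hasFDerivAt_const ((1 : ℝ), (0 : E)) (s, x))
    have h5 := (h4.congr_of_eventuallyEq (h2.mono fun z hz => hz.symm :
      (fun _ => (1 : ℝ)) =ᶠ[𝓝 (s, x)] fun z => b z (1, 0))).unique (hasFDerivAt_const (1 : ℝ) (s, x))
    simpa using congrArg (fun L : ℝ × E →L[ℝ] ℝ => L (0, v)) h5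
  have h6 : fderiv ℝ b (s, x) (1, 0) (0, v) = 0 := by
    have := h1.trans hz
    linarith
  have h7 : HasDerivAt (fun r : ℝ => b (r, x) (0, v)) 0 s := by
    have h8 := (hd.hasFDerivAt.clm_apply (hasFDerivAt_const ((0 : ℝ), v) (s, x)))
    have h9 := h8.comp_hasDerivAt s ((hasDerivAt_id s).prodMk (hasDerivAt_const s x))
    exact h9.congr_deriv (by simp [h6])
  refine h7.congr_of_eventuallyEq ?_
  filter_upwards [(hφ.isOpen_time q).mem_nhds hD] with r hr
  exact congrArg (formFun α) (hφ.mfderiv_chartFlow_right hr v).symm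

/-- The Reeb flow preserves the contact form. -/
lemma IsContactForm.flow_pullback (hα : IsContactForm α)
    (hφ : IsMaximalFlow (reebField α) D φ) {q : M} {t : ℝ} (hD : (t, q) ∈ D)
    (v : TangentSpace 𝓘(ℝ, E) q) : α (φ t q) (mfderiv 𝓘(ℝ, E) 𝓘(ℝ, E) (φ t) q v) = α q v := by
  have h := (hφ.isOpen_time q).is_const_of_deriv_eq_zero (hφ.ordConnected q).isPreconnected
    (fun s hs => (hα.hasDerivAt_flow hφ hs v).differentiableAt.differentiableWithinAt)
    (fun s hs => (hα.hasDerivAt_flow hφ hs v).deriv) hD (hφ.zero_mem q)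
  refine h.trans ?_
  have h0 : φ 0 = id := funext hφ.map_zero
  rw [h0, tangentMap_id]
  rfl

/-- The Reeb flow preserves the exterior derivative of the contact form. -/
lemma IsContactForm.flow_extD (hα : IsContactForm α)
    (hφ : IsMaximalFlow (reebField α) D φ) {q : M} {t : ℝ} (hD : (t, q) ∈ D)
    (v w : TangentSpace 𝓘(ℝ, E) q) :
    extD α (φ t q) (mfderiv 𝓘(ℝ, E) 𝓘(ℝ, E) (φ t) q v) (mfderiv 𝓘(ℝ, E) 𝓘(ℝ, E) (φ t) q w) =
      extD α q v w := by
  have h := extD_map hα.smooth ((hφ.contMDiffAt_time hD).of_le (by norm_cast)) 1 (by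
    have : ∀ᶠ q' in 𝓝 q, (t, q') ∈ D :=
      (Continuous.prodMk_right t).continuousAt.eventually (hφ.isOpen.mem_nhds hD)
    filter_upwards [this] with q' hq' u
    rw [hα.flow_pullback hφ hq', one_mul]) v w
  rw [h, one_mul]

end Reeb

end RealContact

/-! ### The linearized flow in a frame as a symplectic path -/

namespace RealContact

open Filter Topology

/-- The coordinates of a continuous vector in a continuous frame are continuous. -/
lemma continuousAt_of_frame {E : Type*} [NormedAddCommGroup E] [NormedSpace ℝ E]
    [FiniteDimensional ℝ E] {B : ℝ → (ℝ × ℝ) →ₗ[ℝ] E} {a : ℝ → ℝ × ℝ} {t₀ : ℝ}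
    (hB : ∀ u, ContinuousAt (fun t => B t u) t₀) (hinj : Function.Injective (B t₀))
    (hw : ContinuousAt (fun t => B t (a t)) t₀) : ContinuousAt a t₀ := by
  -- A left inverse fixed at t₀ reduces the frame to 2 × 2 matrices with determinant 1 at t₀;
  -- Cramer's rule recovers the coordinates nearby.
  obtain ⟨L, hL⟩ := (B t₀).exists_leftInverse_of_injective (LinearMap.ker_eq_bot.2 hinj)
  have hLc : Continuous L := L.continuous_of_finiteDimensional
  have hL' : ∀ u, L (B t₀ u) = u := fun u => congrArg (fun A => A u) hL
  have hp : ∀ u, ContinuousAt (fun t => L (B t u)) t₀ := fun u => hLc.continuousAt.comp (hB u)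
  have hc : ContinuousAt (fun t => L (B t (a t))) t₀ := hLc.continuousAt.comp hw
  have hp1 := (hp (1, 0)).fst
  have hp2 := (hp (1, 0)).snd
  have hq1 := (hp (0, 1)).fst
  have hq2 := (hp (0, 1)).snd
  have hc1 := hc.fst
  have hc2 := hc.snd
  have hdet : ContinuousAt (fun t => (L (B t (1, 0))).1 * (L (B t (0, 1))).2 -
    (L (B t (1, 0))).2 * (L (B t (0, 1))).1) t₀ := (hp1.mul hq2).sub (hp2.mul hq1)
  have hdet0 : (L (B t₀ (1, 0))).1 * (L (B t₀ (0, 1))).2 -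
    (L (B t₀ (1, 0))).2 * (L (B t₀ (0, 1))).1 ≠ 0 := by simp [hL']
  have hexp : ∀ t, L (B t (a t)) = (a t).1 • L (B t (1, 0)) + (a t).2 • L (B t (0, 1)) := by
    intro t
    rw [← map_smul, ← map_smul, ← map_smul, ← map_smul, ← map_add, ← map_add]
    simp
  have hne := hdet.eventually_ne hdet0
  have h1 : ContinuousAt (fun t => (a t).1) t₀ := by
    refine (((hc1.mul hq2).sub (hc2.mul hq1)).div hdet hdet0).congr ?_
    filter_upwards [hne] with t ht
    simp only [Pi.div_apply, Pi.sub_apply, Pi.mul_apply]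
    rw [div_eq_iff ht, hexp t]
    simp only [Prod.fst_add, Prod.snd_add, Prod.smul_fst, Prod.smul_snd, smul_eq_mul]
    ring
  have h2 : ContinuousAt (fun t => (a t).2) t₀ := by
    refine (((hp1.mul hc2).sub (hp2.mul hc1)).div hdet hdet0).congr ?_
    filter_upwards [hne] with t ht
    simp only [Pi.div_apply, Pi.sub_apply, Pi.mul_apply]
    rw [div_eq_iff ht, hexp t]
    simp only [Prod.fst_add, Prod.snd_add, Prod.smul_fst, Prod.smul_snd, smul_eq_mul]
    ring
  exact h1.prodMk h2

variable {E : Type*} [NormedAddCommGroup E] [NormedSpace ℝ E]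
  {M : Type*} [TopologicalSpace M] [ChartedSpace E M]

lemma tangentBundle_eq_mk {q : M} {z : TangentBundle 𝓘(ℝ, E) M} (h : z.proj = q) :
    ∃ w : TangentSpace 𝓘(ℝ, E) q, z = ⟨q, w⟩ := by
  subst h
  exact ⟨z.snd, rfl⟩

variable [IsManifold 𝓘(ℝ, E) ∞ M]

section Trivialization

variable {α : ∀ p : M, TangentSpace 𝓘(ℝ, E) p →L[ℝ] ℝ} {P : ℝ → M} {T : ℝ}
  {Φ : ∀ t : ℝ, (ℝ × ℝ) →L[ℝ] TangentSpace 𝓘(ℝ, E) (P t)}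

lemma IsTrivialization.injective (hΦ : IsTrivialization α P T Φ) (t : ℝ) :
    Function.Injective (Φ t) := by
  rw [injective_iff_map_eq_zero]
  intro u hu
  have h : ∀ v, RobbinSalamon.omegaStd u v = 0 := fun v => by
    rw [← hΦ.symplectic t, hu, extD_eq_extDBilin]
    exact congrArg (fun L : E →ₗ[ℝ] ℝ => L (Φ t v)) (map_zero (extDBilin α (P t)))
  have h1 := h (0, 1)
  have h2 := h (1, 0)
  simp only [RobbinSalamon.omegaStd, LinearMap.mk₂_apply] at h1 h2
  ext <;> simp <;> linarith

lemma IsTrivialization.eq_of_mk_eq (hΦ : IsTrivialization α P T Φ) {t : ℝ} {u v : ℝ × ℝ}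
    (h : (⟨P t, Φ t u⟩ : TangentBundle 𝓘(ℝ, E) M) = ⟨P t, Φ t v⟩) : u = v :=
  hΦ.injective t (bundle_mk_inj h)

variable [FiniteDimensional ℝ E]

lemma IsTrivialization.exists_eq (hΦ : IsTrivialization α P T Φ) (hα : IsContactForm α)
    (hE : Module.finrank ℝ E = 3) {t : ℝ} {w : TangentSpace 𝓘(ℝ, E) (P t)} (hw : α (P t) w = 0) :
    ∃ u, Φ t u = w := by
  let a : E →L[ℝ] ℝ := α (P t)
  let B : (ℝ × ℝ) →L[ℝ] E := Φ t
  have ha : (a : E →ₗ[ℝ] ℝ) ≠ 0 := fun h => hα.ne_zero (P t) (ContinuousLinearMap.coe_injective h)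
  have hle : LinearMap.range (B : (ℝ × ℝ) →ₗ[ℝ] E) ≤ LinearMap.ker (a : E →ₗ[ℝ] ℝ) := by
    rintro _ ⟨u, rfl⟩
    exact hΦ.mem_ker t u
  have h1 : Module.finrank ℝ (LinearMap.range (B : (ℝ × ℝ) →ₗ[ℝ] E)) = 2 := by
    have hB : Function.Injective (B : (ℝ × ℝ) →ₗ[ℝ] E) := hΦ.injective t
    rw [LinearMap.finrank_range_of_inj hB]
    simp
  have h2 := Module.Dual.finrank_ker_add_one_of_ne_zero ha
  have h3 := Submodule.eq_of_le_of_finrank_eq hle (by omega)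
  have h4 : (w : E) ∈ LinearMap.range (B : (ℝ × ℝ) →ₗ[ℝ] E) := by
    rw [h3]; exact hw
  exact h4

end Trivialization

variable [FiniteDimensional ℝ E]

/-- The coordinates of a continuous tangent field along a curve in a continuous frame are
continuous. -/
lemma continuous_of_tangent_frame {P : ℝ → M}
    {Φ : ∀ t : ℝ, (ℝ × ℝ) →L[ℝ] TangentSpace 𝓘(ℝ, E) (P t)} {a : ℝ → ℝ × ℝ}
    (hΦ : ∀ u, Continuous fun t => (⟨P t, Φ t u⟩ : TangentBundle 𝓘(ℝ, E) M))
    (hinj : ∀ t, Function.Injective (Φ t))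
    (ha : Continuous fun t => (⟨P t, Φ t (a t)⟩ : TangentBundle 𝓘(ℝ, E) M)) : Continuous a := by
  rw [continuous_iff_continuousAt]
  intro t₀
  set e := trivializationAt E (TangentSpace 𝓘(ℝ, E)) (P t₀) with he
  have hP : Continuous P :=
    (FiberBundle.continuous_proj E (TangentSpace 𝓘(ℝ, E))).comp (hΦ 0)
  have hbase : ∀ᶠ t in 𝓝 t₀, P t ∈ e.baseSet := hP.continuousAt.eventually
    (e.open_baseSet.mem_nhds (FiberBundle.mem_baseSet_trivializationAt' (P t₀)))
  have key : ∀ b : ℝ → ℝ × ℝ, (Continuous fun t => (⟨P t, Φ t (b t)⟩ : TangentBundle 𝓘(ℝ, E) M)) →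
      ContinuousAt (fun t => (e.continuousLinearMapAt ℝ (P t)) (Φ t (b t))) t₀ := by
    intro b hb
    have h1 := ((FiberBundle.continuousAt_totalSpace (F := E) _).1 (hb.continuousAt (x := t₀))).2
    refine h1.congr ?_
    filter_upwards [hbase] with t ht
    rw [Bundle.Trivialization.continuousLinearMapAt_apply, Bundle.Trivialization.coe_linearMapAt_of_mem _ ht]
  refine continuousAt_of_frame
    (B := fun t => (e.continuousLinearMapAt ℝ (P t) : TangentSpace 𝓘(ℝ, E) (P t) →ₗ[ℝ] E) ∘ₗ
      (Φ t : (ℝ × ℝ) →ₗ[ℝ] TangentSpace 𝓘(ℝ, E) (P t)))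
    (fun u => key (fun _ => u) (hΦ u)) ?_ (key a ha)
  have hbs : P t₀ ∈ e.baseSet := FiberBundle.mem_baseSet_trivializationAt' (P t₀)
  refine Function.Injective.comp (g := e.continuousLinearMapAt ℝ (P t₀)) ?_ (hinj t₀)
  exact Function.LeftInverse.injective (g := e.symmL ℝ (P t₀))
    fun v => e.symmL_continuousLinearMapAt hbs v

section LinearizedFlow

variable [T2Space M] {α : ∀ p : M, TangentSpace 𝓘(ℝ, E) p →L[ℝ] ℝ} {P : ℝ → M} {T : ℝ}
  {Φ : ∀ t : ℝ, (ℝ × ℝ) →L[ℝ] TangentSpace 𝓘(ℝ, E) (P t)} {D : Set (ℝ × M)} {φ : ℝ → M → M}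

/-- The flow preserves α, hence its kernel, which the injective frame fills by dimension. The matrix
sought by the choice operator therefore exists. -/
lemma linearizedFlow_spec (hα : IsContactForm α) (hφ : IsMaximalFlow (reebField α) D φ)
    (hE : Module.finrank ℝ E = 3) (hP : IsMIntegralCurve (I := 𝓘(ℝ, E)) P (reebField α))
    (hΦ : IsTrivialization α P T Φ) (t : ℝ) (u : ℝ × ℝ) :
    tangentMap 𝓘(ℝ, E) 𝓘(ℝ, E) (φ t) ⟨P 0, Φ 0 u⟩ = ⟨P t, Φ t (linearizedFlow φ P Φ t u)⟩ := by
  refine Classical.epsilon_spec (p := fun A : (ℝ × ℝ) →ₗ[ℝ] (ℝ × ℝ) => ∀ u,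
    tangentMap 𝓘(ℝ, E) 𝓘(ℝ, E) (φ t) ⟨P 0, Φ 0 u⟩ = ⟨P t, Φ t (A u)⟩) ?_ u
  obtain ⟨hD, hPt⟩ := hφ.eq_of_isMIntegralCurve hP t
  have hex : ∀ u, ∃ u', tangentMap 𝓘(ℝ, E) 𝓘(ℝ, E) (φ t) ⟨P 0, Φ 0 u⟩ = ⟨P t, Φ t u'⟩ := by
    intro u
    obtain ⟨w, hw⟩ := tangentBundle_eq_mk
      (z := tangentMap 𝓘(ℝ, E) 𝓘(ℝ, E) (φ t) ⟨P 0, Φ 0 u⟩) hPt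
    have h1 : α (P t) w = 0 := by
      have h2 := congrArg (formFun α) hw
      refine h2.symm.trans ?_
      exact (hα.flow_pullback hφ hD (Φ 0 u)).trans (hΦ.mem_ker 0 u)
    obtain ⟨u', hu'⟩ := hΦ.exists_eq hα hE h1
    exact ⟨u', by rw [hw, hu']⟩
  let B : (ℝ × ℝ) →L[ℝ] E := Φ t
  let B₀ : (ℝ × ℝ) →L[ℝ] E := Φ 0
  let d : E →L[ℝ] E := mfderiv 𝓘(ℝ, E) 𝓘(ℝ, E) (φ t) (P 0)
  obtain ⟨L, hL⟩ := (B : (ℝ × ℝ) →ₗ[ℝ] E).exists_leftInverse_of_injective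
    (LinearMap.ker_eq_bot.2 (hΦ.injective t))
  refine ⟨L ∘ₗ (d.comp B₀ : (ℝ × ℝ) →L[ℝ] E), fun u => ?_⟩
  obtain ⟨u', hu'⟩ := hex u
  have h3 : d (B₀ u) = B u' := by
    have := congrArg (fun z : TangentBundle 𝓘(ℝ, E) M => (z.snd : E)) hu'
    exact this
  have h4 : L (d (B₀ u)) = u' := by
    rw [h3]
    exact congrArg (fun A : (ℝ × ℝ) →ₗ[ℝ] (ℝ × ℝ) => A u') hL
  exact hu'.trans (by rw [← h4]; rfl)

/-- The linearized Reeb flow along an orbit is a path of symplectic maps. -/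
lemma isSymplecticPath_linearizedFlow (hα : IsContactForm α)
    (hφ : IsMaximalFlow (reebField α) D φ)
    (hE : Module.finrank ℝ E = 3) (hP : IsMIntegralCurve (I := 𝓘(ℝ, E)) P (reebField α))
    (hΦ : IsTrivialization α P T Φ) :
    RobbinSalamon.IsSymplecticPath (linearizedFlow φ P Φ) where
  continuous u := by
    refine continuous_of_tangent_frame hΦ.continuous hΦ.injective ?_
    simp_rw [← linearizedFlow_spec hα hφ hE hP hΦ]
    have h1 : ContMDiff 𝓘(ℝ, ℝ) (𝓘(ℝ, ℝ).tangent.prod 𝓘(ℝ, E).tangent) ∞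
        (fun t : ℝ => ((⟨t, (0 : ℝ)⟩ : TangentBundle 𝓘(ℝ, ℝ) ℝ),
          (⟨P 0, Φ 0 u⟩ : TangentBundle 𝓘(ℝ, E) M))) :=
      (Bundle.contMDiff_zeroSection ℝ (TangentSpace 𝓘(ℝ, ℝ) (M := ℝ))).prodMk contMDiff_const
    have hD : ∀ t, (t, P 0) ∈ D := fun t => (hφ.eq_of_isMIntegralCurve hP t).1
    have h2 := hφ.contMDiffOn_tangentMap.comp_contMDiff h1 fun t => hD t
    refine h2.continuous.congr fun t => ?_
    exact hφ.tangentMap_right (hD t) _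
  symplectic t u v := by
    rw [← hΦ.symplectic t, ← hΦ.symplectic 0,
      ← hα.flow_extD hφ (hφ.eq_of_isMIntegralCurve hP t).1]
    exact (extD_congr (linearizedFlow_spec hα hφ hE hP hΦ t u)
      (linearizedFlow_spec hα hφ hE hP hΦ t v)).symm
  map_zero := by
    refine LinearMap.ext fun u => hΦ.eq_of_mk_eq (t := 0) ?_
    rw [← linearizedFlow_spec hα hφ hE hP hΦ, show φ 0 = id from funext hφ.map_zero, tangentMap_id]
    rfl

/-- The group law of the flow holds near P(0) because its domain is open, so it can be
differentiated; periodicity identifies the frames at T and 0. -/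
lemma linearizedFlow_add_period (hα : IsContactForm α)
    (hφ : IsMaximalFlow (reebField α) D φ)
    (hE : Module.finrank ℝ E = 3) (hP : IsMIntegralCurve (I := 𝓘(ℝ, E)) P (reebField α))
    (hΦ : IsTrivialization α P T Φ) (t : ℝ) :
    linearizedFlow φ P Φ (t + T) = linearizedFlow φ P Φ t ∘ₗ linearizedFlow φ P Φ T := by
  refine LinearMap.ext fun u => hΦ.eq_of_mk_eq (t := t + T) ?_
  have hD : ∀ t, (t, P 0) ∈ D := fun t => (hφ.eq_of_isMIntegralCurve hP t).1
  rw [← linearizedFlow_spec hα hφ hE hP hΦ, hΦ.periodic]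
  have h1 : φ (t + T) =ᶠ[𝓝 (P 0)] φ t ∘ φ T := by
    filter_upwards [(Continuous.prodMk_right T).continuousAt.eventually (hφ.isOpen.mem_nhds (hD T)),
      (Continuous.prodMk_right (t + T)).continuousAt.eventually
        (hφ.isOpen.mem_nhds (hD (t + T)))] with q h1 h2
    exact (hφ.map_add h1 h2).2.symm
  rw [tangentMap_congr h1, tangentMap_comp_at (I' := 𝓘(ℝ, E)) _
      ((hφ.contMDiffAt_time (hφ.map_add (hD T) (hD (t + T))).1).mdifferentiableAt (by simp))
      ((hφ.contMDiffAt_time (hD T)).mdifferentiableAt (by simp)),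
    linearizedFlow_spec hα hφ hE hP hΦ]
  have h2 := hΦ.periodic 0 (linearizedFlow φ P Φ T u)
  rw [zero_add] at h2
  rw [h2, linearizedFlow_spec hα hφ hE hP hΦ]
  rfl

end LinearizedFlow

end RealContact

/-! ### Real structures, doubled chords and time reversal -/

namespace RealContact

open Filter Topology

lemma chordCurve_add_int_mul {M : Type*} {ρ : M → M} {C : ℝ → M} {τ : ℝ} (hτ : 0 < τ) (t : ℝ) (k : ℤ) :
    chordCurve ρ C τ (t + 2 * τ * k) = chordCurve ρ C τ t := by
  have h1 : (t + 2 * τ * k) / (2 * τ) = t / (2 * τ) + k := by field_simp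
  have h2 : t + 2 * τ * k - 2 * τ * (⌊t / (2 * τ) + k⌋ : ℤ) = t - 2 * τ * ⌊t / (2 * τ)⌋ := by
    rw [Int.floor_add_intCast]; push_cast; ring
  simp only [chordCurve, h1, h2]

variable {E : Type*} [NormedAddCommGroup E] [NormedSpace ℝ E]
  {M : Type*} [TopologicalSpace M] [ChartedSpace E M]
  {α : ∀ p : M, TangentSpace 𝓘(ℝ, E) p →L[ℝ] ℝ} {ρ : M → M} {C : ℝ → M} {τ : ℝ}

lemma IsChord.chordCurve_eq_left (hC : IsChord α ρ C τ) {t : ℝ} (ht : t ∈ Set.Icc 0 τ) :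
    chordCurve ρ C τ t = C t := by
  have hτ := hC.pos
  have h1 : ⌊t / (2 * τ)⌋ = 0 := by
    rw [Int.floor_eq_zero_iff]
    exact ⟨div_nonneg ht.1 (by linarith), (div_lt_one (by linarith)).2 (by linarith [ht.2])⟩
  simp [chordCurve, h1, ht.2]

lemma IsChord.chordCurve_eq_right (hC : IsChord α ρ C τ) {t : ℝ} (ht : t ∈ Set.Icc (-τ) 0) :
    chordCurve ρ C τ t = ρ (C (-t)) := by
  have hτ := hC.pos
  rcases ht.2.eq_or_lt with rfl | h0
  · rw [hC.chordCurve_eq_left ⟨le_rfl, hτ.le⟩, neg_zero, hC.left_fixed]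
  have h1 : ⌊t / (2 * τ)⌋ = -1 := by
    rw [Int.floor_eq_iff]
    push_cast
    constructor
    · rw [le_div_iff₀ (by linarith)]; linarith [ht.1]
    · rw [div_lt_iff₀ (by linarith)]; linarith
  simp only [chordCurve, h1]
  push_cast
  -- At t = -τ the reduced time is τ, which falls in the first branch of `chordCurve`; the branches
  -- agree because the right end point is fixed.
  rcases ht.1.eq_or_lt with h2 | h2
  · rw [if_pos (by linarith), ← h2]
    ring_nf
    exact hC.right_fixed.symm
  · rw [if_neg (by linarith)]
    ring_nf

/-- Differentiating ρ ∘ ρ = id gives the preimage as the image of `v` under Tρ. -/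
lemma IsRealStructure.surjective_mfderiv (hρ : IsRealStructure α ρ) (q : M)
    (v : TangentSpace 𝓘(ℝ, E) (ρ q)) : ∃ w, mfderiv 𝓘(ℝ, E) 𝓘(ℝ, E) ρ q w = v := by
  have hd : MDifferentiable 𝓘(ℝ, E) 𝓘(ℝ, E) ρ := hρ.smooth.mdifferentiable (by simp)
  obtain ⟨w, hw⟩ := tangentBundle_eq_mk
    (z := tangentMap 𝓘(ℝ, E) 𝓘(ℝ, E) ρ ⟨ρ q, v⟩) (hρ.involutive q)
  refine ⟨w, bundle_mk_inj ?_⟩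
  have h1 : tangentMap 𝓘(ℝ, E) 𝓘(ℝ, E) ρ ⟨q, w⟩ = ⟨ρ q, v⟩ := by
    rw [← hw, ← tangentMap_comp_at (I' := 𝓘(ℝ, E)) _ (hd _) (hd _), hρ.involutive.comp_self,
      tangentMap_id]
    rfl
  exact h1

variable [FiniteDimensional ℝ E] [IsManifold 𝓘(ℝ, E) ∞ M]

/-- A real structure reverses the Reeb field. -/
lemma IsRealStructure.mfderiv_reebField (hρ : IsRealStructure α ρ) (hα : IsContactForm α) (q : M) :
    mfderiv 𝓘(ℝ, E) 𝓘(ℝ, E) ρ q (reebField α q) = -reebField α (ρ q) := by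
  obtain ⟨h1, h2⟩ := hα.reebField_spec q
  rw [← neg_eq_iff_eq_neg]
  refine hα.eq_reebField ?_ fun w => ?_
  · rw [map_neg, hρ.pullback, h1, neg_neg]
  · obtain ⟨w, rfl⟩ := hρ.surjective_mfderiv q w
    have h3 := extD_map hα.smooth ((hρ.smooth q).of_le (by norm_cast)) (-1)
      (Eventually.of_forall fun q v => by rw [hρ.pullback, neg_one_mul]) (reebField α q) w
    rw [h2, mul_zero] at h3
    rw [extD_eq_extDBilin] at h3 ⊢
    refine (congrArg (fun L : E →ₗ[ℝ] ℝ => L (mfderiv 𝓘(ℝ, E) 𝓘(ℝ, E) ρ q w))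
      (map_neg (extDBilin α (ρ q)) _)).trans ?_
    exact (congrArg Neg.neg h3).trans neg_zero

/-- A real structure reflects integral curves of the Reeb field. -/
lemma IsRealStructure.isMIntegralCurveOn (hρ : IsRealStructure α ρ) (hα : IsContactForm α)
    {γ : ℝ → M} {J : Set ℝ} (hγ : IsMIntegralCurveOn (I := 𝓘(ℝ, E)) γ (reebField α) J) :
    IsMIntegralCurveOn (I := 𝓘(ℝ, E)) (fun t => ρ (γ (-t))) (reebField α) {t | -t ∈ J} := by
  have h1 := hγ.comp_mul (-1)
  simp only [mul_neg, mul_one] at h1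
  intro t ht
  have h2 := h1 t ht
  have h3 : HasMFDerivAt 𝓘(ℝ, E) 𝓘(ℝ, E) ρ ((γ ∘ fun x => -x) t)
      (mfderiv 𝓘(ℝ, E) 𝓘(ℝ, E) ρ (γ (-t))) :=
    ((hρ.smooth.mdifferentiable (by simp)) (γ (-t))).hasMFDerivAt
  refine (h3.comp_hasMFDerivWithinAt t h2).congr_mfderiv (ContinuousLinearMap.ext_ring ?_)
  have h5 : mfderiv 𝓘(ℝ, E) 𝓘(ℝ, E) ρ (γ (-t)) ((1 : ℝ) • ((-1 : ℝ) • reebField α (γ (-t)))) =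
      (1 : ℝ) • reebField α (ρ (γ (-t))) := by
    rw [map_smul, map_smul, hρ.mfderiv_reebField hα, neg_one_smul, neg_neg]
  exact h5

/-- The doubled chord is an integral curve of the Reeb field. -/
lemma IsChord.isMIntegralCurve_chordCurve (hC : IsChord α ρ C τ) (hρ : IsRealStructure α ρ)
    (hα : IsContactForm α) : IsMIntegralCurve (I := 𝓘(ℝ, E)) (chordCurve ρ C τ) (reebField α) := by
  have hτ := hC.pos
  have h1 : IsMIntegralCurveOn (I := 𝓘(ℝ, E)) (chordCurve ρ C τ) (reebField α) (Set.Icc 0 τ) := by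
    intro t ht
    have h := (hC.integral t ht).congr_mono (f₁ := chordCurve ρ C τ)
      (fun s hs => hC.chordCurve_eq_left hs) (hC.chordCurve_eq_left ht) subset_rfl
    rw [hC.chordCurve_eq_left ht]
    exact h
  have h2 : IsMIntegralCurveOn (I := 𝓘(ℝ, E)) (chordCurve ρ C τ) (reebField α)
      (Set.Icc (-τ) 0) := by
    have h3 := (hρ.isMIntegralCurveOn hα hC.integral).mono (s' := Set.Icc (-τ) 0) (fun t ht =>
      (⟨by linarith [ht.2], by linarith [ht.1]⟩ : -t ∈ Set.Icc 0 τ))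
    intro t ht
    have h := (h3 t ht).congr_mono (f₁ := chordCurve ρ C τ)
      (fun s hs => hC.chordCurve_eq_right hs) (hC.chordCurve_eq_right ht) subset_rfl
    rw [hC.chordCurve_eq_right ht]
    exact h
  have hshift : ∀ (k : ℤ) (J : Set ℝ),
      IsMIntegralCurveOn (I := 𝓘(ℝ, E)) (chordCurve ρ C τ) (reebField α) J →
      IsMIntegralCurveOn (I := 𝓘(ℝ, E)) (chordCurve ρ C τ) (reebField α)
        {t | t + 2 * τ * k ∈ J} := by
    intro k J hJ
    have h4 := hJ.comp_add (2 * τ * k)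
    have h5 : (chordCurve ρ C τ ∘ fun x => x + 2 * τ * k) = chordCurve ρ C τ :=
      funext fun t => chordCurve_add_int_mul hτ t k
    rwa [h5] at h4
  -- Pieces with even index are translates of [0, τ], those with odd index of [-τ, 0].
  have hpiece : ∀ k : ℤ, IsMIntegralCurveOn (I := 𝓘(ℝ, E)) (chordCurve ρ C τ) (reebField α)
      (Set.Icc (k * τ) ((k + 1) * τ)) := by
    intro k
    rcases Int.even_or_odd' k with ⟨j, rfl | rfl⟩
    · refine (hshift (-j) _ h1).mono fun t ht => ?_
      simp only [Set.mem_Icc] at ht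
      push_cast at ht
      exact ⟨by push_cast; linarith [ht.1], by push_cast; linarith [ht.2]⟩
    · refine (hshift (-j - 1) _ h2).mono fun t ht => ?_
      simp only [Set.mem_Icc] at ht
      push_cast at ht
      exact ⟨by push_cast; linarith [ht.1], by push_cast; linarith [ht.2]⟩
  intro t
  have hk1 : ⌊t / τ⌋ * τ ≤ t := (le_div_iff₀ hτ).1 (Int.floor_le _)
  have hk2 : t < (⌊t / τ⌋ + 1) * τ := (div_lt_iff₀ hτ).1 (Int.lt_floor_add_one _)
  generalize ⌊t / τ⌋ = k at hk1 hk2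
  -- At a junction the two adjacent closed pieces form a neighbourhood, and their one-sided
  -- derivatives are the same Reeb vector.
  rcases hk1.eq_or_lt with h | h
  · have h3 := hpiece k t ⟨hk1, hk2.le⟩
    have h4 := hpiece (k - 1) t (by push_cast; exact ⟨by linarith, by linarith⟩)
    refine (h3.union h4).hasMFDerivAt ?_
    rw [Set.union_comm]
    push_cast
    rw [sub_add_cancel, Set.Icc_union_Icc_eq_Icc (by linarith) (by linarith)]
    exact Icc_mem_nhds (by linarith) hk2
  · exact (hpiece k t ⟨hk1, hk2.le⟩).hasMFDerivAt (Icc_mem_nhds h hk2)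

section Symmetry

variable [T2Space M] {P : ℝ → M} {T : ℝ}
  {Φ : ∀ t : ℝ, (ℝ × ℝ) →L[ℝ] TangentSpace 𝓘(ℝ, E) (P t)} {D : Set (ℝ × M)} {φ : ℝ → M → M}

/-- A real structure reverses the Reeb flow. -/
lemma IsRealStructure.flow_neg (hρ : IsRealStructure α ρ) (hα : IsContactForm α)
    (hφ : IsMaximalFlow (reebField α) D φ) {t : ℝ} {q : M} (h : (t, q) ∈ D) :
    (-t, ρ q) ∈ D ∧ φ (-t) (ρ q) = ρ (φ t q) := by
  have h1 := hφ.eq_of_isMIntegralCurveOn (J := {r | -r ∈ {r | (r, q) ∈ D}}) (t := -t)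
    ((hφ.isOpen_time q).preimage continuous_neg)
    ⟨fun x hx y hy z hz => (hφ.ordConnected q).out hy hx ⟨by linarith [hz.2], by linarith [hz.1]⟩⟩
    (by simpa using hφ.zero_mem q) (hρ.isMIntegralCurveOn hα (hφ.integral q)) (by simpa using h)
  simpa [hφ.map_zero] using h1

/-- Differentiate φ^{-t} ∘ ρ = ρ ∘ φ^t at P(0) and replace Tρ by I in the symmetric frame at times 0
and t. -/
lemma linearizedFlow_neg (hρ : IsRealStructure α ρ) (hα : IsContactForm α)
    (hφ : IsMaximalFlow (reebField α) D φ)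
    (hE : Module.finrank ℝ E = 3) (hP : IsMIntegralCurve (I := 𝓘(ℝ, E)) P (reebField α))
    (hΦ : IsSymmetricTrivialization α ρ P T Φ) (t x y : ℝ) :
    linearizedFlow φ P Φ (-t) (x, -y) =
      ((linearizedFlow φ P Φ t (x, y)).1, -(linearizedFlow φ P Φ t (x, y)).2) := by
  have hΦ' := hΦ.toIsTrivialization
  have hd : MDifferentiable 𝓘(ℝ, E) 𝓘(ℝ, E) ρ := hρ.smooth.mdifferentiable (by simp)
  have hD : ∀ t, (t, P 0) ∈ D := fun t => (hφ.eq_of_isMIntegralCurve hP t).1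
  refine hΦ'.eq_of_mk_eq (t := -t) ?_
  rw [← linearizedFlow_spec hα hφ hE hP hΦ', ← hΦ.symmetric t, Prod.mk.eta,
    ← linearizedFlow_spec hα hφ hE hP hΦ']
  have h0 := hΦ.symmetric 0 x y
  rw [neg_zero] at h0
  rw [← h0]
  have h1 : φ (-t) ∘ ρ =ᶠ[𝓝 (P 0)] ρ ∘ φ t := by
    filter_upwards [(Continuous.prodMk_right t).continuousAt.eventually
      (hφ.isOpen.mem_nhds (hD t))] with q hq
    exact (hρ.flow_neg hα hφ hq).2
  have h2 := hρ.flow_neg hα hφ (hD t)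
  rw [← tangentMap_comp_at (I' := 𝓘(ℝ, E)) _
      ((hφ.contMDiffAt_time h2.1).mdifferentiableAt (by simp)) (hd _),
    ← tangentMap_comp_at (I' := 𝓘(ℝ, E)) _ (hd _)
      ((hφ.contMDiffAt_time (hD t)).mdifferentiableAt (by simp))]
  exact tangentMap_congr h1 _

end Symmetry

end RealContact

end

/-! ### Reduction of the contact statements to symplectic paths -/

theorem mainTheorem9 {M : Type*} [TopologicalSpace M] [T2Space M]
    [ChartedSpace (EuclideanSpace ℝ (Fin 3)) M] [IsManifold (𝓡 3) ∞ M]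
    (α : ∀ p : M, TangentSpace (𝓡 3) p →L[ℝ] ℝ) (hα : RealContact.IsContactForm α)
    (D : Set (ℝ × M)) (φ : ℝ → M → M)
    (hφ : RealContact.IsMaximalFlow (RealContact.reebField α) D φ) :
    (∀ (P : ℝ → M) (T : ℝ), RealContact.IsPeriodicOrbit α P T →
      ∀ Φ : ∀ t : ℝ, (ℝ × ℝ) →L[ℝ] TangentSpace (𝓡 3) (P t),
      RealContact.IsTrivialization α P T Φ →
      ∀ m : ℕ, 1 ≤ m →
        (RealContact.muCZ φ P Φ T < 1 → RealContact.muCZ φ P Φ (m * T) < 1) ∧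
        (1 ≤ RealContact.muCZ φ P Φ T → 1 ≤ RealContact.muCZ φ P Φ (m * T)) ∧
        (3 ≤ RealContact.muCZ φ P Φ T → 2 * (m : ℝ) + 1 ≤ RealContact.muCZ φ P Φ (m * T))) ∧
    (∀ ρ : M → M, RealContact.IsRealStructure α ρ →
      ∀ (C : ℝ → M) (τ : ℝ), RealContact.IsChord α ρ C τ →
      ∀ Φ : ∀ t : ℝ, (ℝ × ℝ) →L[ℝ] TangentSpace (𝓡 3) (RealContact.chordCurve ρ C τ t),
      RealContact.IsSymmetricTrivialization α ρ (RealContact.chordCurve ρ C τ) (2 * τ) Φ →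
      ∀ m : ℕ, 1 ≤ m →
        (RealContact.muRS φ (RealContact.chordCurve ρ C τ) Φ τ < 1 / 2 →
          RealContact.muRS φ (RealContact.chordCurve ρ C τ) Φ (m * τ) < 1 / 2) ∧
        (1 / 2 ≤ RealContact.muRS φ (RealContact.chordCurve ρ C τ) Φ τ →
          1 / 2 ≤ RealContact.muRS φ (RealContact.chordCurve ρ C τ) Φ (m * τ)) ∧
        (3 / 2 ≤ RealContact.muRS φ (RealContact.chordCurve ρ C τ) Φ τ →
          (2 * (m : ℝ) + 1) / 2 ≤ RealContact.muRS φ (RealContact.chordCurve ρ C τ) Φ (m * τ))) ∧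
    (∀ ρ : M → M, RealContact.IsRealStructure α ρ →
      ∀ (P : ℝ → M) (T : ℝ), RealContact.IsPeriodicOrbit α P T →
      ∀ (C : ℝ → M) (τ : ℝ), RealContact.IsChord α ρ C τ →
      T = 2 * τ → P = RealContact.chordCurve ρ C τ →
      ∀ Φ : ∀ t : ℝ, (ℝ × ℝ) →L[ℝ] TangentSpace (𝓡 3) (P t),
      RealContact.IsSymmetricTrivialization α ρ P T Φ →
        3 ≤ RealContact.muCZ φ P Φ T → 3 / 2 ≤ RealContact.muRS φ P Φ τ) := by
  have hE : Module.finrank ℝ (EuclideanSpace ℝ (Fin 3)) = 3 := finrank_euclideanSpace_fin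
  refine ⟨fun P T hP Φ hΦ m hm => ?_, fun ρ hρ C τ hC Φ hΦ m hm => ?_,
    fun ρ hρ P T hP C τ hC hT hPC Φ hΦ h3 => ?_⟩
  · exact RobbinSalamon.conleyZehnder_iterate
      (RealContact.isSymplecticPath_linearizedFlow hα hφ hE hP.integral hΦ) hP.pos
      (RealContact.linearizedFlow_add_period hα hφ hE hP.integral hΦ) hm
  · have hP := hC.isMIntegralCurve_chordCurve hρ hα
    exact RobbinSalamon.realAxisIndex_iterate
      (RealContact.isSymplecticPath_linearizedFlow hα hφ hE hP hΦ.toIsTrivialization) hC.pos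
      (RealContact.linearizedFlow_add_period hα hφ hE hP hΦ.toIsTrivialization)
      (RealContact.linearizedFlow_neg hρ hα hφ hE hP hΦ) hm
  · subst hT
    exact RobbinSalamon.le_realAxisIndex_of_le_conleyZehnder
      (RealContact.isSymplecticPath_linearizedFlow hα hφ hE hP.integral hΦ.toIsTrivialization)
      hC.pos (RealContact.linearizedFlow_add_period hα hφ hE hP.integral hΦ.toIsTrivialization)
      (RealContact.linearizedFlow_neg hρ hα hφ hE hP.integral hΦ) h3
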